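/- Let $d\ge 2$ and let $\Omega\subset\mathbb R^d$ be open and bounded. Let $g(s)=\sum_{i=0}^N a_i s^{\alpha_i}$ for $s\ge 0$, where $N\ge 1$, $0=\alpha_0<\alpha_1<\dots<\alpha_N$, $a_i\ge 0$, $a_0>0$, $a_N>0$. For $\xi\ge 0$ put $K(\xi)=1/g(s(\xi))$, where $s(\xi)\ge 0$ is the unique non-negative solution of $s\,g(s)=\xi$. Let $$a=\frac{\alpha_N}{\alpha_N+1},\qquad \beta=2-a,\qquad \lambda=\frac{2-a}{1-a},$$ and assume the degree condition $a\le \frac{4}{d+2}$. Let $\mathcal T_h$ be a triangulation of $\Omega$ (possibly with curved cells) with mesh size $h$, the maximal diameter of a cell, belonging to a globally quasi-uniform family: every cell is star-shaped with respect to a ball of radius $\sigma h$, with a fixed $\sigma>0$. Let $W_h$ be the space of discontinuous piecewise polynomials of degree at most $r\ge 0$ over $\mathcal T_h$, and let $\pi$ be the $L^2(\Omega)$-orthogonal projection onto $W_h$. Gradients of elements of $W_h$ are taken elementwise. Write $(\cdot,\cdot)$ and $\|\cdot\|$ for the inner product and norm of $L^2(\Omega)$, $\|\cdot\|_1$ for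 the norm of $H^1(\Omega)$, and $\|v\|_{0,\beta}^\beta=\int_\Omega |v|^\beta\,dx$. Let $\rho^0\in L^2(\Omega)$, $f\in C([0,\infty);L^2(\Omega))$ and $\phi\in C^1([0,\infty);H^1(\Omega))$; here $\phi$ is an extension to $\Omega$ of the Dirichlet boundary data. Put $\tilde f=f-\phi_t$ and $\tilde\rho^0=\rho^0-\phi(\cdot,0)$. Let $\tilde\rho_h=\rho_h-\pi\phi:[0,\infty)\to W_h$ be continuous on $[0,\infty)$ and differentiable on $(0,\infty)$, with $\tilde\rho_h(0)=\pi\tilde\rho^0$ and $$(\tilde\rho_{h,t},w_h)+(K(|\nabla\rho_h|)\nabla\rho_h,\nabla w_h)=(\tilde f,w_h)\qquad\text{for all } w_h\in W_h,\ t>0.$$ Then there is a constant $C>0$, depending only on $d$, $\Omega$, the exponents and coefficients of $g$, the polynomial degree $r$ and the quasi-uniformity constant $\sigma$ (and not on $h$, on the triangulation, on $\rho^0,f,\phi$, on the solution or on $t$), such that the following hold, the integrals on the left-hand sides being finite. (i) For all $t\ge 1$, $$\int_{t-1}^t\|\nabla\rho_h(\tau)\|_{0,\beta}^\beta\,d\tau\le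 C\Big(1+\|\tilde\rho_h(t-1)\|^2+\int_{t-1}^t\big(\|\phi(\tau)\|_1^2+\|\tilde f(\tau)\|^\lambda\big)d\tau\Big).$$ (ii) For all $t\ge 1$, $$\int_{t-\frac12}^t\|\tilde\rho_{h,t}(\tau)\|^2d\tau+\|\nabla\rho_h(t)\|_{0,\beta}^\beta\le C\|\tilde\rho_h(t-1)\|^2+C\Big(1+\int_{t-1}^t\big(\|\phi(\tau)\|_1^2+\|\phi_t(\tau)\|_1^2+\|\tilde f(\tau)\|^\lambda\big)d\tau\Big).$$ (iii) Let $G(t)=\|\tilde f(t)\|^\lambda+\|\phi(t)\|_1^2$. For every continuous, non-decreasing function $\mathrm{Env}\,G$ on $[0,\infty)$ with $\mathrm{Env}\,G\ge G$, and for all $t\ge 1$, $$\|\nabla\rho_h(t)\|_{0,\beta}^\beta\le C\Big(1+\|\tilde\rho^0\|^2+\big(\mathrm{Env}\,G(t)\big)^{2/\beta}+\int_{t-1}^t\|\phi_t(\tau)\|_1^2\,d\tau\Big).$$ -/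

import Mathlib

open MeasureTheory Set
open scoped ContDiff RealInnerProductSpace

noncomputable section

/-- Euclidean `d`-space. -/
abbrev Euc (d : ℕ) : Type := EuclideanSpace ℝ (Fin d)

/-- The data of a generalized Forchheimer polynomial
`g(s) = a₀ s^{α₀} + a₁ s^{α₁} + ⋯ + a_N s^{α_N}`. -/
structure ForchheimerPoly where
  N : ℕ
  one_le_N : 1 ≤ N
  alpha : Fin (N + 1) → ℝ
  alpha_zero : alpha 0 = 0
  alpha_strictMono : StrictMono alpha
  coeff : Fin (N + 1) → ℝ
  coeff_nonneg : ∀ i, 0 ≤ coeff i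
  coeff_zero_pos : 0 < coeff 0
  coeff_last_pos : 0 < coeff (Fin.last N)

namespace ForchheimerPoly

/-- The function `g(s) = ∑ aᵢ s^{αᵢ}` (used for `s ≥ 0`). -/
def eval (g : ForchheimerPoly) (s : ℝ) : ℝ := ∑ i, g.coeff i * s ^ g.alpha i

lemma alpha_nonneg (g : ForchheimerPoly) (i : Fin (g.N + 1)) : 0 ≤ g.alpha i := by
  rw [← g.alpha_zero]
  exact g.alpha_strictMono.monotone (Fin.zero_le i)

lemma eval_mono (g : ForchheimerPoly) {s t : ℝ} (hs : 0 ≤ s) (hst : s ≤ t) :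
    g.eval s ≤ g.eval t :=
  Finset.sum_le_sum fun i _ => mul_le_mul_of_nonneg_left
    (Real.rpow_le_rpow hs hst (g.alpha_nonneg i)) (g.coeff_nonneg i)

lemma coeff_zero_le_eval (g : ForchheimerPoly) {s : ℝ} (hs : 0 ≤ s) :
    g.coeff 0 ≤ g.eval s := by
  have h := Finset.single_le_sum (f := fun i => g.coeff i * s ^ g.alpha i)
    (fun i _ => mul_nonneg (g.coeff_nonneg i) (Real.rpow_nonneg hs _)) (Finset.mem_univ 0)
  simpa [eval, g.alpha_zero] using h

lemma continuous_eval (g : ForchheimerPoly) : Continuous g.eval := by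
  unfold eval
  exact continuous_finsetSum _ fun i _ =>
    continuous_const.mul (Real.continuous_rpow_const (g.alpha_nonneg i))

/-- For every `ξ ≥ 0` the equation `s g(s) = ξ` has exactly one non-negative solution. -/
lemma existsUnique_root (g : ForchheimerPoly) {ξ : ℝ} (hξ : 0 ≤ ξ) :
    ∃! s : ℝ, 0 ≤ s ∧ s * g.eval s = ξ := by
  have h0 := g.coeff_zero_pos
  have hb : 0 ≤ ξ / g.coeff 0 := div_nonneg hξ h0.le
  have hc : ContinuousOn (fun s => s * g.eval s) (Icc 0 (ξ / g.coeff 0)) :=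
    (continuous_id.mul g.continuous_eval).continuousOn
  have hmem : ξ ∈ Icc ((fun s => s * g.eval s) 0)
      ((fun s => s * g.eval s) (ξ / g.coeff 0)) := by
    refine ⟨by simpa using hξ, ?_⟩
    calc ξ = ξ / g.coeff 0 * g.coeff 0 := by field_simp
      _ ≤ _ := mul_le_mul_of_nonneg_left (g.coeff_zero_le_eval hb) hb
  obtain ⟨s, hs, hsξ⟩ := intermediate_value_Icc hb hc hmem
  have key : ∀ x y : ℝ, 0 ≤ x → x < y → x * g.eval x < y * g.eval y := by
    intro x y hx hxy
    have h1 := g.eval_mono hx hxy.le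
    have h2 : 0 < g.eval y := h0.trans_le (g.coeff_zero_le_eval (hx.trans hxy.le))
    calc x * g.eval x ≤ x * g.eval y := mul_le_mul_of_nonneg_left h1 hx
      _ < y * g.eval y := mul_lt_mul_of_pos_right hxy h2
  refine ⟨s, ⟨hs.1, hsξ⟩, ?_⟩
  rintro t ⟨ht, htξ⟩
  rcases lt_trichotomy t s with h | h | h
  · have := key t s ht h
    simp only at hsξ
    linarith
  · exact h
  · have := key s t hs.1 h
    simp only at hsξ
    linarith

/-- `s(ξ)`: the unique non-negative solution `s` of `s g(s) = ξ`, for `ξ ≥ 0`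
(see `existsUnique_root`). -/
def root (g : ForchheimerPoly) (ξ : ℝ) : ℝ :=
  Classical.epsilon fun s : ℝ => 0 ≤ s ∧ s * g.eval s = ξ

lemma root_spec (g : ForchheimerPoly) {ξ : ℝ} (hξ : 0 ≤ ξ) :
    0 ≤ g.root ξ ∧ g.root ξ * g.eval (g.root ξ) = ξ :=
  Classical.epsilon_spec (g.existsUnique_root hξ).exists

/-- The conductivity `K(ξ) = 1 / g(s(ξ))`, for `ξ ≥ 0`. -/
def K (g : ForchheimerPoly) (ξ : ℝ) : ℝ := 1 / g.eval (g.root ξ)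

/-- The degree `α_N` of `g`. -/
def deg (g : ForchheimerPoly) : ℝ := g.alpha (Fin.last g.N)

/-- `a = deg g / (deg g + 1)`. -/
def a (g : ForchheimerPoly) : ℝ := g.deg / (g.deg + 1)

/-- `β = 2 - a`. -/
def beta (g : ForchheimerPoly) : ℝ := 2 - g.a

/-- `λ = (2 - a) / (1 - a)`, the conjugate exponent of `β`. -/
def lam (g : ForchheimerPoly) : ℝ := (2 - g.a) / (1 - g.a)

end ForchheimerPoly

/-- A triangulation of the open set `Ω`: finitely many compact cells with non-empty, pairwise
disjoint interiors contained in `Ω`, which cover `Ω`.  Cells may be curved, so that domains with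
a smooth boundary can be triangulated as well as polyhedra.  (For the quasi-uniform triangulations
below, each cell is star-shaped with respect to a ball, hence is a topological simplex.) -/
structure Triangulation {d : ℕ} (Ω : Set (Euc d)) where
  cells : Finset (Set (Euc d))
  isCompact : ∀ T ∈ cells, IsCompact T
  interior_nonempty : ∀ T ∈ cells, (interior T).Nonempty
  interior_subset : ∀ T ∈ cells, interior T ⊆ Ω
  covers : Ω ⊆ ⋃ T ∈ cells, T
  disjoint : ∀ T ∈ cells, ∀ T' ∈ cells, T ≠ T' → Disjoint (interior T) (interior T')

namespace Triangulation

variable {d : ℕ} {Ω : Set (Euc d)}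

/-- The mesh size `h`, the maximal diameter of a cell. -/
def meshSize (𝒯 : Triangulation Ω) : ℝ := sSup (Metric.diam '' (𝒯.cells : Set (Set (Euc d))))

/-- Global quasi-uniformity with constant `σ`: every cell is star-shaped with respect to a ball of
radius `σ h`.  A family of triangulations is globally quasi-uniform when its members satisfy this
with a common `σ > 0`. -/
def IsQuasiUniform (𝒯 : Triangulation Ω) (σ : ℝ) : Prop :=
  ∀ T ∈ 𝒯.cells, ∃ c : Euc d, Metric.closedBall c (σ * 𝒯.meshSize) ⊆ T ∧
    ∀ y ∈ Metric.closedBall c (σ * 𝒯.meshSize), StarConvex ℝ y T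

/-- The space `W_h` of discontinuous piecewise polynomials of degree at most `r`: on the interior
of each cell the function is a polynomial of total degree at most `r`.  No condition relates
different cells, and the values on the (null) skeleton are irrelevant. -/
def space (𝒯 : Triangulation Ω) (r : ℕ) : Submodule ℝ (Euc d → ℝ) where
  carrier := {w | ∀ T ∈ 𝒯.cells, ∃ p : MvPolynomial (Fin d) ℝ, p.totalDegree ≤ r ∧
    ∀ x ∈ interior T, w x = MvPolynomial.eval (fun i => x i) p}
  add_mem' := by
    intro u v hu hv T hT
    obtain ⟨p, hp, hpu⟩ := hu T hT
    obtain ⟨q, hq, hqv⟩ := hv T hT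
    refine ⟨p + q, (MvPolynomial.totalDegree_add p q).trans (max_le hp hq), fun x hx => ?_⟩
    simp [hpu x hx, hqv x hx]
  zero_mem' := fun T _ => ⟨0, by simp, fun x _ => by simp⟩
  smul_mem' := by
    intro c u hu T hT
    obtain ⟨p, hp, hpu⟩ := hu T hT
    refine ⟨c • p, (MvPolynomial.totalDegree_smul_le c p).trans hp, fun x hx => ?_⟩
    simp [hpu x hx, MvPolynomial.smul_eval]

/-- `p` is the `L²(Ω)`-projection `π u` of `u` onto `W_h`:
`p ∈ W_h` and `(p, v) = (u, v)` for all `v ∈ W_h`. -/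
def IsL2Proj (𝒯 : Triangulation Ω) (r : ℕ) (u p : Euc d → ℝ) : Prop :=
  p ∈ 𝒯.space r ∧ ∀ v ∈ 𝒯.space r, ∫ x in Ω, p x * v x = ∫ x in Ω, u x * v x

end Triangulation

/-- The scalar space `L²(Ω)`. -/
abbrev L2 {d : ℕ} (Ω : Set (Euc d)) : Type := Lp ℝ 2 (volume.restrict Ω)

/-- The space `L²(Ω)^d` of vector fields. -/
abbrev L2Vec {d : ℕ} (Ω : Set (Euc d)) : Type := Lp (Euc d) 2 (volume.restrict Ω)

/-- `G` is the weak gradient on `Ω` of `u`; thus `u ∈ H¹(Ω)`, with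
`‖u‖₁² = ‖u‖² + ‖G‖²`. -/
def IsWeakGradient {d : ℕ} (Ω : Set (Euc d)) (u : L2 Ω) (G : L2Vec Ω) : Prop :=
  ∀ η : Euc d → ℝ, ContDiff ℝ ∞ η → HasCompactSupport η → tsupport η ⊆ Ω →
    ∀ v : Euc d, ∫ x in Ω, u x * fderiv ℝ η x v = - ∫ x in Ω, η x * ⟪G x, v⟫

/-- The data of the initial boundary value problem: an initial density `ρ⁰ ∈ L²(Ω)`, a source
`f ∈ C([0,∞); L²(Ω))`, and the extension `φ ∈ C¹([0,∞); H¹(Ω))` of the boundary values. Here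
`phi_t` is the time derivative of `phi`, and `grad_phi`, `grad_phi_t` are spatial gradients. -/
structure ProblemData {d : ℕ} (Ω : Set (Euc d)) where
  rho0 : L2 Ω
  f : ℝ → L2 Ω
  phi : ℝ → L2 Ω
  grad_phi : ℝ → L2Vec Ω
  phi_t : ℝ → L2 Ω
  grad_phi_t : ℝ → L2Vec Ω
  isWeakGradient_phi : ∀ t, 0 ≤ t → IsWeakGradient Ω (phi t) (grad_phi t)
  isWeakGradient_phi_t : ∀ t, 0 ≤ t → IsWeakGradient Ω (phi_t t) (grad_phi_t t)
  hasDeriv_phi : ∀ t, 0 ≤ t → HasDerivWithinAt phi (phi_t t) (Ici 0) t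
  continuousOn_f : ContinuousOn f (Ici 0)
  continuousOn_grad_phi : ContinuousOn grad_phi (Ici 0)
  continuousOn_phi_t : ContinuousOn phi_t (Ici 0)
  continuousOn_grad_phi_t : ContinuousOn grad_phi_t (Ici 0)

namespace ProblemData

variable {d : ℕ} {Ω : Set (Euc d)}

/-- `f̃ = f - φ_t`. -/
def fTilde (D : ProblemData Ω) (t : ℝ) : L2 Ω := D.f t - D.phi_t t

/-- `ρ̃⁰ = ρ⁰ - φ(·, 0)`. -/
def rhoTilde0 (D : ProblemData Ω) : L2 Ω := D.rho0 - D.phi 0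

/-- `‖φ(t)‖₁²`, the squared `H¹(Ω)`-norm. -/
def phiH1Sq (D : ProblemData Ω) (t : ℝ) : ℝ := ‖D.phi t‖ ^ 2 + ‖D.grad_phi t‖ ^ 2

/-- `‖φ_t(t)‖₁²`, the squared `H¹(Ω)`-norm. -/
def phitH1Sq (D : ProblemData Ω) (t : ℝ) : ℝ := ‖D.phi_t t‖ ^ 2 + ‖D.grad_phi_t t‖ ^ 2

/-- `g(t) = ‖f̃(t)‖^λ + ‖φ(t)‖₁²`. -/
def gFun (D : ProblemData Ω) (g : ForchheimerPoly) (t : ℝ) : ℝ :=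
  ‖D.fTilde t‖ ^ g.lam + D.phiH1Sq t

end ProblemData

/-- `E` is a continuous, increasing (upper) envelope of `F` on `[0, ∞)`. -/
structure IsEnvelope (F E : ℝ → ℝ) : Prop where
  continuousOn : ContinuousOn E (Ici 0)
  monotoneOn : MonotoneOn E (Ici 0)
  le : ∀ t, 0 ≤ t → F t ≤ E t

/-- The time derivative `u_t(t, x)`. -/
def timeDeriv {d : ℕ} (u : ℝ → Euc d → ℝ) (t : ℝ) (x : Euc d) : ℝ := deriv (fun s => u s x) t

/-- `‖u‖²`, the squared `L²(Ω)`-norm. -/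
def normSqL2 {d : ℕ} (Ω : Set (Euc d)) (u : Euc d → ℝ) : ℝ := ∫ x in Ω, u x ^ 2

/-- `‖∇u‖_{0,β}^β = ∫_Ω |∇u|^β`. For a piecewise polynomial `u`, the pointwise gradient exists
in the interior of every cell, hence almost everywhere, and is the elementwise gradient. -/
def gradPow {d : ℕ} (Ω : Set (Euc d)) (β : ℝ) (u : Euc d → ℝ) : ℝ :=
  ∫ x in Ω, ‖gradient u x‖ ^ β

/-- The semidiscrete Galerkin problem: `ρ̃_h = ρ_h - π φ : [0,∞) → W_h` is continuous on `[0,∞)`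
and differentiable on `(0,∞)`, starts from `π ρ̃⁰`, and
`(ρ̃_{h,t}, w) + (K(|∇ρ_h|) ∇ρ_h, ∇w) = (f̃, w)` for all `w ∈ W_h`, with elementwise gradients.
Here `rhoT` stands for `ρ̃_h` and `rho` for `ρ_h`. (As `W_h` is finite dimensional, pointwise
continuity and differentiability in time inside the cells amount to those of a curve in `W_h`.) -/
structure IsSemidiscreteSolution {d : ℕ} {Ω : Set (Euc d)} (g : ForchheimerPoly)
    (𝒯 : Triangulation Ω) (r : ℕ) (D : ProblemData Ω) (rhoT rho : ℝ → Euc d → ℝ) : Prop where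
  mem : ∀ t, 0 ≤ t → rhoT t ∈ 𝒯.space r
  proj : ∀ t, 0 ≤ t → 𝒯.IsL2Proj r (D.phi t) (rho t - rhoT t)
  init : 𝒯.IsL2Proj r D.rhoTilde0 (rhoT 0)
  continuousOn : ∀ T ∈ 𝒯.cells, ∀ x ∈ interior T, ContinuousOn (fun s => rhoT s x) (Ici 0)
  differentiableAt : ∀ T ∈ 𝒯.cells, ∀ x ∈ interior T, ∀ t, 0 < t →
    DifferentiableAt ℝ (fun s => rhoT s x) t
  equation : ∀ t, 0 < t → ∀ w ∈ 𝒯.space r,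
    (∫ x in Ω, timeDeriv rhoT t x * w x) +
      (∫ x in Ω, ⟪g.K ‖gradient (rho t) x‖ • gradient (rho t) x, gradient w x⟫) =
    ∫ x in Ω, D.fTilde t x * w x

end

/-!
The flux `K(|ξ|) ξ` grows like `|ξ| ^ (β - 1)` and is the gradient of a potential `H` that grows
like `|ξ| ^ β`. Write `z` for the squared norm of the component of `ρ̃_h` orthogonal to the
piecewise constants, whose elementwise gradients vanish. Testing the Galerkin equation with this
component gives `z' ≤ -c ‖∇ρ_h‖_{0,β}^β + C (1 + G)`: the source is absorbed by the broken Poincaré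
inequality `‖w - w₀‖ ^ β ≤ S ∫ |∇w| ^ β`, in which `h` appears with the exponent
`(d + 2) β / 2 - d`, nonnegative exactly under the degree condition, and `πφ` is controlled by
`‖∇πφ‖ ≤ C ‖∇φ‖`, which follows by comparing `πφ` with a piecewise constant. Integration over
`[t - 1, t]` is (i). Testing with the time derivative of `ρ̃_h` bounds the growth of the energy
`∫ H(∇ρ_h)`; multiplied by a weight vanishing at `t - 1` and combined with (i), this is (ii).
Finally, the Poincaré inequality turns the bound on `z'` into
`z' ≤ -c' z ^ (β / 2) + C' (1 + G)`, so `z` decreases whenever it exceeds a multiple of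
`(1 + Env G) ^ (2 / β)`; hence `z` is at most the maximum of that multiple and `z 0 ≤ ‖ρ̃⁰‖²`,
and (iii) follows from (ii).
-/

noncomputable section

/-! ### The Forchheimer flux -/

lemma rpow_eq_rpow_sub_one_mul {b : ℝ} (hb : 1 < b) {x : ℝ} (hx : 0 ≤ x) :
    x ^ b = x ^ (b - 1) * x := by
  rw [← Real.rpow_add_one' hx (by linarith), sub_add_cancel]

lemma rpow_le_one_add_rpow {x p q : ℝ} (hx : 0 ≤ x) (hp : 0 ≤ p) (hpq : p ≤ q) :
    x ^ p ≤ 1 + x ^ q := by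
  rcases le_total x 1 with h | h
  · exact (Real.rpow_le_one hx h hp).trans (le_add_of_nonneg_right (Real.rpow_nonneg hx q))
  · exact (Real.rpow_le_rpow_of_exponent_le h hpq).trans (le_add_of_nonneg_left zero_le_one)

lemma rpow_le_one_add_sq {x p : ℝ} (hx : 0 ≤ x) (hp : 0 ≤ p) (hp2 : p ≤ 2) :
    x ^ p ≤ 1 + x ^ 2 := by
  simpa using rpow_le_one_add_rpow hx hp hp2

lemma add_rpow_le {x y b : ℝ} (hx : 0 ≤ x) (hy : 0 ≤ y) (hb : 0 ≤ b) :
    (x + y) ^ b ≤ 2 ^ b * (x ^ b + y ^ b) := by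
  have hmax : max x y ^ b ≤ x ^ b + y ^ b := by
    rcases max_choice x y with h | h <;> rw [h]
    · exact le_add_of_nonneg_right (Real.rpow_nonneg hy b)
    · exact le_add_of_nonneg_left (Real.rpow_nonneg hx b)
  calc (x + y) ^ b ≤ (2 * max x y) ^ b :=
        Real.rpow_le_rpow (by positivity) (by linarith [le_max_left x y, le_max_right x y]) hb
    _ = 2 ^ b * max x y ^ b := Real.mul_rpow (by norm_num) (le_max_of_le_left hx)
    _ ≤ 2 ^ b * (x ^ b + y ^ b) := by gcongr

lemma rpow_sub_one_mul_le {b ε x y : ℝ} (hb : 1 < b) (hε : 0 < ε) (hx : 0 ≤ x) (hy : 0 ≤ y) :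
    x ^ (b - 1) * y ≤ ε * x ^ b + ε⁻¹ ^ (b - 1) * y ^ b := by
  rcases le_total y (ε * x) with h | h
  · calc x ^ (b - 1) * y ≤ x ^ (b - 1) * (ε * x) := by gcongr
      _ = ε * x ^ b := by rw [rpow_eq_rpow_sub_one_mul hb hx]; ring
      _ ≤ _ := le_add_of_nonneg_right (by positivity)
  · have hx_le : x ≤ ε⁻¹ * y := by rwa [inv_mul_eq_div, le_div_iff₀' hε]
    calc x ^ (b - 1) * y ≤ (ε⁻¹ * y) ^ (b - 1) * y := by gcongr
      _ = ε⁻¹ ^ (b - 1) * y ^ b := by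
        rw [Real.mul_rpow (by positivity) hy, rpow_eq_rpow_sub_one_mul hb hy, mul_assoc]
      _ ≤ _ := le_add_of_nonneg_left (by positivity)

namespace ForchheimerPoly

variable (g : ForchheimerPoly)

lemma deg_pos : 0 < g.deg := by
  rw [deg, ← g.alpha_zero]
  exact g.alpha_strictMono (Fin.lt_def.2 (by simpa using Nat.lt_of_lt_of_le one_pos g.one_le_N))

lemma beta_sub_one : g.beta - 1 = (g.deg + 1)⁻¹ := by
  have := g.deg_pos
  rw [beta, a]
  field_simp
  ring

lemma one_lt_beta : 1 < g.beta := by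
  have := g.deg_pos
  rw [← sub_pos, beta_sub_one]
  positivity

lemma beta_lt_two : g.beta < 2 := by
  have : 0 < g.a := div_pos g.deg_pos (by linarith [g.deg_pos])
  rw [beta]
  linarith

lemma beta_pos : 0 < g.beta := one_pos.trans g.one_lt_beta

lemma lam_eq : g.lam = g.beta / (g.beta - 1) := by
  rw [lam, beta]
  congr 1
  ring

lemma two_le_lam : 2 ≤ g.lam := by
  rw [lam_eq, le_div_iff₀ (by linarith [g.one_lt_beta])]
  linarith [g.beta_lt_two]

lemma rpow_inv_rpow_beta_sub_one {s : ℝ} (hs : 0 ≤ s) :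
    (s ^ (g.deg + 1)) ^ (g.beta - 1) = s := by
  rw [g.beta_sub_one, Real.rpow_rpow_inv hs (by linarith [g.deg_pos])]

lemma eval_pos {s : ℝ} (hs : 0 ≤ s) : 0 < g.eval s :=
  g.coeff_zero_pos.trans_le (g.coeff_zero_le_eval hs)

lemma coeff_last_mul_rpow_le_eval {s : ℝ} (hs : 0 ≤ s) :
    g.coeff (Fin.last g.N) * s ^ g.deg ≤ g.eval s :=
  Finset.single_le_sum (f := fun i => g.coeff i * s ^ g.alpha i)
    (fun i _ => mul_nonneg (g.coeff_nonneg i) (Real.rpow_nonneg hs _))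
    (Finset.mem_univ (Fin.last g.N))

lemma eval_le_mul_rpow {s : ℝ} (hs : 1 ≤ s) : g.eval s ≤ g.eval 1 * s ^ g.deg := by
  rw [eval, eval, Finset.sum_mul]
  refine Finset.sum_le_sum fun i _ => ?_
  rw [Real.one_rpow, mul_one]
  exact mul_le_mul_of_nonneg_left (Real.rpow_le_rpow_of_exponent_le hs
    (g.alpha_strictMono.monotone (Fin.le_last i))) (g.coeff_nonneg i)

lemma root_nonneg {ξ : ℝ} (hξ : 0 ≤ ξ) : 0 ≤ g.root ξ := (g.root_spec hξ).1

lemma root_mul_eval {ξ : ℝ} (hξ : 0 ≤ ξ) : g.root ξ * g.eval (g.root ξ) = ξ := (g.root_spec hξ).2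

lemma K_pos {ξ : ℝ} (hξ : 0 ≤ ξ) : 0 < g.K ξ :=
  one_div_pos.2 (g.eval_pos (g.root_nonneg hξ))

lemma K_mul_self {ξ : ℝ} (hξ : 0 ≤ ξ) : g.K ξ * ξ = g.root ξ := by
  rw [K, one_div_mul_eq_div, div_eq_iff (g.eval_pos (g.root_nonneg hξ)).ne', g.root_mul_eval hξ]

lemma root_mono {x y : ℝ} (hx : 0 ≤ x) (hxy : x ≤ y) : g.root x ≤ g.root y := by
  have hy := hx.trans hxy
  by_contra! h
  have : y < x :=
    calc y = g.root y * g.eval (g.root y) := (g.root_mul_eval hy).symm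
      _ < g.root x * g.eval (g.root y) :=
        mul_lt_mul_of_pos_right h (g.eval_pos (g.root_nonneg hy))
      _ ≤ g.root x * g.eval (g.root x) :=
        mul_le_mul_of_nonneg_left (g.eval_mono (g.root_nonneg hy) h.le) (g.root_nonneg hx)
      _ = x := g.root_mul_eval hx
  exact this.not_ge hxy

lemma K_antitone {x y : ℝ} (hx : 0 ≤ x) (hxy : x ≤ y) : g.K y ≤ g.K x :=
  one_div_le_one_div_of_le (g.eval_pos (g.root_nonneg hx))
    (g.eval_mono (g.root_nonneg hx) (g.root_mono hx hxy))

lemma coeff_zero_mul_root_sub_le {x y : ℝ} (hx : 0 ≤ x) (hxy : x ≤ y) :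
    g.coeff 0 * (g.root y - g.root x) ≤ y - x := by
  have hroot := g.root_mono hx hxy
  calc g.coeff 0 * (g.root y - g.root x) ≤ g.eval (g.root x) * (g.root y - g.root x) :=
        mul_le_mul_of_nonneg_right (g.coeff_zero_le_eval (g.root_nonneg hx)) (sub_nonneg.2 hroot)
    _ = g.root y * g.eval (g.root x) - g.root x * g.eval (g.root x) := by ring
    _ ≤ g.root y * g.eval (g.root y) - g.root x * g.eval (g.root x) := by
      gcongr
      · exact g.root_nonneg (hx.trans hxy)
      · exact g.eval_mono (g.root_nonneg hx) hroot
    _ = y - x := by rw [g.root_mul_eval hx, g.root_mul_eval (hx.trans hxy)]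

lemma continuousOn_root : ContinuousOn g.root (Ici 0) := by
  refine LipschitzOnWith.continuousOn (K := Real.toNNReal (g.coeff 0)⁻¹)
    (LipschitzOnWith.of_le_add_mul _ fun x hx y hy => ?_)
  rw [Real.coe_toNNReal _ (inv_pos.2 g.coeff_zero_pos).le, ← sub_le_iff_le_add', inv_mul_eq_div,
    le_div_iff₀' g.coeff_zero_pos, Real.dist_eq]
  rcases le_total x y with hxy | hxy
  · exact (mul_nonpos_of_nonneg_of_nonpos g.coeff_zero_pos.le
      (sub_nonpos.2 (g.root_mono hx hxy))).trans (abs_nonneg _)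
  · exact (g.coeff_zero_mul_root_sub_le hy hxy).trans (le_abs_self _)

lemma continuousOn_K : ContinuousOn g.K (Ici 0) :=
  continuousOn_const.div (g.continuous_eval.comp_continuousOn g.continuousOn_root)
    fun _ hξ => (g.eval_pos (g.root_nonneg hξ)).ne'

lemma exists_root_le : ∃ C : ℝ, 0 < C ∧ ∀ ξ, 0 ≤ ξ → g.root ξ ≤ C * ξ ^ (g.beta - 1) := by
  have hlast := g.coeff_last_pos
  refine ⟨(g.coeff (Fin.last g.N))⁻¹ ^ (g.beta - 1), by positivity, fun ξ hξ => ?_⟩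
  rw [← Real.mul_rpow (by positivity) hξ]
  have hs := g.root_nonneg hξ
  have hpow : g.root ξ ^ (g.deg + 1) ≤ (g.coeff (Fin.last g.N))⁻¹ * ξ := by
    rw [inv_mul_eq_div, le_div_iff₀' hlast, Real.rpow_add_one' hs (by linarith [g.deg_pos])]
    calc g.coeff (Fin.last g.N) * (g.root ξ ^ g.deg * g.root ξ)
        = g.root ξ * (g.coeff (Fin.last g.N) * g.root ξ ^ g.deg) := by ring
      _ ≤ g.root ξ * g.eval (g.root ξ) := by gcongr; exact g.coeff_last_mul_rpow_le_eval hs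
      _ = ξ := g.root_mul_eval hξ
  calc g.root ξ = (g.root ξ ^ (g.deg + 1)) ^ (g.beta - 1) :=
        (g.rpow_inv_rpow_beta_sub_one hs).symm
    _ ≤ _ := Real.rpow_le_rpow (by positivity) hpow (by linarith [g.one_lt_beta])

lemma exists_le_one_add_root :
    ∃ c : ℝ, 0 < c ∧ ∀ ξ, 0 ≤ ξ → c * ξ ^ (g.beta - 1) ≤ 1 + g.root ξ := by
  have hone := g.eval_pos zero_le_one
  refine ⟨(g.eval 1)⁻¹ ^ (g.beta - 1), by positivity, fun ξ hξ => ?_⟩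
  rw [← Real.mul_rpow (by positivity) hξ]
  have hs := g.root_nonneg hξ
  have hpow : (g.eval 1)⁻¹ * ξ ≤ (1 + g.root ξ) ^ (g.deg + 1) := by
    rw [inv_mul_le_iff₀ hone]
    calc ξ = g.root ξ * g.eval (g.root ξ) := (g.root_mul_eval hξ).symm
      _ ≤ (1 + g.root ξ) * g.eval (1 + g.root ξ) := by
        gcongr
        · exact (g.eval_pos hs).le
        · linarith
        · exact g.eval_mono hs (by linarith)
      _ ≤ (1 + g.root ξ) * (g.eval 1 * (1 + g.root ξ) ^ g.deg) := by
        gcongr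
        exact g.eval_le_mul_rpow (by linarith)
      _ = g.eval 1 * (1 + g.root ξ) ^ (g.deg + 1) := by
        rw [Real.rpow_add_one' (by positivity) (by linarith [g.deg_pos])]
        ring
  calc ((g.eval 1)⁻¹ * ξ) ^ (g.beta - 1) ≤ ((1 + g.root ξ) ^ (g.deg + 1)) ^ (g.beta - 1) :=
        Real.rpow_le_rpow (by positivity) hpow (by linarith [g.one_lt_beta])
    _ = 1 + g.root ξ := g.rpow_inv_rpow_beta_sub_one (by positivity)

lemma exists_le_root_mul : ∃ c C : ℝ, 0 < c ∧ 0 < C ∧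
    ∀ ξ, 0 ≤ ξ → c * ξ ^ g.beta ≤ g.root ξ * ξ + C := by
  obtain ⟨c, hc, hroot⟩ := g.exists_le_one_add_root
  refine ⟨c / 2, (c / 2)⁻¹ ^ (1 / (g.beta - 1)), by positivity, by positivity, fun ξ hξ => ?_⟩
  have hb := g.one_lt_beta
  have hlower : c * ξ ^ g.beta ≤ ξ + g.root ξ * ξ :=
    calc c * ξ ^ g.beta = c * ξ ^ (g.beta - 1) * ξ := by
          rw [rpow_eq_rpow_sub_one_mul hb hξ, mul_assoc]
      _ ≤ (1 + g.root ξ) * ξ := mul_le_mul_of_nonneg_right (hroot ξ hξ) hξ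
      _ = ξ + g.root ξ * ξ := by ring
  have habsorb : ξ ≤ c / 2 * ξ ^ g.beta + (c / 2)⁻¹ ^ (1 / (g.beta - 1)) := by
    rcases le_total 1 (c / 2 * ξ ^ (g.beta - 1)) with h | h
    · calc ξ = 1 * ξ := (one_mul ξ).symm
        _ ≤ c / 2 * ξ ^ (g.beta - 1) * ξ := by gcongr
        _ = c / 2 * ξ ^ g.beta := by rw [rpow_eq_rpow_sub_one_mul hb hξ, mul_assoc]
        _ ≤ _ := le_add_of_nonneg_right (by positivity)
    · have hpow : ξ ^ (g.beta - 1) ≤ (c / 2)⁻¹ := by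
        rwa [← one_div, le_div_iff₀' (by positivity)]
      calc ξ = (ξ ^ (g.beta - 1)) ^ (1 / (g.beta - 1)) := by
            rw [one_div, Real.rpow_rpow_inv hξ (by linarith)]
        _ ≤ (c / 2)⁻¹ ^ (1 / (g.beta - 1)) :=
          Real.rpow_le_rpow (by positivity) hpow (one_div_nonneg.2 (by linarith))
        _ ≤ _ := le_add_of_nonneg_left (by positivity)
  linarith

section Flux

variable {E : Type*} [NormedAddCommGroup E] [InnerProductSpace ℝ E]

/-- The Forchheimer flux `K(|ξ|) ξ`. -/
def flux (ξ : E) : E := g.K ‖ξ‖ • ξ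

/-- The potential of the flux, `∫₀^{|ξ|} K(r) r dr`, written as an integral in `s = r²` so that it
is differentiable at `ξ = 0` by the chain rule. -/
def potential (ξ : E) : ℝ := (1 / 2) * ∫ s in (0 : ℝ)..‖ξ‖ ^ 2, g.K √s

lemma continuous_flux : Continuous (g.flux : E → E) :=
  (g.continuousOn_K.comp_continuous continuous_norm norm_nonneg).smul continuous_id

lemma norm_flux (ξ : E) : ‖g.flux ξ‖ = g.root ‖ξ‖ := by
  rw [flux, norm_smul, Real.norm_of_nonneg (g.K_pos (norm_nonneg ξ)).le,
    g.K_mul_self (norm_nonneg ξ)]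

lemma inner_flux_self (ξ : E) : ⟪g.flux ξ, ξ⟫ = g.root ‖ξ‖ * ‖ξ‖ := by
  rw [flux, real_inner_smul_left, real_inner_self_eq_norm_sq, sq, ← mul_assoc,
    g.K_mul_self (norm_nonneg ξ)]

lemma continuous_K_sqrt : Continuous fun s => g.K √s :=
  g.continuousOn_K.comp_continuous Real.continuous_sqrt Real.sqrt_nonneg

lemma hasFDerivAt_potential (ξ : E) : HasFDerivAt g.potential (innerSL ℝ (g.flux ξ)) ξ := by
  have hprim : HasDerivAt (fun y => ∫ s in (0 : ℝ)..y, g.K √s) (g.K ‖ξ‖) (‖ξ‖ ^ 2) := by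
    have := (g.continuous_K_sqrt.integral_hasStrictDerivAt 0 (‖ξ‖ ^ 2)).hasDerivAt
    rwa [Real.sqrt_sq (norm_nonneg ξ)] at this
  have hnorm : HasFDerivAt (fun ξ : E => ‖ξ‖ ^ 2) (2 • innerSL ℝ ξ) ξ :=
    (hasStrictFDerivAt_norm_sq ξ).hasFDerivAt
  refine HasFDerivAt.congr_fderiv (f := g.potential)
    ((hprim.comp_hasFDerivAt ξ hnorm).const_mul (1 / 2)) ?_
  rw [flux, map_smul, smul_comm (1 / 2 : ℝ), ← Nat.cast_smul_eq_nsmul ℝ, smul_smul (1 / 2 : ℝ)]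
  norm_num

lemma continuous_potential : Continuous (g.potential : E → ℝ) :=
  continuous_iff_continuousAt.2 fun ξ => (g.hasFDerivAt_potential ξ).continuousAt

lemma inner_flux_self_le_potential (ξ : E) : ⟪g.flux ξ, ξ⟫ ≤ 2 * g.potential ξ := by
  have hmono := intervalIntegral.integral_mono_on (μ := volume) (a := 0) (b := ‖ξ‖ ^ 2)
    (by positivity) intervalIntegrable_const
    (g.continuous_K_sqrt.intervalIntegrable _ _) fun s hs =>
      g.K_antitone (Real.sqrt_nonneg s) (Real.sqrt_le_iff.2 ⟨norm_nonneg ξ, hs.2⟩)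
  rw [intervalIntegral.integral_const, smul_eq_mul, sub_zero] at hmono
  calc ⟪g.flux ξ, ξ⟫ = ‖ξ‖ ^ 2 * g.K ‖ξ‖ := by
        rw [flux, real_inner_smul_left, real_inner_self_eq_norm_sq, mul_comm]
    _ ≤ _ := hmono
    _ = 2 * g.potential ξ := by rw [potential]; ring

lemma potential_le_inner_flux_self (ξ : E) : g.potential ξ ≤ ⟪g.flux ξ, ξ⟫ := by
  rw [inner_flux_self, potential, ← intervalIntegral.integral_const_mul]
  have h := intervalIntegral.integral_le_sub_of_hasDeriv_right_of_le (a := 0) (b := ‖ξ‖ ^ 2)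
    (g := fun s => g.root ‖ξ‖ * √s) (φ := fun s => 1 / 2 * g.K √s)
    (g' := fun s => g.root ‖ξ‖ * (1 / (2 * √s))) (by positivity) (by fun_prop)
    (fun s hs => ((Real.hasDerivAt_sqrt hs.1.ne').const_mul _).hasDerivWithinAt)
    (g.continuous_K_sqrt.const_smul (1 / 2 : ℝ)).integrableOn_Icc fun s hs => by
      have hsqrt := Real.sqrt_pos.2 hs.1
      have hroot : g.K √s * √s ≤ g.root ‖ξ‖ := by
        rw [g.K_mul_self hsqrt.le]
        exact g.root_mono hsqrt.le (Real.sqrt_le_iff.2 ⟨norm_nonneg ξ, hs.2.le⟩)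
      rw [← mul_div_assoc, mul_one, le_div_iff₀ (by positivity)]
      linarith
  simpa [Real.sqrt_sq (norm_nonneg ξ)] using h

variable (E) in
/-- Growth of order `β - 1` of the flux and of order `β` of its potential on `E`, with lower
constant `c` and upper constant `C`. -/
structure GrowthBounds (c C : ℝ) : Prop where
  lower_pos : 0 < c
  upper_pos : 0 < C
  coercive : ∀ ξ η : E, c * ‖ξ‖ ^ g.beta ≤ ⟪g.flux ξ, ξ - η⟫ + C * (1 + ‖η‖ ^ 2)
  flux_le : ∀ ξ η : E, ⟪g.flux ξ, η⟫ ≤ ‖ξ‖ ^ g.beta + C * (1 + ‖η‖ ^ 2)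
  le_potential : ∀ ξ : E, c * ‖ξ‖ ^ g.beta ≤ g.potential ξ + C
  potential_le : ∀ ξ : E, g.potential ξ ≤ C * ‖ξ‖ ^ g.beta

lemma inner_flux_le {C ε : ℝ} (hC : 0 < C) (hε : 0 < ε)
    (hroot : ∀ x, 0 ≤ x → g.root x ≤ C * x ^ (g.beta - 1)) (ξ η : E) :
    ⟪g.flux ξ, η⟫ ≤ ε * ‖ξ‖ ^ g.beta + C * (ε / C)⁻¹ ^ (g.beta - 1) * (1 + ‖η‖ ^ 2) := by
  calc ⟪g.flux ξ, η⟫ ≤ g.root ‖ξ‖ * ‖η‖ := g.norm_flux ξ ▸ real_inner_le_norm _ _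
    _ ≤ C * ‖ξ‖ ^ (g.beta - 1) * ‖η‖ := by gcongr; exact hroot _ (norm_nonneg ξ)
    _ = C * (‖ξ‖ ^ (g.beta - 1) * ‖η‖) := mul_assoc _ _ _
    _ ≤ C * (ε / C * ‖ξ‖ ^ g.beta + (ε / C)⁻¹ ^ (g.beta - 1) * ‖η‖ ^ g.beta) := by
      gcongr
      exact rpow_sub_one_mul_le g.one_lt_beta (by positivity) (norm_nonneg _) (norm_nonneg _)
    _ = ε * ‖ξ‖ ^ g.beta + C * (ε / C)⁻¹ ^ (g.beta - 1) * ‖η‖ ^ g.beta := by field_simp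
    _ ≤ _ := by gcongr; exact rpow_le_one_add_sq (norm_nonneg η) g.beta_pos.le g.beta_lt_two.le

lemma exists_growthBounds (E : Type*) [NormedAddCommGroup E] [InnerProductSpace ℝ E] :
    ∃ c C : ℝ, g.GrowthBounds E c C := by
  obtain ⟨c, C₀, hc, hC₀, hlower⟩ := g.exists_le_root_mul
  obtain ⟨C₁, hC₁, hupper⟩ := g.exists_root_le
  set young : ℝ → ℝ := fun ε => C₁ * (ε / C₁)⁻¹ ^ (g.beta - 1)
  have hyoung : ∀ {ε : ℝ}, 0 < ε → 0 < young ε := fun hε => by positivity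
  have hflux := fun {ε : ℝ} (hε : 0 < ε) (ξ η : E) => g.inner_flux_le hC₁ hε hupper ξ η
  have hself : ∀ ξ : E, c * ‖ξ‖ ^ g.beta ≤ ⟪g.flux ξ, ξ⟫ + C₀ := fun ξ =>
    g.inner_flux_self ξ ▸ hlower _ (norm_nonneg ξ)
  have hc2 : 0 < c / 2 := by positivity
  have young_one_pos := hyoung one_pos
  have young_half_pos := hyoung hc2
  refine ⟨c / 2, C₀ + C₁ + young 1 + young (c / 2), hc2, by positivity, fun ξ η => ?_,
    fun ξ η => ?_, fun ξ => ?_, fun ξ => ?_⟩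
  · have hsq : 0 ≤ ‖η‖ ^ 2 := sq_nonneg _
    have := hflux hc2 ξ η
    rw [inner_sub_right]
    nlinarith [hself ξ, mul_nonneg hC₀.le hsq, mul_nonneg (add_pos hC₁ young_one_pos).le hsq]
  · refine (hflux one_pos ξ η).trans ?_
    rw [one_mul]
    gcongr
    change young 1 ≤ _
    linarith
  · linarith [hself ξ, g.inner_flux_self_le_potential ξ]
  · calc g.potential ξ ≤ g.root ‖ξ‖ * ‖ξ‖ :=
          (g.potential_le_inner_flux_self ξ).trans_eq (g.inner_flux_self ξ)
      _ ≤ C₁ * ‖ξ‖ ^ (g.beta - 1) * ‖ξ‖ := by gcongr; exact hupper _ (norm_nonneg ξ)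
      _ = C₁ * ‖ξ‖ ^ g.beta := by
        rw [rpow_eq_rpow_sub_one_mul g.one_lt_beta (norm_nonneg ξ), mul_assoc]
      _ ≤ _ := by gcongr; linarith

end Flux

end ForchheimerPoly

/-! ### Energy inequalities -/

lemma intervalIntegrable_of_continuousOn_Ici {F : ℝ → ℝ} (hF : ContinuousOn F (Ici 0)) {s t : ℝ}
    (hs : 0 ≤ s) (hst : s ≤ t) : IntervalIntegrable F volume s t :=
  (hF.mono fun _ hx => hs.trans hx.1).intervalIntegrable_of_Icc hst

lemma antitoneOn_Icc_of_hasDerivAt_nonpos {y y' : ℝ → ℝ} {s t : ℝ} (hc : ContinuousOn y (Icc s t))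
    (hd : ∀ τ ∈ Ioo s t, HasDerivAt y (y' τ) τ) (hy' : ∀ τ ∈ Ioo s t, y' τ ≤ 0) :
    AntitoneOn y (Icc s t) := by
  refine antitoneOn_of_hasDerivWithinAt_nonpos (f' := y') (convex_Icc s t) hc ?_ ?_ <;>
    rw [interior_Icc]
  exacts [fun τ hτ => (hd τ hτ).hasDerivWithinAt, hy']

lemma le_max_of_hasDerivAt_nonpos_of_lt {y y' : ℝ → ℝ} {a t M : ℝ} (ht : a ≤ t)
    (hc : ContinuousOn y (Icc a t)) (hd : ∀ s ∈ Ioo a t, HasDerivAt y (y' s) s)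
    (hM : ∀ s ∈ Ioo a t, M < y s → y' s ≤ 0) : y t ≤ max (y a) M := by
  by_contra! hlt
  set S := Icc a t ∩ y ⁻¹' Iic (max (y a) M)
  have hS : IsCompact S := isCompact_Icc.of_isClosed_subset
    (hc.preimage_isClosed_of_isClosed isClosed_Icc isClosed_Iic) inter_subset_left
  -- After its last visit to `(-∞, max (y a) M]`, at time `s`, the function `y` decreases.
  obtain ⟨s, ⟨⟨has, hst⟩, hs⟩, hlast⟩ :=
    hS.exists_isGreatest ⟨a, ⟨le_rfl, ht⟩, le_max_left (y a) M⟩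
  have hsub : Ioo s t ⊆ Ioo a t := Ioo_subset_Ioo_left has
  have habove : ∀ τ ∈ Ioo s t, M < y τ := fun τ hτ => by
    by_contra! h
    exact (hlast ⟨Ioo_subset_Icc_self (hsub hτ), h.trans (le_max_right _ _)⟩).not_gt hτ.1
  have hanti : AntitoneOn y (Icc s t) :=
    antitoneOn_Icc_of_hasDerivAt_nonpos (hc.mono (Icc_subset_Icc_left has))
      (fun τ hτ => hd τ (hsub hτ)) fun τ hτ => hM τ (hsub hτ) (habove τ hτ)
  exact ((hanti ⟨le_rfl, hst⟩ ⟨hst, le_rfl⟩ hst).trans hs).not_gt hlt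

lemma le_mul_of_le_mul {x M N b : ℝ} (hx : 0 ≤ x) (hM : 0 < M) (h : x ≤ M * b) (hMN : M ≤ N) :
    x ≤ N * b :=
  h.trans (mul_le_mul_of_nonneg_right hMN (nonneg_of_mul_nonneg_right (hx.trans h) hM))

/-- The scalar inequalities satisfied by a solution of the Galerkin equations: `z` is the square of
the `L²`-norm of its fluctuation, `A` the integral of `|∇ρ|^β`, `J` the potential energy, `R` the
square of the norm of the time derivative, and `F` and `F'` are the forcing terms. -/
structure EnergyProfile (β c C : ℝ) where
  (z z' A J J' R F F' : ℝ → ℝ)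
  z_nonneg : ∀ t, 0 ≤ z t
  A_nonneg : ∀ t, 0 ≤ A t
  R_nonneg : ∀ t, 0 ≤ R t
  F_nonneg : ∀ t, 0 ≤ F t
  F'_nonneg : ∀ t, 0 ≤ F' t
  continuousOn_z : ContinuousOn z (Ici 0)
  continuousOn_A : ContinuousOn A (Ici 0)
  continuousOn_J : ContinuousOn J (Ici 0)
  continuousOn_R : ContinuousOn R (Ioi 0)
  continuousOn_F : ContinuousOn F (Ici 0)
  continuousOn_F' : ContinuousOn F' (Ici 0)
  hasDerivAt_z : ∀ t, 0 < t → HasDerivAt z (z' t) t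
  hasDerivAt_J : ∀ t, 0 < t → HasDerivAt J (J' t) t
  z'_le : ∀ t, 0 < t → z' t ≤ -c * A t + C * (1 + F t)
  z_rpow_le : ∀ t, 0 < t → z t ^ (β / 2) ≤ C * (A t + (1 + F t))
  J'_le : ∀ t, 0 < t → J' t ≤ -(1 / 2) * R t + C * (A t + (1 + (F t + F' t)))
  le_J : ∀ t, c * A t ≤ J t + C
  J_le : ∀ t, J t ≤ C * A t

namespace EnergyProfile

variable {β c C : ℝ} (𝓔 : EnergyProfile β c C)

lemma integral_A_le {t : ℝ} (ht : 1 ≤ t) :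
    c * ∫ τ in (t - 1)..t, 𝓔.A τ ≤ 𝓔.z (t - 1) + C * (1 + ∫ τ in (t - 1)..t, 𝓔.F τ) := by
  have h0 : 0 ≤ t - 1 := by linarith
  have hle : t - 1 ≤ t := by linarith
  have hA := intervalIntegrable_of_continuousOn_Ici 𝓔.continuousOn_A h0 hle
  have hF := intervalIntegrable_of_continuousOn_Ici 𝓔.continuousOn_F h0 hle
  have hsub : Icc (t - 1) t ⊆ Ici 0 := fun x hx => h0.trans hx.1
  have hdecay := intervalIntegral.sub_le_integral_of_hasDeriv_right_of_le hle
    (g := 𝓔.z) (φ := fun τ => -c * 𝓔.A τ + C * (1 + 𝓔.F τ)) (𝓔.continuousOn_z.mono hsub)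
    (fun x hx => (𝓔.hasDerivAt_z x (h0.trans_lt hx.1)).hasDerivWithinAt)
    (((𝓔.continuousOn_A.const_mul _).add
      ((continuousOn_const.add 𝓔.continuousOn_F).const_mul _)).mono hsub).integrableOn_Icc
    fun x hx => 𝓔.z'_le x (h0.trans_lt hx.1)
  rw [intervalIntegral.integral_add (hA.const_mul _)
    ((intervalIntegrable_const.add hF).const_mul _), intervalIntegral.integral_const_mul,
    intervalIntegral.integral_const_mul, intervalIntegral.integral_add intervalIntegrable_const hF,
    intervalIntegral.integral_const, sub_sub_cancel, one_smul] at hdecay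
  linarith [𝓔.z_nonneg t]

/-- The right-hand side of the energy inequality, up to a constant factor. -/
def load (t : ℝ) : ℝ := 𝓔.A t + (1 + (𝓔.F t + 𝓔.F' t))

lemma load_nonneg (t : ℝ) : 0 ≤ 𝓔.load t :=
  add_nonneg (𝓔.A_nonneg t)
    (add_nonneg zero_le_one (add_nonneg (𝓔.F_nonneg t) (𝓔.F'_nonneg t)))

lemma A_le_load (t : ℝ) : 𝓔.A t ≤ 𝓔.load t :=
  le_add_of_nonneg_right
    (add_nonneg zero_le_one (add_nonneg (𝓔.F_nonneg t) (𝓔.F'_nonneg t)))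

lemma continuousOn_load : ContinuousOn 𝓔.load (Ici 0) :=
  𝓔.continuousOn_A.add (continuousOn_const.add (𝓔.continuousOn_F.add 𝓔.continuousOn_F'))

lemma J_sub_half_le (hC : 0 ≤ C) {t : ℝ} (ht : 1 ≤ t) :
    𝓔.J (t - 1 / 2) ≤ 4 * C * ∫ τ in (t - 1)..(t - 1 / 2), 𝓔.load τ := by
  have h0 : 0 ≤ t - 1 := by linarith
  have hsub : Icc (t - 1) (t - 1 / 2) ⊆ Ici 0 := fun x hx => h0.trans hx.1
  -- The weight vanishes at `t - 1`, where nothing is known about the energy.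
  have hweighted := intervalIntegral.sub_le_integral_of_hasDeriv_right_of_le
    (a := t - 1) (b := t - 1 / 2) (by linarith)
    (g := fun τ => (τ - (t - 1)) * 𝓔.J τ) (φ := fun τ => 2 * C * 𝓔.load τ)
    ((by fun_prop : ContinuousOn (fun τ : ℝ => τ - (t - 1)) _).mul (𝓔.continuousOn_J.mono hsub))
    (fun x hx => (((hasDerivAt_id x).sub_const (t - 1)).mul
      (𝓔.hasDerivAt_J x (h0.trans_lt hx.1))).hasDerivWithinAt)
    ((𝓔.continuousOn_load.const_mul _).mono hsub).integrableOn_Icc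
    fun x hx => by
      have hJ : 𝓔.J x ≤ C * 𝓔.load x :=
        (𝓔.J_le x).trans (mul_le_mul_of_nonneg_left (𝓔.A_le_load x) hC)
      have hJ' : 𝓔.J' x ≤ C * 𝓔.load x :=
        (𝓔.J'_le x (h0.trans_lt hx.1)).trans (by rw [load]; linarith [𝓔.R_nonneg x])
      have hw0 : 0 ≤ x - (t - 1) := by linarith [hx.1]
      have hw1 : x - (t - 1) ≤ 1 := by linarith [hx.2]
      have hload := mul_nonneg hC (𝓔.load_nonneg x)
      simp only [id_eq]
      nlinarith
  rw [intervalIntegral.integral_const_mul] at hweighted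
  linarith

lemma integral_R_add_J_le {t : ℝ} (ht : 1 ≤ t) :
    1 / 2 * (∫ τ in (t - 1 / 2)..t, 𝓔.R τ) + 𝓔.J t ≤
      𝓔.J (t - 1 / 2) + C * ∫ τ in (t - 1 / 2)..t, 𝓔.load τ := by
  have h0 : 0 < t - 1 / 2 := by linarith
  have hle : t - 1 / 2 ≤ t := by linarith
  have hsub : Icc (t - 1 / 2) t ⊆ Ioi 0 := fun x hx => h0.trans_le hx.1
  have hR := (𝓔.continuousOn_R.mono hsub).intervalIntegrable_of_Icc hle (μ := volume)
  have hload := intervalIntegrable_of_continuousOn_Ici 𝓔.continuousOn_load h0.le hle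
  have hdecay := intervalIntegral.sub_le_integral_of_hasDeriv_right_of_le hle
    (g := 𝓔.J) (φ := fun τ => -(1 / 2) * 𝓔.R τ + C * 𝓔.load τ)
    (𝓔.continuousOn_J.mono (hsub.trans Ioi_subset_Ici_self))
    (fun x hx => (𝓔.hasDerivAt_J x (h0.trans hx.1)).hasDerivWithinAt)
    (((𝓔.continuousOn_R.mono hsub).const_mul _).add
      ((𝓔.continuousOn_load.mono (hsub.trans Ioi_subset_Ici_self)).const_mul _)).integrableOn_Icc
    fun x hx => 𝓔.J'_le x (h0.trans hx.1)
  rw [intervalIntegral.integral_add (hR.const_mul _) (hload.const_mul _),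
    intervalIntegral.integral_const_mul, intervalIntegral.integral_const_mul] at hdecay
  linarith

lemma integral_R_add_A_le (hC : 0 ≤ C) {t : ℝ} (ht : 1 ≤ t) :
    1 / 2 * (∫ τ in (t - 1 / 2)..t, 𝓔.R τ) + c * 𝓔.A t ≤
      C * (5 + 4 * ((∫ τ in (t - 1)..t, 𝓔.A τ) +
        ∫ τ in (t - 1)..t, (𝓔.F τ + 𝓔.F' τ))) := by
  have h0 : 0 ≤ t - 1 := by linarith
  have hle : t - 1 ≤ t := by linarith
  have hload₁ := intervalIntegrable_of_continuousOn_Ici 𝓔.continuousOn_load h0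
    (by linarith : t - 1 ≤ t - 1 / 2)
  have hload₂ := intervalIntegrable_of_continuousOn_Ici 𝓔.continuousOn_load
    (by linarith : 0 ≤ t - 1 / 2) (by linarith : t - 1 / 2 ≤ t)
  have hF : IntervalIntegrable (fun τ => 𝓔.F τ + 𝓔.F' τ) volume (t - 1) t :=
    intervalIntegrable_of_continuousOn_Ici (𝓔.continuousOn_F.add 𝓔.continuousOn_F') h0 hle
  have hsplit := intervalIntegral.integral_add_adjacent_intervals hload₁ hload₂
  have hload_eq : ∫ τ in (t - 1)..t, 𝓔.load τ = (∫ τ in (t - 1)..t, 𝓔.A τ) +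
      (1 + ∫ τ in (t - 1)..t, (𝓔.F τ + 𝓔.F' τ)) := by
    unfold load
    rw [intervalIntegral.integral_add
      (intervalIntegrable_of_continuousOn_Ici 𝓔.continuousOn_A h0 hle)
      (intervalIntegrable_const.add hF), intervalIntegral.integral_add intervalIntegrable_const hF,
      intervalIntegral.integral_const, sub_sub_cancel, one_smul]
  have htail : 0 ≤ C * ∫ τ in (t - 1 / 2)..t, 𝓔.load τ :=
    mul_nonneg hC (intervalIntegral.integral_nonneg (by linarith) fun τ _ => 𝓔.load_nonneg τ)
  have hhalf := 𝓔.J_sub_half_le hC ht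
  have htotal : C * ∫ τ in (t - 1)..t, 𝓔.load τ =
      C * (∫ τ in (t - 1)..(t - 1 / 2), 𝓔.load τ) + C * ∫ τ in (t - 1 / 2)..t, 𝓔.load τ := by
    rw [← hsplit, mul_add]
  rw [hload_eq] at htotal
  linarith [𝓔.integral_R_add_J_le ht, 𝓔.le_J t]

lemma z_le_max (hβ : 0 < β) (hc : 0 < c) (hC : 0 < C) {t e : ℝ} (ht : 0 ≤ t)
    (he : ∀ s ∈ Icc 0 t, 𝓔.F s ≤ e) :
    𝓔.z t ≤ max (𝓔.z 0) ((C * (1 + C / c) * (1 + e)) ^ (2 / β)) := by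
  have he0 : 0 ≤ e := (𝓔.F_nonneg 0).trans (he 0 ⟨le_rfl, ht⟩)
  refine le_max_of_hasDerivAt_nonpos_of_lt ht (𝓔.continuousOn_z.mono fun x hx => hx.1)
    (fun s hs => 𝓔.hasDerivAt_z s hs.1) fun s hs hlt => ?_
  have hFe : 1 + 𝓔.F s ≤ 1 + e := by linarith [he s (Ioo_subset_Icc_self hs)]
  have hz : C * (1 + C / c) * (1 + e) < 𝓔.z s ^ (β / 2) := by
    rwa [← inv_div β 2, Real.rpow_inv_lt_iff_of_pos (by positivity) (𝓔.z_nonneg s)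
      (by positivity)] at hlt
  have hA : C * (1 + e) ≤ c * 𝓔.A s := by
    have hchain : C * (C / c * (1 + e) + (1 + e)) ≤ C * (𝓔.A s + (1 + e)) :=
      calc C * (C / c * (1 + e) + (1 + e)) = C * (1 + C / c) * (1 + e) := by ring
        _ ≤ 𝓔.z s ^ (β / 2) := hz.le
        _ ≤ C * (𝓔.A s + (1 + 𝓔.F s)) := 𝓔.z_rpow_le s hs.1
        _ ≤ _ := by gcongr
    have hcancel := le_of_add_le_add_right (le_of_mul_le_mul_left hchain hC)
    rwa [div_mul_eq_mul_div, div_le_iff₀' hc] at hcancel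
  calc 𝓔.z' s ≤ -c * 𝓔.A s + C * (1 + 𝓔.F s) := 𝓔.z'_le s hs.1
    _ ≤ -c * 𝓔.A s + C * (1 + e) := by gcongr
    _ ≤ 0 := by linarith

lemma integral_F_le {t e : ℝ} (ht : 1 ≤ t) (he : ∀ s ∈ Icc 0 t, 𝓔.F s ≤ e) :
    ∫ τ in (t - 1)..t, 𝓔.F τ ≤ e := by
  have h0 : 0 ≤ t - 1 := by linarith
  have hle : t - 1 ≤ t := by linarith
  simpa using intervalIntegral.integral_mono_on hle
    (intervalIntegrable_of_continuousOn_Ici 𝓔.continuousOn_F h0 hle)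
    (intervalIntegrable_const (μ := volume) (c := e)) fun s hs => he s ⟨h0.trans hs.1, hs.2⟩

lemma exists_integral_A_le (β : ℝ) (hc : 0 < c) (hC : 0 < C) :
    ∃ M : ℝ, 0 < M ∧ ∀ (𝓔 : EnergyProfile β c C) (t : ℝ), 1 ≤ t →
      ∫ τ in (t - 1)..t, 𝓔.A τ ≤ M * (1 + 𝓔.z (t - 1) + ∫ τ in (t - 1)..t, 𝓔.F τ) := by
  refine ⟨(1 + C) / c, by positivity, fun 𝓔 t ht => ?_⟩
  have hF : 0 ≤ ∫ τ in (t - 1)..t, 𝓔.F τ :=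
    intervalIntegral.integral_nonneg (by linarith) fun τ _ => 𝓔.F_nonneg τ
  rw [div_mul_eq_mul_div, le_div_iff₀' hc]
  linarith [𝓔.integral_A_le ht, mul_nonneg hC.le (𝓔.z_nonneg (t - 1))]

lemma exists_integral_R_add_A_le (β : ℝ) (hc : 0 < c) (hC : 0 < C) :
    ∃ M : ℝ, 0 < M ∧ ∀ (𝓔 : EnergyProfile β c C) (t : ℝ), 1 ≤ t →
      (∫ τ in (t - 1 / 2)..t, 𝓔.R τ) + 𝓔.A t ≤
        M * (1 + 𝓔.z (t - 1) + ∫ τ in (t - 1)..t, (𝓔.F τ + 𝓔.F' τ)) := by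
  obtain ⟨M, hM, hA⟩ := exists_integral_A_le β hc hC
  refine ⟨C * (5 + 4 * (M + 1)) / min (1 / 2) c, by positivity, fun 𝓔 t ht => ?_⟩
  have hm : 0 < min (1 / 2) c := by positivity
  have h0 : 0 ≤ t - 1 := by linarith
  have hle : t - 1 ≤ t := by linarith
  have hR : 0 ≤ ∫ τ in (t - 1 / 2)..t, 𝓔.R τ :=
    intervalIntegral.integral_nonneg (by linarith) fun τ _ => 𝓔.R_nonneg τ
  have hF : ∫ τ in (t - 1)..t, 𝓔.F τ ≤ ∫ τ in (t - 1)..t, (𝓔.F τ + 𝓔.F' τ) :=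
    intervalIntegral.integral_mono_on hle
      (intervalIntegrable_of_continuousOn_Ici 𝓔.continuousOn_F h0 hle)
      (intervalIntegrable_of_continuousOn_Ici
        (𝓔.continuousOn_F.add 𝓔.continuousOn_F') h0 hle)
      fun τ _ => le_add_of_nonneg_right (𝓔.F'_nonneg τ)
  set I := ∫ τ in (t - 1)..t, (𝓔.F τ + 𝓔.F' τ)
  have hI : 0 ≤ I := intervalIntegral.integral_nonneg hle fun τ _ =>
    add_nonneg (𝓔.F_nonneg τ) (𝓔.F'_nonneg τ)
  have hz := 𝓔.z_nonneg (t - 1)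
  rw [div_mul_eq_mul_div, le_div_iff₀' hm]
  calc min (1 / 2) c * ((∫ τ in (t - 1 / 2)..t, 𝓔.R τ) + 𝓔.A t)
      ≤ 1 / 2 * (∫ τ in (t - 1 / 2)..t, 𝓔.R τ) + c * 𝓔.A t := by
        rw [mul_add]
        gcongr
        exacts [min_le_left _ _, 𝓔.A_nonneg t, min_le_right _ _]
    _ ≤ C * (5 + 4 * ((∫ τ in (t - 1)..t, 𝓔.A τ) + I)) := 𝓔.integral_R_add_A_le hC.le ht
    _ ≤ C * (5 * (1 + 𝓔.z (t - 1) + I) +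
          4 * (M * (1 + 𝓔.z (t - 1) + I) + (1 + 𝓔.z (t - 1) + I))) := by
      gcongr
      · linarith
      · exact (hA 𝓔 t ht).trans (by gcongr)
      · linarith
    _ = C * (5 + 4 * (M + 1)) * (1 + 𝓔.z (t - 1) + I) := by ring

lemma exists_A_le (hβ : 0 < β) (hβ2 : β ≤ 2) (hc : 0 < c) (hC : 0 < C) :
    ∃ M : ℝ, 0 < M ∧ ∀ (𝓔 : EnergyProfile β c C) (t e : ℝ), 1 ≤ t →
      (∀ s ∈ Icc 0 t, 𝓔.F s ≤ e) →
      𝓔.A t ≤ M * (1 + 𝓔.z 0 + e ^ (2 / β) + ∫ τ in (t - 1)..t, 𝓔.F' τ) := by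
  obtain ⟨M, hM, hA⟩ := exists_integral_R_add_A_le β hc hC
  set k := (C * (1 + C / c)) ^ (2 / β) * 2 ^ (2 / β)
  have hk : 0 < k := by positivity
  refine ⟨M * (2 + k), by positivity, fun 𝓔 t e ht he => ?_⟩
  have h0 : 0 ≤ t - 1 := by linarith
  have hle : t - 1 ≤ t := by linarith
  have he0 : 0 ≤ e := (𝓔.F_nonneg 0).trans (he 0 ⟨le_rfl, by linarith⟩)
  set q := e ^ (2 / β)
  have hq : 0 ≤ q := Real.rpow_nonneg he0 _
  have hz : 𝓔.z (t - 1) ≤ 𝓔.z 0 + k * (1 + q) := by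
    have hpow : (C * (1 + C / c) * (1 + e)) ^ (2 / β) ≤ k * (1 + q) := by
      rw [Real.mul_rpow (by positivity) (by positivity), mul_assoc]
      gcongr
      simpa using add_rpow_le zero_le_one he0 (show 0 ≤ 2 / β by positivity)
    refine (𝓔.z_le_max hβ hc hC h0 fun s hs => he s ⟨hs.1, hs.2.trans hle⟩).trans (max_le ?_ ?_)
    · exact le_add_of_nonneg_right (by positivity)
    · exact hpow.trans (le_add_of_nonneg_left (𝓔.z_nonneg 0))
  have hF : ∫ τ in (t - 1)..t, 𝓔.F τ ≤ 1 + q := by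
    have := rpow_le_one_add_rpow he0 zero_le_one ((one_le_div hβ).2 hβ2)
    rw [Real.rpow_one] at this
    exact (𝓔.integral_F_le ht he).trans this
  have hsum : ∫ τ in (t - 1)..t, (𝓔.F τ + 𝓔.F' τ) =
      (∫ τ in (t - 1)..t, 𝓔.F τ) + ∫ τ in (t - 1)..t, 𝓔.F' τ :=
    intervalIntegral.integral_add (intervalIntegrable_of_continuousOn_Ici 𝓔.continuousOn_F h0 hle)
      (intervalIntegrable_of_continuousOn_Ici 𝓔.continuousOn_F' h0 hle)
  set I := ∫ τ in (t - 1)..t, 𝓔.F' τ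
  have hI : 0 ≤ I := intervalIntegral.integral_nonneg hle fun τ _ => 𝓔.F'_nonneg τ
  have hR : 0 ≤ ∫ τ in (t - 1 / 2)..t, 𝓔.R τ :=
    intervalIntegral.integral_nonneg (by linarith) fun τ _ => 𝓔.R_nonneg τ
  calc 𝓔.A t ≤ M * (1 + 𝓔.z (t - 1) + ∫ τ in (t - 1)..t, (𝓔.F τ + 𝓔.F' τ)) :=
        (le_add_of_nonneg_left hR).trans (hA 𝓔 t ht)
    _ ≤ M * (1 + (𝓔.z 0 + k * (1 + q)) + ((1 + q) + I)) := by rw [hsum]; gcongr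
    _ ≤ M * ((2 + k) * (1 + 𝓔.z 0 + q + I)) := by
      gcongr
      nlinarith [𝓔.z_nonneg 0, mul_nonneg hk.le (𝓔.z_nonneg 0), mul_nonneg hk.le hI]
    _ = M * (2 + k) * (1 + 𝓔.z 0 + q + I) := by ring

lemma exists_estimates (hβ : 0 < β) (hβ2 : β ≤ 2) (hc : 0 < c) (hC : 0 < C) :
    ∃ M : ℝ, 0 < M ∧ ∀ (𝓔 : EnergyProfile β c C) (t : ℝ), 1 ≤ t →
      (∫ τ in (t - 1)..t, 𝓔.A τ ≤ M * (1 + 𝓔.z (t - 1) + ∫ τ in (t - 1)..t, 𝓔.F τ)) ∧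
      ((∫ τ in (t - 1 / 2)..t, 𝓔.R τ) + 𝓔.A t ≤
        M * (1 + 𝓔.z (t - 1) + ∫ τ in (t - 1)..t, (𝓔.F τ + 𝓔.F' τ))) ∧
      ∀ e, (∀ s ∈ Icc 0 t, 𝓔.F s ≤ e) →
        𝓔.A t ≤ M * (1 + 𝓔.z 0 + e ^ (2 / β) + ∫ τ in (t - 1)..t, 𝓔.F' τ) := by
  obtain ⟨K, hK, integral_A_le⟩ := exists_integral_A_le β hc hC
  obtain ⟨L, hL, integral_R_le⟩ := exists_integral_R_add_A_le β hc hC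
  obtain ⟨N, hN, A_le⟩ := exists_A_le hβ hβ2 hc hC
  refine ⟨K + L + N, by positivity, fun 𝓔 t ht => ⟨?_, ?_, fun e he => ?_⟩⟩
  · exact le_mul_of_le_mul (intervalIntegral.integral_nonneg (by linarith) fun τ _ => 𝓔.A_nonneg τ)
      hK (integral_A_le 𝓔 t ht) (by linarith)
  · exact le_mul_of_le_mul (add_nonneg (intervalIntegral.integral_nonneg (by linarith)
      fun τ _ => 𝓔.R_nonneg τ) (𝓔.A_nonneg t)) hL (integral_R_le 𝓔 t ht) (by linarith)
  · exact le_mul_of_le_mul (𝓔.A_nonneg t) hN (A_le 𝓔 t e ht he) (by linarith)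

end EnergyProfile

/-! ### Galerkin equations in a finite-dimensional space -/

section ParametricIntegrals

variable {X Y W F : Type*} [MeasurableSpace X] {μ : Measure X} [IsFiniteMeasure μ]
  [NormedAddCommGroup Y] [ProperSpace Y] [NormedAddCommGroup F] {D : X → Y} {M : ℝ}

lemma integrable_comp_of_norm_le (hD : StronglyMeasurable D) (hM : ∀ x, ‖D x‖ ≤ M) {ψ : Y → F}
    (hψ : Continuous ψ) : Integrable (fun x => ψ (D x)) μ := by
  obtain ⟨C, hC⟩ := (isCompact_closedBall (0 : Y) M).exists_bound_of_continuousOn hψ.continuousOn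
  exact .of_bound (hψ.comp_stronglyMeasurable hD).aestronglyMeasurable C
    (ae_of_all _ fun x => hC _ (mem_closedBall_zero_iff.2 (hM x)))

variable [NormedSpace ℝ F] [NormedAddCommGroup W] [ProperSpace W]

lemma continuous_integral_comp_of_norm_le (hD : StronglyMeasurable D) (hM : ∀ x, ‖D x‖ ≤ M)
    {ψ : W → Y → F} (hψ : Continuous (Function.uncurry ψ)) :
    Continuous fun w => ∫ x, ψ w (D x) ∂μ := by
  refine continuous_iff_continuousAt.2 fun w₀ => ?_
  obtain ⟨C, hC⟩ := ((isCompact_closedBall w₀ 1).prod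
    (isCompact_closedBall (0 : Y) M)).exists_bound_of_continuousOn hψ.continuousOn
  refine continuousAt_of_dominated (bound := fun _ => C) (.of_forall fun w =>
    ((hψ.comp (.prodMk_right w)).comp_stronglyMeasurable hD).aestronglyMeasurable) ?_
    (integrable_const _) (ae_of_all _ fun x => (hψ.comp (.prodMk_left (D x))).continuousAt)
  filter_upwards [Metric.closedBall_mem_nhds w₀ one_pos] with w hw
  exact ae_of_all _ fun x => hC (w, D x) ⟨hw, mem_closedBall_zero_iff.2 (hM x)⟩

lemma hasFDerivAt_integral_comp_of_norm_le [NormedSpace ℝ W] (hD : StronglyMeasurable D)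
    (hM : ∀ x, ‖D x‖ ≤ M) {ψ : W → Y → F} {ψ' : W → Y → W →L[ℝ] F} (hψ : ∀ w, Continuous (ψ w))
    (hψ' : Continuous (Function.uncurry ψ'))
    (hderiv : ∀ w y, HasFDerivAt (fun w => ψ w y) (ψ' w y) w) (w₀ : W) :
    HasFDerivAt (fun w => ∫ x, ψ w (D x) ∂μ) (∫ x, ψ' w₀ (D x) ∂μ) w₀ := by
  obtain ⟨C, hC⟩ := ((isCompact_closedBall w₀ 1).prod
    (isCompact_closedBall (0 : Y) M)).exists_bound_of_continuousOn hψ'.continuousOn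
  exact hasFDerivAt_integral_of_dominated_of_fderiv_le (bound := fun _ => C)
    (Metric.closedBall_mem_nhds w₀ one_pos)
    (.of_forall fun w => ((hψ w).comp_stronglyMeasurable hD).aestronglyMeasurable)
    (integrable_comp_of_norm_le hD hM (hψ w₀))
    ((hψ'.comp (.prodMk_right w₀)).comp_stronglyMeasurable hD).aestronglyMeasurable
    (ae_of_all _ fun x w hw => hC (w, D x) ⟨hw, mem_closedBall_zero_iff.2 (hM x)⟩)
    (integrable_const _) (ae_of_all _ fun x w _ => hderiv w (D x))

end ParametricIntegrals

lemma ForchheimerPoly.mul_le_rpow_beta_add_rpow_lam (g : ForchheimerPoly) {ε x y : ℝ} (hε : 0 < ε)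
    (hx : 0 ≤ x) (hy : 0 ≤ y) : x * y ≤ ε * x ^ g.beta + ε⁻¹ ^ (g.lam - 1) * y ^ g.lam := by
  have hb : 0 < g.beta - 1 := sub_pos.2 g.one_lt_beta
  have hlam : (g.beta - 1) * (g.lam - 1) = 1 := by
    rw [g.lam_eq]
    field_simp
    ring
  have hconj : (g.beta - 1) * g.lam = g.beta := by linarith
  have h := rpow_sub_one_mul_le (b := g.lam) (by linarith [g.two_le_lam]) hε
    (Real.rpow_nonneg hx (g.beta - 1)) hy
  rwa [← Real.rpow_mul hx, ← Real.rpow_mul hx, hlam, hconj, Real.rpow_one] at h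

/-- The Riesz representative of the functional `v ↦ (K(|Lw|)Lw, Lv)`. -/
def ForchheimerPoly.fluxDual (g : ForchheimerPoly) {E W : Type*} [NormedAddCommGroup E]
    [InnerProductSpace ℝ E] [CompleteSpace E] [NormedAddCommGroup W] [InnerProductSpace ℝ W]
    [CompleteSpace W] (w : W) (L : W →L[ℝ] E) : W :=
  ContinuousLinearMap.adjoint L (g.flux (L w))

lemma ForchheimerPoly.continuous_fluxDual (g : ForchheimerPoly) {E W : Type*}
    [NormedAddCommGroup E] [InnerProductSpace ℝ E] [CompleteSpace E] [NormedAddCommGroup W]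
    [InnerProductSpace ℝ W] [CompleteSpace W] :
    Continuous (Function.uncurry (g.fluxDual : W → (W →L[ℝ] E) → W)) := by
  have hadj : Continuous fun z : W × (W →L[ℝ] E) => ContinuousLinearMap.adjoint z.2 :=
    ContinuousLinearMap.adjoint.continuous.comp continuous_snd
  exact hadj.clm_apply (g.continuous_flux.comp (by fun_prop))

/-- A space `W` of functions on `X`, given abstractly by the bounded measurable family of linear
maps `D x` that send `w : W` to its gradient at the point `x`. -/
structure DiscreteGradient (X E W : Type*) [MeasurableSpace X] [NormedAddCommGroup E]
    [InnerProductSpace ℝ E] [NormedAddCommGroup W] [InnerProductSpace ℝ W] where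
  D : X → W →L[ℝ] E
  bound : ℝ
  stronglyMeasurable_D : StronglyMeasurable D
  norm_D_le : ∀ x, ‖D x‖ ≤ bound

namespace DiscreteGradient

variable {X E W : Type*} [MeasurableSpace X] [NormedAddCommGroup E] [InnerProductSpace ℝ E]
  [NormedAddCommGroup W] [InnerProductSpace ℝ W] (𝓓 : DiscreteGradient X E W)

/-- The elements of `W` with zero gradient, that is, the piecewise constants. -/
def constants : Submodule ℝ W := ⨅ x, (𝓓.D x).ker

variable {𝓓} in
lemma mem_constants {n : W} : n ∈ 𝓓.constants ↔ ∀ x, 𝓓.D x n = 0 := by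
  simp [constants]

variable (g : ForchheimerPoly) (μ : Measure X)

/-- The integral `∫ |∇w|^β`. -/
def dissipation (w : W) : ℝ := ∫ x, ‖𝓓.D x w‖ ^ g.beta ∂μ

/-- The integral of the potential of the flux at `∇w`. -/
def energy (w : W) : ℝ := ∫ x, g.potential (𝓓.D x w) ∂μ

lemma dissipation_nonneg (w : W) : 0 ≤ 𝓓.dissipation g μ w :=
  integral_nonneg fun _ => Real.rpow_nonneg (norm_nonneg _) _

variable [FiniteDimensional ℝ W]

/-- The fluctuation of `w`, its orthogonal projection onto the complement of the piecewise
constants. -/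
def fluctuation : W →L[ℝ] W := 𝓓.constantsᗮ.starProjection

lemma D_fluctuation (x : X) (w : W) : 𝓓.D x (𝓓.fluctuation w) = 𝓓.D x w := by
  rw [fluctuation, Submodule.starProjection_orthogonal_val, map_sub,
    mem_constants.1 (𝓓.constants.starProjection_apply_mem w) x, sub_zero]

lemma inner_fluctuation_fluctuation (v w : W) :
    ⟪𝓓.fluctuation v, 𝓓.fluctuation w⟫ = ⟪𝓓.fluctuation v, w⟫ := by
  rw [fluctuation, Submodule.inner_starProjection_left_eq_right,
    Submodule.starProjection_eq_self_iff.2 (Submodule.starProjection_apply_mem _ w),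
    ← Submodule.inner_starProjection_left_eq_right]

lemma norm_fluctuation_le (w : W) : ‖𝓓.fluctuation w‖ ≤ ‖w‖ :=
  Submodule.norm_starProjection_apply_le _ w

lemma norm_fluctuation_le_norm_sub (w : W) {n : W} (hn : n ∈ 𝓓.constants) :
    ‖𝓓.fluctuation w‖ ≤ ‖w - n‖ := by
  have hzero : 𝓓.fluctuation n = 0 :=
    (Submodule.starProjection_apply_eq_zero_iff _).2 (Submodule.le_orthogonal_orthogonal _ hn)
  simpa [hzero] using 𝓓.norm_fluctuation_le (w - n)

variable [IsFiniteMeasure μ]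

variable [FiniteDimensional ℝ E]

/-- The gradient of the energy, that is, the Riesz representative of the functional
`v ↦ (K(|∇w|)∇w, ∇v)`. -/
def energyGradient (w : W) : W := ∫ x, g.fluxDual w (𝓓.D x) ∂μ

lemma integrable_rpow (w : W) : Integrable (fun x => ‖𝓓.D x w‖ ^ g.beta) μ :=
  integrable_comp_of_norm_le 𝓓.stronglyMeasurable_D 𝓓.norm_D_le (ψ := fun L => ‖L w‖ ^ g.beta)
    ((Real.continuous_rpow_const g.beta_pos.le).comp (by fun_prop))

lemma integrable_potential (w : W) : Integrable (fun x => g.potential (𝓓.D x w)) μ :=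
  integrable_comp_of_norm_le 𝓓.stronglyMeasurable_D 𝓓.norm_D_le (ψ := fun L => g.potential (L w))
    (g.continuous_potential.comp (by fun_prop))

lemma integrable_inner_flux (w v : W) :
    Integrable (fun x => ⟪g.flux (𝓓.D x w), 𝓓.D x v⟫) μ :=
  integrable_comp_of_norm_le 𝓓.stronglyMeasurable_D 𝓓.norm_D_le
    (ψ := fun L => ⟪g.flux (L w), L v⟫)
    ((g.continuous_flux.comp (by fun_prop : Continuous fun L : W →L[ℝ] E => L w)).inner
      (by fun_prop))

lemma integrable_sq (w : W) : Integrable (fun x => ‖𝓓.D x w‖ ^ 2) μ :=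
  integrable_comp_of_norm_le 𝓓.stronglyMeasurable_D 𝓓.norm_D_le (ψ := fun L => ‖L w‖ ^ 2)
    (by fun_prop)

lemma integrable_one_add_sq (w : W) : Integrable (fun x => 1 + ‖𝓓.D x w‖ ^ 2) μ :=
  (integrable_const 1).add (𝓓.integrable_sq μ w)

lemma integral_one_add_sq (w : W) :
    ∫ x, (1 + ‖𝓓.D x w‖ ^ 2) ∂μ = μ.real univ + ∫ x, ‖𝓓.D x w‖ ^ 2 ∂μ := by
  simp [integral_add (integrable_const _) (𝓓.integrable_sq μ w)]

lemma continuous_dissipation : Continuous (𝓓.dissipation g μ) :=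
  continuous_integral_comp_of_norm_le 𝓓.stronglyMeasurable_D 𝓓.norm_D_le
    (ψ := fun w L => ‖L w‖ ^ g.beta) ((Real.continuous_rpow_const g.beta_pos.le).comp
      (by fun_prop : Continuous fun z : W × (W →L[ℝ] E) => ‖z.2 z.1‖))

lemma continuous_energyGradient : Continuous (𝓓.energyGradient g μ) :=
  continuous_integral_comp_of_norm_le 𝓓.stronglyMeasurable_D 𝓓.norm_D_le
    g.continuous_fluxDual

lemma integrable_fluxDual (w : W) : Integrable (fun x => g.fluxDual w (𝓓.D x)) μ := by
  have hcont : Continuous (g.fluxDual w : (W →L[ℝ] E) → W) :=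
    g.continuous_fluxDual.uncurry_left w
  exact integrable_comp_of_norm_le 𝓓.stronglyMeasurable_D 𝓓.norm_D_le hcont

lemma inner_energyGradient (w v : W) :
    ⟪𝓓.energyGradient g μ w, v⟫ = ∫ x, ⟪g.flux (𝓓.D x w), 𝓓.D x v⟫ ∂μ := by
  rw [energyGradient, real_inner_comm, ← integral_inner (𝓓.integrable_fluxDual g μ w)]
  refine integral_congr_ae (ae_of_all _ fun x => ?_)
  simp only [ForchheimerPoly.fluxDual, ContinuousLinearMap.adjoint_inner_right]
  exact real_inner_comm _ _

lemma hasFDerivAt_energy (w : W) :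
    HasFDerivAt (𝓓.energy g μ) (innerSL ℝ (𝓓.energyGradient g μ w)) w := by
  rw [energyGradient, ← ContinuousLinearMap.integral_comp_comm _ (𝓓.integrable_fluxDual g μ w)]
  refine hasFDerivAt_integral_comp_of_norm_le 𝓓.stronglyMeasurable_D 𝓓.norm_D_le
    (ψ := fun w L => g.potential (L w)) (fun w => g.continuous_potential.comp (by fun_prop))
    (ψ' := fun w L => innerSL ℝ (g.fluxDual w L))
    ((innerSL ℝ).continuous.comp g.continuous_fluxDual) (fun w L => ?_) w
  refine ((g.hasFDerivAt_potential (L w)).comp w L.hasFDerivAt).congr_fderiv ?_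
  ext v
  simp [ForchheimerPoly.fluxDual, ContinuousLinearMap.adjoint_inner_left]

lemma continuous_energy : Continuous (𝓓.energy g μ) :=
  continuous_iff_continuousAt.2 fun w => (𝓓.hasFDerivAt_energy g μ w).continuousAt

variable {g} {c C : ℝ}

lemma mul_dissipation_le_inner (hg : g.GrowthBounds E c C) (w q : W) :
    c * 𝓓.dissipation g μ w ≤ ⟪𝓓.energyGradient g μ w, w - q⟫ +
      C * (μ.real univ + ∫ x, ‖𝓓.D x q‖ ^ 2 ∂μ) := by
  have hq := (𝓓.integrable_one_add_sq μ q).const_mul C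
  have hflux := 𝓓.integrable_inner_flux g μ w (w - q)
  rw [inner_energyGradient, ← integral_one_add_sq, dissipation, ← integral_const_mul,
    ← integral_const_mul, ← integral_add hflux hq]
  refine integral_mono ((𝓓.integrable_rpow g μ w).const_mul c) (hflux.add hq) fun x => ?_
  simpa using hg.coercive (𝓓.D x w) (𝓓.D x q)

lemma inner_energyGradient_le (hg : g.GrowthBounds E c C) (w q : W) :
    ⟪𝓓.energyGradient g μ w, q⟫ ≤ 𝓓.dissipation g μ w +
      C * (μ.real univ + ∫ x, ‖𝓓.D x q‖ ^ 2 ∂μ) := by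
  have hq := (𝓓.integrable_one_add_sq μ q).const_mul C
  have hpow := 𝓓.integrable_rpow g μ w
  rw [inner_energyGradient, ← integral_one_add_sq, dissipation, ← integral_const_mul,
    ← integral_add hpow hq]
  exact integral_mono (𝓓.integrable_inner_flux g μ w q) (hpow.add hq) fun x => hg.flux_le _ _

lemma mul_dissipation_le_energy (hg : g.GrowthBounds E c C) (w : W) :
    c * 𝓓.dissipation g μ w ≤ 𝓓.energy g μ w + C * μ.real univ := by
  have hconst : C * μ.real univ = ∫ _, C ∂μ := by simp [mul_comm]
  rw [hconst, dissipation, energy, ← integral_const_mul,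
    ← integral_add (𝓓.integrable_potential g μ w) (integrable_const C)]
  exact integral_mono ((𝓓.integrable_rpow g μ w).const_mul c)
    ((𝓓.integrable_potential g μ w).add (integrable_const C)) fun x => hg.le_potential _

lemma energy_le (hg : g.GrowthBounds E c C) (w : W) :
    𝓓.energy g μ w ≤ C * 𝓓.dissipation g μ w := by
  rw [dissipation, energy, ← integral_const_mul]
  exact integral_mono (𝓓.integrable_potential g μ w) ((𝓓.integrable_rpow g μ w).const_mul C)
    fun x => hg.potential_le _

variable (g) in
lemma dissipation_sub_le (w q : W) : 𝓓.dissipation g μ (w - q) ≤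
    4 * (𝓓.dissipation g μ w + (μ.real univ + ∫ x, ‖𝓓.D x q‖ ^ 2 ∂μ)) := by
  have hq := 𝓓.integrable_one_add_sq μ q
  have hpow := 𝓓.integrable_rpow g μ w
  have hfour : (2 : ℝ) ^ g.beta ≤ 4 :=
    calc (2 : ℝ) ^ g.beta ≤ 2 ^ (2 : ℝ) :=
          Real.rpow_le_rpow_of_exponent_le one_le_two g.beta_lt_two.le
      _ = 4 := by norm_num
  rw [← integral_one_add_sq, dissipation, dissipation, ← integral_add hpow hq,
    ← integral_const_mul]
  refine integral_mono (𝓓.integrable_rpow g μ _) ((hpow.add hq).const_mul 4) fun x => ?_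
  calc ‖𝓓.D x (w - q)‖ ^ g.beta ≤ (‖𝓓.D x w‖ + ‖𝓓.D x q‖) ^ g.beta :=
        Real.rpow_le_rpow (norm_nonneg _) (map_sub (𝓓.D x) w q ▸ norm_sub_le _ _) g.beta_pos.le
    _ ≤ 2 ^ g.beta * (‖𝓓.D x w‖ ^ g.beta + ‖𝓓.D x q‖ ^ g.beta) :=
        add_rpow_le (norm_nonneg _) (norm_nonneg _) g.beta_pos.le
    _ ≤ 4 * (‖𝓓.D x w‖ ^ g.beta + (1 + ‖𝓓.D x q‖ ^ 2)) := by
      gcongr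
      exact rpow_le_one_add_sq (norm_nonneg _) g.beta_pos.le g.beta_lt_two.le

end DiscreteGradient

/-- A solution of the Galerkin equations as a curve in the finite-dimensional space `W`: the
unknown is `u`, the boundary data enter through `p`, and `P` and `P_t` stand for the squares of the
`H¹`-norms that control `p` and its time derivative. The constants are that of the broken Poincaré
inequality, `S`, and that of the stability of the projection, `B`. -/
structure GalerkinFlow (g : ForchheimerPoly) {X : Type*} [MeasurableSpace X] (μ : Measure X)
    (E W : Type*) [NormedAddCommGroup E] [InnerProductSpace ℝ E] [FiniteDimensional ℝ E]
    [NormedAddCommGroup W] [InnerProductSpace ℝ W] [FiniteDimensional ℝ W] (S B : ℝ) extends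
    DiscreteGradient X E W where
  (u u_t p p_t f : ℝ → W)
  (P P_t : ℝ → ℝ)
  poincare : ∀ w, ∃ n ∈ toDiscreteGradient.constants,
    ‖w - n‖ ^ g.beta ≤ S * toDiscreteGradient.dissipation g μ w
  continuousOn_u : ContinuousOn u (Ici 0)
  hasDerivAt_u : ∀ t, 0 < t → HasDerivAt u (u_t t) t
  continuousOn_p : ContinuousOn p (Ici 0)
  hasDerivAt_p : ∀ t, 0 < t → HasDerivAt p (p_t t) t
  continuousOn_f : ContinuousOn f (Ici 0)
  continuousOn_P : ContinuousOn P (Ici 0)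
  continuousOn_P_t : ContinuousOn P_t (Ici 0)
  P_nonneg : ∀ t, 0 ≤ P t
  P_t_nonneg : ∀ t, 0 ≤ P_t t
  integral_p_le : ∀ t, 0 < t → ∫ x, ‖D x (p t)‖ ^ 2 ∂μ ≤ B * P t
  integral_p_t_le : ∀ t, 0 < t → ∫ x, ‖D x (p_t t)‖ ^ 2 ∂μ ≤ B * P_t t
  equation : ∀ t, 0 < t → u_t t + toDiscreteGradient.energyGradient g μ (u t + p t) = f t

namespace GalerkinFlow

variable {g : ForchheimerPoly} {X E W : Type*} [MeasurableSpace X] {μ : Measure X}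
  [NormedAddCommGroup E] [InnerProductSpace ℝ E] [FiniteDimensional ℝ E]
  [NormedAddCommGroup W] [InnerProductSpace ℝ W] [FiniteDimensional ℝ W] {S B c C : ℝ}
  (𝓕 : GalerkinFlow g μ E W S B)

/-- The integral of `|∇ρ|^β`, where `ρ = u + p`. -/
def A (t : ℝ) : ℝ := 𝓕.dissipation g μ (𝓕.u t + 𝓕.p t)

/-- The forcing that enters the `L²`-estimate. -/
def F (t : ℝ) : ℝ := ‖𝓕.f t‖ ^ g.lam + 𝓕.P t

lemma rpow_norm_f_nonneg (t : ℝ) : 0 ≤ ‖𝓕.f t‖ ^ g.lam := Real.rpow_nonneg (norm_nonneg _) _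

lemma F_nonneg (t : ℝ) : 0 ≤ 𝓕.F t := add_nonneg (𝓕.rpow_norm_f_nonneg t) (𝓕.P_nonneg t)

lemma continuousOn_u_add_p : ContinuousOn (fun t => 𝓕.u t + 𝓕.p t) (Ici 0) :=
  𝓕.continuousOn_u.add 𝓕.continuousOn_p

lemma continuousOn_F : ContinuousOn 𝓕.F (Ici 0) :=
  (𝓕.continuousOn_f.norm.rpow_const fun _ _ => .inr (by linarith [g.two_le_lam])).add
    𝓕.continuousOn_P

lemma hasDerivAt_normSq_fluctuation {t : ℝ} (ht : 0 < t) :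
    HasDerivAt (fun t => ‖𝓕.fluctuation (𝓕.u t)‖ ^ 2)
      (2 * ⟪𝓕.fluctuation (𝓕.u t), 𝓕.u_t t⟫) t := by
  rw [← 𝓕.inner_fluctuation_fluctuation]
  exact (𝓕.fluctuation.hasFDerivAt.comp_hasDerivAt t (𝓕.hasDerivAt_u t ht)).norm_sq

lemma measure_add_integral_p_le (hB : 0 ≤ B) {t : ℝ} (ht : 0 < t) :
    μ.real univ + ∫ x, ‖𝓕.D x (𝓕.p t)‖ ^ 2 ∂μ ≤ (μ.real univ + B) * (1 + 𝓕.F t) := by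
  have hm : 0 ≤ μ.real univ * 𝓕.F t := mul_nonneg measureReal_nonneg (𝓕.F_nonneg t)
  have hP : B * 𝓕.P t ≤ B * 𝓕.F t :=
    mul_le_mul_of_nonneg_left (le_add_of_nonneg_left (𝓕.rpow_norm_f_nonneg t)) hB
  linarith [𝓕.integral_p_le t ht]

variable [IsFiniteMeasure μ]

lemma continuousOn_u_t : ContinuousOn 𝓕.u_t (Ioi 0) := by
  have hsub : ContinuousOn
      (fun t => 𝓕.f t - 𝓕.energyGradient g μ (𝓕.u t + 𝓕.p t)) (Ioi 0) :=
    (𝓕.continuousOn_f.sub ((𝓕.continuous_energyGradient g μ).comp_continuousOn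
      𝓕.continuousOn_u_add_p)).mono Ioi_subset_Ici_self
  exact hsub.congr fun t ht => eq_sub_of_add_eq (𝓕.equation t ht)

lemma hasDerivAt_energy {t : ℝ} (ht : 0 < t) :
    HasDerivAt (fun t => 𝓕.energy g μ (𝓕.u t + 𝓕.p t))
      ⟪𝓕.energyGradient g μ (𝓕.u t + 𝓕.p t), 𝓕.u_t t + 𝓕.p_t t⟫ t :=
  (𝓕.hasFDerivAt_energy g μ _).comp_hasDerivAt t
    ((𝓕.hasDerivAt_u t ht).add (𝓕.hasDerivAt_p t ht))

lemma fluctuation_rpow_le (hS : 0 ≤ S) (hB : 0 ≤ B) {t : ℝ} (ht : 0 < t) :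
    ‖𝓕.fluctuation (𝓕.u t)‖ ^ g.beta ≤
      4 * S * (𝓕.A t + (μ.real univ + B) * (1 + 𝓕.F t)) := by
  obtain ⟨n, hn, hle⟩ := 𝓕.poincare (𝓕.u t)
  calc ‖𝓕.fluctuation (𝓕.u t)‖ ^ g.beta ≤ ‖𝓕.u t - n‖ ^ g.beta :=
        Real.rpow_le_rpow (norm_nonneg _) (𝓕.norm_fluctuation_le_norm_sub _ hn) g.beta_pos.le
    _ ≤ S * 𝓕.dissipation g μ (𝓕.u t) := hle
    _ = S * 𝓕.dissipation g μ (𝓕.u t + 𝓕.p t - 𝓕.p t) := by rw [add_sub_cancel_right]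
    _ ≤ S * (4 * (𝓕.A t + (μ.real univ + ∫ x, ‖𝓕.D x (𝓕.p t)‖ ^ 2 ∂μ))) := by
      gcongr
      exact 𝓕.dissipation_sub_le g μ _ _
    _ ≤ S * (4 * (𝓕.A t + (μ.real univ + B) * (1 + 𝓕.F t))) := by
      gcongr
      exact 𝓕.measure_add_integral_p_le hB ht
    _ = _ := by ring

lemma inner_fluctuation_u_t {t : ℝ} (ht : 0 < t) :
    ⟪𝓕.fluctuation (𝓕.u t), 𝓕.u_t t⟫ = ⟪𝓕.fluctuation (𝓕.u t), 𝓕.f t⟫ -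
      ⟪𝓕.energyGradient g μ (𝓕.u t + 𝓕.p t), 𝓕.u t + 𝓕.p t - 𝓕.p t⟫ := by
  rw [← 𝓕.equation t ht, inner_add_right, real_inner_comm (𝓕.energyGradient g μ _),
    𝓕.inner_energyGradient, 𝓕.inner_energyGradient, add_sub_cancel_right]
  simp only [𝓕.D_fluctuation, add_sub_cancel_right]

/-- The upper constant of the energy profile of a Galerkin flow. -/
def upperConst (g : ForchheimerPoly) (c C S B m : ℝ) : ℝ :=
  2 * (c / (8 * S))⁻¹ ^ (g.lam - 1) + (1 + c + 2 * C + 4 * S) * (1 + m + B)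

lemma upperConst_pos (g : ForchheimerPoly) {m : ℝ} (hc : 0 < c) (hC : 0 < C) (hS : 0 < S)
    (hB : 0 ≤ B) (hm : 0 ≤ m) : 0 < upperConst g c C S B m := by
  unfold upperConst
  positivity

lemma two_mul_inner_fluctuation_u_t_le (hg : g.GrowthBounds E c C) (hS : 0 < S) (hB : 0 ≤ B)
    {t : ℝ} (ht : 0 < t) :
    2 * ⟪𝓕.fluctuation (𝓕.u t), 𝓕.u_t t⟫ ≤
      -c * 𝓕.A t + upperConst g c C S B (μ.real univ) * (1 + 𝓕.F t) := by
  have hc := hg.lower_pos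
  have hC := hg.upper_pos
  set ε := c / (8 * S)
  have hε : 0 < ε := by positivity
  have hεS : 8 * ε * S = c := by
    simp only [ε]
    field_simp
  have : 0 ≤ μ.real univ := measureReal_nonneg
  have hF := 𝓕.F_nonneg t
  have hf : ⟪𝓕.fluctuation (𝓕.u t), 𝓕.f t⟫ ≤
      ε * ‖𝓕.fluctuation (𝓕.u t)‖ ^ g.beta + ε⁻¹ ^ (g.lam - 1) * (1 + 𝓕.F t) := by
    refine (real_inner_le_norm _ _).trans ((g.mul_le_rpow_beta_add_rpow_lam hε (norm_nonneg _)
      (norm_nonneg _)).trans ?_)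
    gcongr
    rw [F]
    linarith [𝓕.P_nonneg t]
  have habsorb := mul_le_mul_of_nonneg_left (𝓕.fluctuation_rpow_le hS.le hB ht) hε.le
  have hcoercive := 𝓕.mul_dissipation_le_inner μ hg (𝓕.u t + 𝓕.p t) (𝓕.p t)
  have hdata := mul_le_mul_of_nonneg_left (𝓕.measure_add_integral_p_le hB ht) hC.le
  have hupper : 2 * ε⁻¹ ^ (g.lam - 1) + (c + 2 * C) * (μ.real univ + B) ≤
      upperConst g c C S B (μ.real univ) := by
    unfold upperConst
    gcongr 2 * ε⁻¹ ^ (g.lam - 1) + ?_ * ?_ <;> linarith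
  have hexpand : ε * (4 * S * (𝓕.A t + (μ.real univ + B) * (1 + 𝓕.F t))) =
      c / 2 * (𝓕.A t + (μ.real univ + B) * (1 + 𝓕.F t)) := by rw [← hεS]; ring
  rw [𝓕.inner_fluctuation_u_t ht]
  rw [← A] at hcoercive
  linarith [mul_le_mul_of_nonneg_right hupper (by linarith : 0 ≤ 1 + 𝓕.F t)]

lemma fluctuation_sq_rpow_le (hc : 0 < c) (hC : 0 < C) (hS : 0 < S) (hB : 0 ≤ B) {t : ℝ}
    (ht : 0 < t) : (‖𝓕.fluctuation (𝓕.u t)‖ ^ 2) ^ (g.beta / 2) ≤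
      upperConst g c C S B (μ.real univ) * (𝓕.A t + (1 + 𝓕.F t)) := by
  have hm : 0 ≤ μ.real univ := measureReal_nonneg
  have hA : 0 ≤ 𝓕.A t := 𝓕.dissipation_nonneg g μ _
  have hF := 𝓕.F_nonneg t
  have hupper : 4 * S * (1 + μ.real univ + B) ≤ upperConst g c C S B (μ.real univ) := by
    unfold upperConst
    have : 0 ≤ (c / (8 * S))⁻¹ ^ (g.lam - 1) := by positivity
    nlinarith
  calc (‖𝓕.fluctuation (𝓕.u t)‖ ^ 2) ^ (g.beta / 2) = ‖𝓕.fluctuation (𝓕.u t)‖ ^ g.beta := by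
        rw [← Real.rpow_natCast_mul (norm_nonneg _), Nat.cast_ofNat, mul_div_cancel₀ _ two_ne_zero]
    _ ≤ 4 * S * (𝓕.A t + (μ.real univ + B) * (1 + 𝓕.F t)) := 𝓕.fluctuation_rpow_le hS.le hB ht
    _ ≤ 4 * S * ((1 + μ.real univ + B) * (𝓕.A t + (1 + 𝓕.F t))) := by
      gcongr
      nlinarith
    _ = 4 * S * (1 + μ.real univ + B) * (𝓕.A t + (1 + 𝓕.F t)) := by ring
    _ ≤ _ := by gcongr

lemma inner_energyGradient_add_le (hg : g.GrowthBounds E c C) (hS : 0 < S) (hB : 0 ≤ B) {t : ℝ}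
    (ht : 0 < t) :
    ⟪𝓕.energyGradient g μ (𝓕.u t + 𝓕.p t), 𝓕.u_t t + 𝓕.p_t t⟫ ≤ -(1 / 2) * ‖𝓕.u_t t‖ ^ 2 +
      upperConst g c C S B (μ.real univ) * (𝓕.A t + (1 + (𝓕.F t + 𝓕.P_t t))) := by
  have hc := hg.lower_pos
  have hC := hg.upper_pos
  have hm : 0 ≤ μ.real univ := measureReal_nonneg
  have hA : 0 ≤ 𝓕.A t := 𝓕.dissipation_nonneg g μ _
  have hP := 𝓕.P_nonneg t
  have hP_t := 𝓕.P_t_nonneg t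
  have hf0 := 𝓕.rpow_norm_f_nonneg t
  have hgrad : 𝓕.energyGradient g μ (𝓕.u t + 𝓕.p t) = 𝓕.f t - 𝓕.u_t t :=
    eq_sub_of_add_eq' (𝓕.equation t ht)
  have htest : ⟪𝓕.energyGradient g μ (𝓕.u t + 𝓕.p t), 𝓕.u_t t⟫ ≤
      -(1 / 2) * ‖𝓕.u_t t‖ ^ 2 + 1 / 2 * ‖𝓕.f t‖ ^ 2 := by
    rw [hgrad, inner_sub_left, real_inner_self_eq_norm_sq]
    linarith [real_inner_le_norm (𝓕.f t) (𝓕.u_t t), sq_nonneg (‖𝓕.f t‖ - ‖𝓕.u_t t‖)]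
  have hf : ‖𝓕.f t‖ ^ 2 ≤ 1 + ‖𝓕.f t‖ ^ g.lam := by
    simpa using rpow_le_one_add_rpow (norm_nonneg (𝓕.f t)) zero_le_two g.two_le_lam
  have hdata := 𝓕.inner_energyGradient_le μ hg (𝓕.u t + 𝓕.p t) (𝓕.p_t t)
  have hp_t := mul_le_mul_of_nonneg_left (𝓕.integral_p_t_le t ht) hC.le
  have hupper : 1 + C * (1 + μ.real univ + B) ≤ upperConst g c C S B (μ.real univ) := by
    unfold upperConst
    have : 0 ≤ (c / (8 * S))⁻¹ ^ (g.lam - 1) := by positivity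
    nlinarith [mul_nonneg hc.le hm, mul_nonneg hc.le hB, mul_nonneg hC.le hm,
      mul_nonneg hC.le hB, mul_nonneg hS.le hm, mul_nonneg hS.le hB]
  rw [inner_add_right]
  calc _ ≤ -(1 / 2) * ‖𝓕.u_t t‖ ^ 2 +
        (1 + C * (1 + μ.real univ + B)) * (𝓕.A t + (1 + (𝓕.F t + 𝓕.P_t t))) := by
        rw [← A] at hdata
        rw [F]
        nlinarith [mul_nonneg hC.le hA, mul_nonneg hC.le hP, mul_nonneg hC.le hP_t,
          mul_nonneg hC.le hf0, mul_nonneg (mul_nonneg hC.le hm) hA,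
          mul_nonneg (mul_nonneg hC.le hm) hP, mul_nonneg (mul_nonneg hC.le hm) hP_t,
          mul_nonneg (mul_nonneg hC.le hm) hf0, mul_nonneg (mul_nonneg hC.le hB) hA,
          mul_nonneg (mul_nonneg hC.le hB) hP, mul_nonneg (mul_nonneg hC.le hB) hf0,
          mul_nonneg hC.le hB]
    _ ≤ _ := by
      have := 𝓕.F_nonneg t
      gcongr

lemma C_mul_le_upperConst (g : ForchheimerPoly) (hc : 0 < c) (hC : 0 < C) (hS : 0 < S) (hB : 0 ≤ B)
    {m : ℝ} (hm : 0 ≤ m) : C * (1 + m) ≤ upperConst g c C S B m := by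
  have hpow : 0 ≤ (c / (8 * S))⁻¹ ^ (g.lam - 1) := by positivity
  unfold upperConst
  nlinarith [mul_nonneg hc.le hm, mul_nonneg hc.le hB, mul_nonneg hC.le hm,
    mul_nonneg hC.le hB, mul_nonneg hS.le hm, mul_nonneg hS.le hB]

/-- The energy profile of a Galerkin flow, obtained by testing the equation with the fluctuation of
`u` and with `u_t`. -/
def energyProfile (hg : g.GrowthBounds E c C) (hS : 0 < S) (hB : 0 ≤ B) :
    EnergyProfile g.beta c (upperConst g c C S B (μ.real univ)) :=
  have hm : 0 ≤ μ.real univ := measureReal_nonneg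
  have hupper := C_mul_le_upperConst g hg.lower_pos hg.upper_pos hS hB hm
  { z t := ‖𝓕.fluctuation (𝓕.u t)‖ ^ 2
    z' t := 2 * ⟪𝓕.fluctuation (𝓕.u t), 𝓕.u_t t⟫
    A := 𝓕.A
    J t := 𝓕.energy g μ (𝓕.u t + 𝓕.p t)
    J' t := ⟪𝓕.energyGradient g μ (𝓕.u t + 𝓕.p t), 𝓕.u_t t + 𝓕.p_t t⟫
    R t := ‖𝓕.u_t t‖ ^ 2
    F := 𝓕.F
    F' := 𝓕.P_t
    z_nonneg t := sq_nonneg _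
    A_nonneg t := 𝓕.dissipation_nonneg g μ _
    R_nonneg t := sq_nonneg _
    F_nonneg := 𝓕.F_nonneg
    F'_nonneg := 𝓕.P_t_nonneg
    continuousOn_z := (𝓕.fluctuation.continuous.comp_continuousOn 𝓕.continuousOn_u).norm.pow 2
    continuousOn_A := (𝓕.continuous_dissipation g μ).comp_continuousOn 𝓕.continuousOn_u_add_p
    continuousOn_J := (𝓕.continuous_energy g μ).comp_continuousOn 𝓕.continuousOn_u_add_p
    continuousOn_R := 𝓕.continuousOn_u_t.norm.pow 2
    continuousOn_F := 𝓕.continuousOn_F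
    continuousOn_F' := 𝓕.continuousOn_P_t
    hasDerivAt_z _ ht := 𝓕.hasDerivAt_normSq_fluctuation ht
    hasDerivAt_J _ ht := 𝓕.hasDerivAt_energy ht
    z'_le _ ht := 𝓕.two_mul_inner_fluctuation_u_t_le hg hS hB ht
    z_rpow_le _ ht := 𝓕.fluctuation_sq_rpow_le hg.lower_pos hg.upper_pos hS hB ht
    J'_le _ ht := 𝓕.inner_energyGradient_add_le hg hS hB ht
    le_J _ := (𝓕.mul_dissipation_le_energy μ hg _).trans
      (add_le_add_right (hupper.trans' (mul_le_mul_of_nonneg_left (by linarith) hg.upper_pos.le)) _)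
    J_le _ := (𝓕.energy_le μ hg _).trans (mul_le_mul_of_nonneg_right
      (hupper.trans' (le_mul_of_one_le_right hg.upper_pos.le (by linarith)))
      (𝓕.dissipation_nonneg g μ _)) }

end GalerkinFlow

/-! ### Polynomials -/

lemma contDiff_eval_mvPolynomial {d : ℕ} (p : MvPolynomial (Fin d) ℝ) :
    ContDiff ℝ ∞ fun y : Euc d => MvPolynomial.eval (fun i => y i) p := by
  induction p using MvPolynomial.induction_on with
  | C a => simpa using contDiff_const
  | add p q hp hq => simpa using hp.add hq
  | mul_X p i hp =>
    simp only [map_mul, MvPolynomial.eval_X]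
    exact hp.mul (contDiff_piLp_apply 2)

lemma totalDegree_affine_le {σ : Type*} (s b : ℝ) (i : σ) :
    (MvPolynomial.C s * MvPolynomial.X i + MvPolynomial.C b : MvPolynomial σ ℝ).totalDegree
      ≤ 1 := by
  refine (MvPolynomial.totalDegree_add _ _).trans (max_le ?_ (by simp))
  exact (MvPolynomial.totalDegree_mul _ _).trans (by simp)

lemma exists_mvPolynomial_comp_affine {d r : ℕ} (p : MvPolynomial (Fin d) ℝ)
    (hp : p.totalDegree ≤ r) (s : ℝ) (b : Fin d → ℝ) :
    ∃ q : MvPolynomial (Fin d) ℝ, q.totalDegree ≤ r ∧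
      ∀ x : Fin d → ℝ, MvPolynomial.eval x q = MvPolynomial.eval (fun i => s * x i + b i) p := by
  refine ⟨∑ α ∈ p.support, MvPolynomial.C (p.coeff α) *
    ∏ i, (MvPolynomial.C s * MvPolynomial.X i + MvPolynomial.C (b i)) ^ α i, ?_, fun x => ?_⟩
  · refine MvPolynomial.totalDegree_finsetSum_le fun α hα => ?_
    refine (MvPolynomial.totalDegree_mul _ _).trans ?_
    rw [MvPolynomial.totalDegree_C, zero_add]
    refine (MvPolynomial.totalDegree_finsetProd _ _).trans ?_
    have factor_le (i) : ((MvPolynomial.C s * MvPolynomial.X i + MvPolynomial.C (b i) :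
        MvPolynomial (Fin d) ℝ) ^ α i).totalDegree ≤ α i :=
      (MvPolynomial.totalDegree_pow _ _).trans <| by
        simpa using Nat.mul_le_mul_left (α i) (totalDegree_affine_le s (b i) i)
    calc _ ≤ ∑ i, α i := Finset.sum_le_sum fun i _ => factor_le i
      _ = α.sum fun _ e => e := by rw [Finsupp.sum_fintype _ _ fun _ => rfl]
      _ ≤ p.totalDegree := MvPolynomial.le_totalDegree hα
      _ ≤ r := hp
  · rw [MvPolynomial.eval_eq' (fun i => s * x i + b i) p, map_sum]
    refine Finset.sum_congr rfl fun α _ => ?_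
    simp

/-- Polynomials of degree at most `r` in `d` variables, encoded by their coefficient vectors in a
fixed basis so that they form a normed space. -/
abbrev PolyCoef (d r : ℕ) : Type :=
  Fin (Module.finrank ℝ (MvPolynomial.restrictTotalDegree (Fin d) ℝ r)) → ℝ

namespace PolyCoef

variable {d r : ℕ}

/-- The polynomial functions that make up the fixed basis. -/
def basisFun (i : Fin (Module.finrank ℝ (MvPolynomial.restrictTotalDegree (Fin d) ℝ r)))
    (y : Euc d) : ℝ :=
  MvPolynomial.eval (fun k => y k)
    (Module.finBasis ℝ (MvPolynomial.restrictTotalDegree (Fin d) ℝ r) i : MvPolynomial (Fin d) ℝ)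

/-- The value of a polynomial at `y`, linear in the polynomial. -/
def ev (y : Euc d) : PolyCoef d r →L[ℝ] ℝ :=
  ∑ i, basisFun i y • ContinuousLinearMap.proj i

/-- The gradient of a polynomial at `y`, linear in the polynomial. -/
def grad (y : Euc d) : PolyCoef d r →L[ℝ] Euc d :=
  ∑ i, (ContinuousLinearMap.proj i : PolyCoef d r →L[ℝ] ℝ).smulRight (gradient (basisFun i) y)

lemma contDiff_basisFun (i) : ContDiff ℝ ∞ (basisFun (d := d) (r := r) i) :=
  contDiff_eval_mvPolynomial _

lemma continuous_ev : Continuous (ev : Euc d → PolyCoef d r →L[ℝ] ℝ) :=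
  continuous_finsetSum _ fun i _ => (contDiff_basisFun i).continuous.smul continuous_const

lemma continuous_grad : Continuous (grad : Euc d → PolyCoef d r →L[ℝ] Euc d) := by
  refine continuous_finsetSum _ fun i _ => ?_
  have continuous_gradient : Continuous (gradient (basisFun (d := d) (r := r) i)) :=
    (InnerProductSpace.toDual ℝ (Euc d)).symm.continuous.comp
      ((contDiff_basisFun i).continuous_fderiv (by simp))
  exact ((ContinuousLinearMap.smulRightL ℝ (PolyCoef d r) (Euc d)
    (ContinuousLinearMap.proj i)).continuous).comp continuous_gradient

lemma hasGradientAt_ev (q : PolyCoef d r) (y : Euc d) :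
    HasGradientAt (fun y => ev y q) (grad y q) y := by
  have hasGradientAt_basisFun (i) : HasGradientAt (basisFun i) (gradient (basisFun i) y) y :=
    ((contDiff_basisFun (r := r) i).differentiable (by simp) y).hasGradientAt
  have ev_eq_sum : (fun y => ev y q) = fun y => ∑ i, basisFun i y * q i := by
    ext z
    simp [ev]
  have toDual_grad : InnerProductSpace.toDual ℝ (Euc d) (grad y q) =
      ∑ i, q i • InnerProductSpace.toDual ℝ (Euc d) (gradient (basisFun i) y) := by
    simp [grad, map_sum]
  rw [hasGradientAt_iff_hasFDerivAt, ev_eq_sum, toDual_grad]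
  exact HasFDerivAt.fun_sum fun i _ => (hasGradientAt_basisFun i).hasFDerivAt.mul_const (q i)

lemma ev_eq (q : PolyCoef d r) (y : Euc d) : ev y q = MvPolynomial.eval (fun k => y k)
    (((Module.finBasis ℝ (MvPolynomial.restrictTotalDegree (Fin d) ℝ r)).equivFun.symm q :
      MvPolynomial.restrictTotalDegree (Fin d) ℝ r) : MvPolynomial (Fin d) ℝ) := by
  simp only [Module.Basis.equivFun_symm_apply, ev, sum_apply]
  simp [basisFun, MvPolynomial.smul_eval, mul_comm]

lemma exists_ev_eq_eval {p : MvPolynomial (Fin d) ℝ} (hp : p.totalDegree ≤ r) :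
    ∃ q : PolyCoef d r, ∀ y : Euc d, ev y q = MvPolynomial.eval (fun k => y k) p := by
  set b := Module.finBasis ℝ (MvPolynomial.restrictTotalDegree (Fin d) ℝ r)
  refine ⟨b.equivFun ⟨p, (MvPolynomial.mem_restrictTotalDegree _ _ p).2 hp⟩, fun y => ?_⟩
  rw [ev_eq, LinearEquiv.symm_apply_apply]

lemma exists_totalDegree_le (q : PolyCoef d r) : ∃ p : MvPolynomial (Fin d) ℝ,
    p.totalDegree ≤ r ∧ ∀ y : Euc d, ev y q = MvPolynomial.eval (fun k => y k) p :=
  ⟨_, (MvPolynomial.mem_restrictTotalDegree _ _ _).1 (Subtype.property _), ev_eq q⟩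

lemma exists_ev_eq_one : ∃ e : PolyCoef d r, ∀ y, ev y e = 1 := by
  obtain ⟨q, hq⟩ := exists_ev_eq_eval (d := d) (r := r) (p := 1) (by simp)
  exact ⟨q, fun y => by rw [hq, map_one]⟩

lemma grad_eq_zero {q : PolyCoef d r} {a : ℝ} (hq : ∀ y, ev y q = a) (y : Euc d) :
    grad y q = 0 := by
  have h := hasGradientAt_ev q y
  rw [show (fun y => ev y q) = fun _ => a from funext hq] at h
  exact h.unique (hasGradientAt_const y a)

lemma eq_zero_of_ev_eq_zero {q : PolyCoef d r} {U : Set (Euc d)} (hU : IsOpen U)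
    (hUn : U.Nonempty) (h : ∀ y ∈ U, ev y q = 0) : q = 0 := by
  obtain ⟨x, hx⟩ := hUn
  set b := Module.finBasis ℝ (MvPolynomial.restrictTotalDegree (Fin d) ℝ r)
  have hpre : (WithLp.toLp 2 : (Fin d → ℝ) → Euc d) ⁻¹' U ∈ nhds (WithLp.ofLp x) :=
    (PiLp.continuous_toLp 2 fun _ : Fin d => ℝ).continuousAt.preimage_mem_nhds (hU.mem_nhds hx)
  obtain ⟨ε, hε, hball⟩ := Metric.mem_nhds_iff.1 hpre
  have polynomial_eq_zero : ((b.equivFun.symm q : MvPolynomial.restrictTotalDegree (Fin d) ℝ r) :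
      MvPolynomial (Fin d) ℝ) = 0 := by
    refine MvPolynomial.funext_set (fun i => Ioo (x i - ε) (x i + ε))
      (fun i => Ioo_infinite (by linarith)) fun z hz => ?_
    have hz' : z ∈ Metric.ball (WithLp.ofLp x) ε := by
      rw [Metric.mem_ball, dist_pi_lt_iff hε]
      intro i
      have := hz i trivial
      rw [Real.dist_eq, abs_lt]
      constructor <;> linarith [this.1, this.2]
    have := h _ (hball hz')
    rw [ev_eq] at this
    simpa using this
  exact b.equivFun.symm.map_eq_zero_iff.1 (Subtype.ext polynomial_eq_zero)

end PolyCoef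

lemma exists_mul_norm_rpow_le_of_homogeneous {V : Type*} [NormedAddCommGroup V] [NormedSpace ℝ V]
    [FiniteDimensional ℝ V] {N : V → ℝ} {s : ℝ} (hs : 0 < s) (hN : Continuous N)
    (hhom : ∀ (c : ℝ) v, 0 ≤ c → N (c • v) = c ^ s * N v) (hpos : ∀ v, v ≠ 0 → 0 < N v) :
    ∃ c : ℝ, 0 < c ∧ ∀ v, c * ‖v‖ ^ s ≤ N v := by
  have : ProperSpace V := FiniteDimensional.proper ℝ V
  have hN0 : N 0 = 0 := by
    have := hhom 0 0 le_rfl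
    rwa [smul_zero, Real.zero_rpow hs.ne', zero_mul] at this
  have mem_sphere {v : V} (hv : v ≠ 0) : ‖v‖⁻¹ • v ∈ Metric.sphere (0 : V) 1 := by
    simp [norm_smul, inv_mul_cancel₀ (norm_ne_zero_iff.2 hv)]
  have scaled {v : V} (hv : v ≠ 0) : N v = ‖v‖ ^ s * N (‖v‖⁻¹ • v) := by
    rw [← hhom _ _ (norm_nonneg v), smul_smul, mul_inv_cancel₀ (norm_ne_zero_iff.2 hv), one_smul]
  suffices ∃ c : ℝ, 0 < c ∧ ∀ v ∈ Metric.sphere (0 : V) 1, c ≤ N v by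
    obtain ⟨c, hc, hle⟩ := this
    refine ⟨c, hc, fun v => ?_⟩
    obtain rfl | hv := eq_or_ne v 0
    · rw [hN0, norm_zero, Real.zero_rpow hs.ne', mul_zero]
    · rw [scaled hv, mul_comm]
      exact mul_le_mul_of_nonneg_left (hle _ (mem_sphere hv)) (by positivity)
  rcases (Metric.sphere (0 : V) 1).eq_empty_or_nonempty with hempty | hne
  · exact ⟨1, one_pos, by simp [hempty]⟩
  · obtain ⟨v₀, hv₀, hmin⟩ := (isCompact_sphere (0 : V) 1).exists_isMinOn hne hN.continuousOn
    exact ⟨N v₀, hpos _ (by rintro rfl; simp at hv₀), hmin⟩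

lemma eqOn_zero_of_setIntegral_eq_zero {d : ℕ} {F : Euc d → ℝ} (hF : Continuous F)
    (h0 : ∀ y, 0 ≤ F y) {σ : ℝ} (h : ∫ y in Metric.closedBall (0 : Euc d) σ, F y = 0) :
    ∀ y ∈ Metric.ball (0 : Euc d) σ, F y = 0 := by
  have ae_closedBall : F =ᵐ[volume.restrict (Metric.closedBall (0 : Euc d) σ)] 0 :=
    (setIntegral_eq_zero_iff_of_nonneg_ae (ae_of_all _ h0)
      (hF.continuousOn.integrableOn_compact (isCompact_closedBall _ _))).1 h
  exact Measure.eqOn_open_of_ae_eq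
    (ae_restrict_of_ae_restrict_of_subset Metric.ball_subset_closedBall ae_closedBall)
    Metric.isOpen_ball hF.continuousOn continuousOn_const

namespace PolyCoef

variable {d : ℕ}

lemma exists_norm_apply_le_of_continuous {F V : Type*} [NormedAddCommGroup F] [NormedSpace ℝ F]
    [NormedAddCommGroup V] [NormedSpace ℝ V] {L : Euc d → V →L[ℝ] F} (hL : Continuous L) :
    ∃ M : ℝ, 0 < M ∧ ∀ y ∈ Metric.closedBall (0 : Euc d) 1, ∀ v, ‖L y v‖ ≤ M * ‖v‖ := by
  obtain ⟨M, hM⟩ := (isCompact_closedBall (0 : Euc d) 1).exists_bound_of_continuousOn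
    hL.continuousOn
  refine ⟨max M 1, lt_max_of_lt_right one_pos, fun y hy v => ?_⟩
  exact ((L y).le_opNorm v).trans
    (mul_le_mul_of_nonneg_right ((hM y hy).trans (le_max_left _ _)) (norm_nonneg _))

lemma exists_mul_norm_rpow_le_integral {F V : Type*} [NormedAddCommGroup F] [NormedSpace ℝ F]
    [NormedAddCommGroup V] [NormedSpace ℝ V] [FiniteDimensional ℝ V] {L : Euc d → V →L[ℝ] F}
    (hL : Continuous L) {s σ : ℝ} (hs : 0 < s)
    (hinj : ∀ v, (∀ y ∈ Metric.ball (0 : Euc d) σ, L y v = 0) → v = 0) :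
    ∃ c : ℝ, 0 < c ∧ ∀ v, c * ‖v‖ ^ s ≤
      ∫ y in Metric.closedBall (0 : Euc d) σ, ‖L y v‖ ^ s := by
  have hcont : Continuous fun z : V × Euc d => ‖L z.2 z.1‖ ^ s :=
    (Real.continuous_rpow_const hs.le).comp
      ((hL.comp continuous_snd).clm_apply continuous_fst).norm
  refine exists_mul_norm_rpow_le_of_homogeneous hs ?_ (fun c v hc => ?_) fun v hv => ?_
  · exact continuous_parametric_integral_of_continuous hcont (isCompact_closedBall _ _)
  · rw [← integral_const_mul]
    refine integral_congr_ae (ae_of_all _ fun y => ?_)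
    simp only [map_smul, norm_smul, Real.norm_of_nonneg hc]
    exact Real.mul_rpow hc (norm_nonneg _)
  · refine lt_of_le_of_ne (integral_nonneg fun y => by positivity) fun h => hv ?_
    refine hinj v fun y hy => ?_
    have rpow_eq_zero : ‖L y v‖ ^ s = 0 := eqOn_zero_of_setIntegral_eq_zero
      (hcont.comp (Continuous.prodMk_right v)) (fun y => Real.rpow_nonneg (norm_nonneg _) s)
      h.symm y hy
    rwa [Real.rpow_eq_zero (norm_nonneg _) hs.ne', norm_eq_zero] at rpow_eq_zero

lemma exists_norm_grad_sq_le (d r : ℕ) {σ : ℝ} (hσ : 0 < σ) : ∃ C : ℝ, 0 < C ∧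
    ∀ (q : PolyCoef d r), ∀ y ∈ Metric.closedBall (0 : Euc d) 1,
      ‖grad y q‖ ^ 2 ≤ C * ∫ z in Metric.closedBall (0 : Euc d) σ, (ev z q) ^ 2 := by
  obtain ⟨M, hM, hMle⟩ := exists_norm_apply_le_of_continuous (d := d) (continuous_grad (r := r))
  obtain ⟨c, hc, hcle⟩ := exists_mul_norm_rpow_le_integral (d := d) (s := 2) (σ := σ)
    (continuous_ev (r := r)) two_pos fun v hv =>
      eq_zero_of_ev_eq_zero Metric.isOpen_ball ⟨0, by simpa using hσ⟩ hv
  refine ⟨M ^ 2 / c, by positivity, fun q y hy => ?_⟩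
  have norm_sq_le : c * ‖q‖ ^ 2 ≤ ∫ z in Metric.closedBall (0 : Euc d) σ, (ev z q) ^ 2 := by
    simpa only [Real.rpow_ofNat, Real.norm_eq_abs, sq_abs] using hcle q
  rw [div_mul_eq_mul_div, le_div_iff₀ hc]
  calc ‖grad y q‖ ^ 2 * c ≤ (M * ‖q‖) ^ 2 * c := by
        gcongr; exact hMle y hy q
    _ = M ^ 2 * (c * ‖q‖ ^ 2) := by ring
    _ ≤ _ := by gcongr

lemma eq_zero_of_grad_eq_zero {r : ℕ} {q : PolyCoef d r} {σ : ℝ} (hσ : 0 < σ)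
    (h0 : ev (0 : Euc d) q = 0) (hgrad : ∀ y ∈ Metric.ball (0 : Euc d) σ, grad y q = 0) :
    q = 0 := by
  have zero_mem : (0 : Euc d) ∈ Metric.ball 0 σ := Metric.mem_ball_self hσ
  refine eq_zero_of_ev_eq_zero Metric.isOpen_ball ⟨0, zero_mem⟩ fun y hy => ?_
  rw [← h0]
  refine Metric.isOpen_ball.is_const_of_fderiv_eq_zero (𝕜 := ℝ)
    (convex_ball (0 : Euc d) σ).isPreconnected (f := fun y => ev y q)
    (fun z _ => (hasGradientAt_ev _ z).differentiableAt.differentiableWithinAt)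
    (fun z hz => ?_) hy zero_mem
  rw [(hasGradientAt_ev _ z).hasFDerivAt.fderiv, hgrad z hz, map_zero]
  rfl

lemma exists_abs_sub_rpow_le (d r : ℕ) {σ b : ℝ} (hσ : 0 < σ) (hb : 0 < b) : ∃ C : ℝ, 0 < C ∧
    ∀ (q : PolyCoef d r), ∀ y ∈ Metric.closedBall (0 : Euc d) 1,
      |ev y q - ev 0 q| ^ b ≤ C * ∫ z in Metric.closedBall (0 : Euc d) σ, ‖grad z q‖ ^ b := by
  set V := LinearMap.ker ((ev (0 : Euc d) : PolyCoef d r →L[ℝ] ℝ) : PolyCoef d r →ₗ[ℝ] ℝ)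
  obtain ⟨M, hM, hMle⟩ := exists_norm_apply_le_of_continuous (d := d) (continuous_ev (r := r))
  have continuous_grad_V :
      Continuous fun y : Euc d => (grad y : PolyCoef d r →L[ℝ] Euc d).comp V.subtypeL :=
    continuous_grad.clm_comp continuous_const
  obtain ⟨c, hc, hcle⟩ := exists_mul_norm_rpow_le_integral (σ := σ) continuous_grad_V hb
    fun v hv => Subtype.ext (eq_zero_of_grad_eq_zero hσ v.2 hv)
  obtain ⟨e, he⟩ := exists_ev_eq_one (d := d) (r := r)
  refine ⟨M ^ b / c, by positivity, fun q y hy => ?_⟩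
  set v : PolyCoef d r := q - ev (0 : Euc d) q • e with hv
  have ev_v (z : Euc d) : ev z v = ev z q - ev 0 q := by
    rw [hv, map_sub, map_smul, he, smul_eq_mul, mul_one]
  have grad_v (z : Euc d) : grad z v = grad z q := by
    rw [hv, map_sub, map_smul, grad_eq_zero he, smul_zero, sub_zero]
  have v_mem : v ∈ V := by
    change ev 0 v = 0
    rw [ev_v, sub_self]
  have norm_v_le : c * ‖v‖ ^ b ≤ ∫ z in Metric.closedBall (0 : Euc d) σ, ‖grad z q‖ ^ b := by
    simpa only [ContinuousLinearMap.comp_apply, Submodule.subtypeL_apply, grad_v,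
      Submodule.coe_norm] using hcle ⟨v, v_mem⟩
  rw [div_mul_eq_mul_div, le_div_iff₀ hc]
  calc |ev y q - ev 0 q| ^ b * c ≤ (M * ‖v‖) ^ b * c := by
        gcongr
        simpa only [ev_v, Real.norm_eq_abs] using hMle y hy v
    _ = M ^ b * (c * ‖v‖ ^ b) := by rw [Real.mul_rpow hM.le (norm_nonneg _)]; ring
    _ ≤ _ := by gcongr

end PolyCoef

/-! ### The Poincaré inequality on star-shaped cells -/

section SmoothPoincare

lemma lintegral_sq_le {X : Type*} [MeasurableSpace X] {ν : Measure X} (hν : ν univ ≤ 1)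
    {f : X → ENNReal} (hf : AEMeasurable f ν) : (∫⁻ x, f x ∂ν) ^ 2 ≤ ∫⁻ x, f x ^ 2 ∂ν := by
  have hoelder := ENNReal.lintegral_mul_le_Lp_mul_Lq ν Real.HolderConjugate.two_two hf
    (aemeasurable_const (b := (1 : ENNReal)))
  simp only [Pi.mul_apply, mul_one, ENNReal.rpow_ofNat, one_pow, lintegral_const, one_mul]
    at hoelder
  have mass_le_one : (ν univ) ^ (1 / 2 : ℝ) ≤ 1 := ENNReal.rpow_le_one hν (by norm_num)
  calc (∫⁻ x, f x ∂ν) ^ 2 ≤ ((∫⁻ x, f x ^ 2 ∂ν) ^ (1 / 2 : ℝ)) ^ 2 := by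
        gcongr
        exact hoelder.trans (mul_le_of_le_one_right' mass_le_one)
    _ = ∫⁻ x, f x ^ 2 ∂ν := by
      rw [← ENNReal.rpow_natCast, ← ENNReal.rpow_mul]
      norm_num

variable {d : ℕ}

lemma lintegral_comp_smul_add {f : Euc d → ENNReal} (hf : Measurable f) {s : ℝ}
    (hs : 1 / 2 ≤ s) (v : Euc d) :
    ∫⁻ x, f (s • x + v) ≤ 2 ^ d * ∫⁻ x, f x := by
  have hs0 : 0 < s := by linarith
  have map_smul : Measure.map (fun x : Euc d => s • x) volume =
      ENNReal.ofReal |(s ^ d)⁻¹| • (volume : Measure (Euc d)) := by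
    simpa only [finrank_euclideanSpace_fin] using
      Measure.map_addHaar_smul (volume : Measure (Euc d)) hs0.ne'
  rw [← lintegral_map (f := fun z => f (z + v)) (hf.comp (measurable_add_const v))
    (measurable_const_smul s), map_smul, lintegral_smul_measure,
    lintegral_add_right_eq_self f v, smul_eq_mul]
  gcongr
  rw [abs_of_pos (by positivity), ← inv_pow]
  have inv_le_two : s⁻¹ ≤ 2 := by
    rw [inv_le_comm₀ hs0 two_pos]
    linarith
  calc ENNReal.ofReal (s⁻¹ ^ d) ≤ ENNReal.ofReal (2 ^ d) :=
        ENNReal.ofReal_le_ofReal (pow_le_pow_left₀ (by positivity) inv_le_two d)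
    _ = 2 ^ d := by
        rw [ENNReal.ofReal_pow (by norm_num)]
        norm_num

lemma enorm_sub_sq_le_lintegral {φ : Euc d → ℝ} (hφ : ContDiff ℝ 1 φ) {h : ℝ}
    {x y : Euc d} (hxy : ‖x - y‖ ≤ h) :
    ‖φ x - φ y‖ₑ ^ 2 ≤
      ENNReal.ofReal (h ^ 2) * ∫⁻ s in Icc (0 : ℝ) 1, ‖fderiv ℝ φ (y + s • (x - y))‖ₑ ^ 2 := by
  have hh : 0 ≤ h := (norm_nonneg _).trans hxy
  have continuous_deriv : Continuous fun s : ℝ => fderiv ℝ φ (y + s • (x - y)) :=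
    (hφ.continuous_fderiv one_ne_zero).comp (by fun_prop)
  have hasDerivAt_segment (s : ℝ) : HasDerivAt (fun s : ℝ => φ (y + s • (x - y)))
      (fderiv ℝ φ (y + s • (x - y)) (x - y)) s :=
    (hφ.differentiable one_ne_zero _).hasFDerivAt.comp_hasDerivAt s
      (by simpa using ((hasDerivAt_id s).smul_const (x - y)).const_add y)
  have ftc : ∫ s in Icc (0 : ℝ) 1, fderiv ℝ φ (y + s • (x - y)) (x - y) = φ x - φ y := by
    rw [integral_Icc_eq_integral_Ioc, ← intervalIntegral.integral_of_le zero_le_one,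
      intervalIntegral.integral_eq_sub_of_hasDerivAt (fun s _ => hasDerivAt_segment s)
        ((continuous_deriv.clm_apply continuous_const).intervalIntegrable _ _)]
    simp
  have increment_le : ‖φ x - φ y‖ₑ ≤
      ENNReal.ofReal h * ∫⁻ s in Icc (0 : ℝ) 1, ‖fderiv ℝ φ (y + s • (x - y))‖ₑ := by
    rw [← ftc, ← lintegral_const_mul _ continuous_deriv.enorm.measurable]
    refine (enorm_integral_le_lintegral_enorm _).trans (lintegral_mono fun s => ?_)
    rw [← ofReal_norm, ← ofReal_norm, ← ENNReal.ofReal_mul hh, mul_comm]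
    exact ENNReal.ofReal_le_ofReal ((ContinuousLinearMap.le_opNorm _ _).trans
      (mul_le_mul_of_nonneg_left hxy (norm_nonneg _)))
  calc ‖φ x - φ y‖ₑ ^ 2 ≤ (ENNReal.ofReal h *
        ∫⁻ s in Icc (0 : ℝ) 1, ‖fderiv ℝ φ (y + s • (x - y))‖ₑ) ^ 2 := by gcongr
    _ = ENNReal.ofReal (h ^ 2) *
        (∫⁻ s in Icc (0 : ℝ) 1, ‖fderiv ℝ φ (y + s • (x - y))‖ₑ) ^ 2 := by
      rw [mul_pow, ENNReal.ofReal_pow hh]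
    _ ≤ _ := by
      gcongr
      exact lintegral_sq_le (by simp) continuous_deriv.enorm.measurable.aemeasurable

-- One of the weights `s`, `1 - s` is at least `1 / 2`; the variable carrying it is integrated
-- over the whole space.
lemma lintegral_lintegral_comp_segment_le {ψ : Euc d → ENNReal} (hψ : Measurable ψ)
    (U B : Set (Euc d)) (s : ℝ) :
    ∫⁻ x in U, ∫⁻ y in B, ψ (y + s • (x - y)) ≤
      2 ^ d * (volume U + volume B) * ∫⁻ z, ψ z := by
  rcases le_total s (1 / 2) with hs | hs
  · have inner_le (x : Euc d) : ∫⁻ y in B, ψ (y + s • (x - y)) ≤ 2 ^ d * ∫⁻ z, ψ z := by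
      refine (setLIntegral_le_lintegral B _).trans ?_
      refine (lintegral_congr fun y => congrArg ψ ?_).trans_le
        (lintegral_comp_smul_add hψ (show 1 / 2 ≤ 1 - s by linarith) (s • x))
      module
    calc _ ≤ ∫⁻ x in U, 2 ^ d * ∫⁻ z, ψ z := lintegral_mono fun x => inner_le x
      _ = 2 ^ d * volume U * ∫⁻ z, ψ z := by rw [setLIntegral_const]; ring
      _ ≤ _ := by gcongr; exact le_self_add
  · have inner_le (y : Euc d) : ∫⁻ x in U, ψ (y + s • (x - y)) ≤ 2 ^ d * ∫⁻ z, ψ z := by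
      refine (setLIntegral_le_lintegral U _).trans ?_
      refine (lintegral_congr fun x => congrArg ψ ?_).trans_le
        (lintegral_comp_smul_add hψ hs ((1 - s) • y))
      module
    calc _ = ∫⁻ y in B, ∫⁻ x in U, ψ (y + s • (x - y)) := by
          refine lintegral_lintegral_swap (hψ.comp (Continuous.measurable ?_)).aemeasurable
          fun_prop
      _ ≤ ∫⁻ y in B, 2 ^ d * ∫⁻ z, ψ z := lintegral_mono fun y => inner_le y
      _ = 2 ^ d * volume B * ∫⁻ z, ψ z := by rw [setLIntegral_const]; ring
      _ ≤ _ := by gcongr; exact le_add_self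

lemma lintegral_lintegral_segment_swap {ψ : Euc d → ENNReal} (hψ : Measurable ψ)
    (U B : Set (Euc d)) :
    ∫⁻ x in U, ∫⁻ y in B, ∫⁻ s in Icc (0 : ℝ) 1, ψ (y + s • (x - y)) =
      ∫⁻ s in Icc (0 : ℝ) 1, ∫⁻ x in U, ∫⁻ y in B, ψ (y + s • (x - y)) := by
  calc _ = ∫⁻ x in U, ∫⁻ s in Icc (0 : ℝ) 1, ∫⁻ y in B, ψ (y + s • (x - y)) := by
        refine lintegral_congr fun x => lintegral_lintegral_swap
          (hψ.comp (Continuous.measurable ?_)).aemeasurable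
        fun_prop
    _ = _ := by
        have measurable_segment :
            Measurable fun z : (Euc d × ℝ) × Euc d => ψ (z.2 + z.1.2 • (z.1.1 - z.2)) :=
          hψ.comp (Continuous.measurable (by fun_prop))
        exact lintegral_lintegral_swap measurable_segment.lintegral_prod_right'.aemeasurable

lemma lintegral_lintegral_sub_sq_le_of_contDiff {φ : Euc d → ℝ} (hφ : ContDiff ℝ 1 φ)
    {U B : Set (Euc d)} (hU : MeasurableSet U) (hB : MeasurableSet B) {h : ℝ}
    (hstar : ∀ y ∈ B, StarConvex ℝ y U) (hdist : ∀ x ∈ U, ∀ y ∈ B, ‖x - y‖ ≤ h) :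
    ∫⁻ x in U, ∫⁻ y in B, ‖φ x - φ y‖ₑ ^ 2 ≤
      ENNReal.ofReal (h ^ 2) * (2 ^ d * (volume U + volume B) *
        ∫⁻ z in U, ‖fderiv ℝ φ z‖ₑ ^ 2) := by
  set ψ : Euc d → ENNReal := U.indicator fun z => ‖fderiv ℝ φ z‖ₑ ^ 2 with hψ
  have measurable_ψ : Measurable ψ :=
    (((hφ.continuous_fderiv one_ne_zero).enorm.measurable).pow_const 2).indicator hU
  have increment_le : ∀ x ∈ U, ∀ y ∈ B, ‖φ x - φ y‖ₑ ^ 2 ≤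
      ENNReal.ofReal (h ^ 2) * ∫⁻ s in Icc (0 : ℝ) 1, ψ (y + s • (x - y)) := by
    intro x hx y hy
    refine (enorm_sub_sq_le_lintegral hφ (hdist x hx y hy)).trans (mul_le_mul_right ?_ _)
    refine setLIntegral_mono' measurableSet_Icc fun s hs => ?_
    have segment_mem : y + s • (x - y) ∈ U := (hstar y hy).add_smul_sub_mem hx hs.1 hs.2
    simp [hψ, segment_mem]
  calc ∫⁻ x in U, ∫⁻ y in B, ‖φ x - φ y‖ₑ ^ 2
      ≤ ∫⁻ x in U, ∫⁻ y in B, ENNReal.ofReal (h ^ 2) *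
          ∫⁻ s in Icc (0 : ℝ) 1, ψ (y + s • (x - y)) :=
        setLIntegral_mono' hU fun x hx => setLIntegral_mono' hB fun y hy => increment_le x hx y hy
    _ = ENNReal.ofReal (h ^ 2) * ∫⁻ s in Icc (0 : ℝ) 1, ∫⁻ x in U, ∫⁻ y in B,
          ψ (y + s • (x - y)) := by
        simp_rw [lintegral_const_mul' _ _ ENNReal.ofReal_ne_top]
        rw [lintegral_lintegral_segment_swap measurable_ψ]
    _ ≤ ENNReal.ofReal (h ^ 2) * ∫⁻ _ in Icc (0 : ℝ) 1,
          2 ^ d * (volume U + volume B) * ∫⁻ z, ψ z := by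
        gcongr with s
        exact lintegral_lintegral_comp_segment_le measurable_ψ U B s
    _ = _ := by
        rw [setLIntegral_const, lintegral_indicator hU]
        simp

end SmoothPoincare

section Mollification

variable {d : ℕ} {Ω V : Set (Euc d)} {φ : L2 Ω} {G : L2Vec Ω}

lemma locallyIntegrable_indicator_L2 (hΩo : IsOpen Ω) (hΩb : Bornology.IsBounded Ω) (φ : L2 Ω) :
    LocallyIntegrable (Ω.indicator φ) volume := by
  have : IsFiniteMeasure (volume.restrict Ω) := ⟨by simpa using hΩb.measure_lt_top⟩
  have h : Integrable φ (volume.restrict Ω) := (Lp.memLp φ).integrable (by norm_num)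
  exact ((integrable_indicator_iff hΩo.measurableSet).2 h).locallyIntegrable

/-- The mollification of a function in `L²(Ω)`, extended by zero outside `Ω`. -/
def mollify (b : ContDiffBump (0 : Euc d)) (φ : L2 Ω) : Euc d → ℝ :=
  convolution (b.normed volume) (Ω.indicator φ) (ContinuousLinearMap.lsmul ℝ ℝ) volume

lemma contDiff_mollify (hΩo : IsOpen Ω) (hΩb : Bornology.IsBounded Ω)
    (b : ContDiffBump (0 : Euc d)) (φ : L2 Ω) : ContDiff ℝ 1 (mollify b φ) :=
  b.hasCompactSupport_normed.contDiff_convolution_left _ b.contDiff_normed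
    (locallyIntegrable_indicator_L2 hΩo hΩb φ)

lemma ae_tendsto_mollify (hΩo : IsOpen Ω) (hΩb : Bornology.IsBounded Ω) (φ : L2 Ω)
    {b : ℕ → ContDiffBump (0 : Euc d)}
    (hb : Filter.Tendsto (fun n => (b n).rOut) Filter.atTop (nhds 0))
    (hb2 : ∀ n, (b n).rOut ≤ 2 * (b n).rIn) :
    ∀ᵐ x, Filter.Tendsto (fun n => mollify (b n) φ x) Filter.atTop (nhds (Ω.indicator φ x)) :=
  ContDiffBump.ae_convolution_tendsto_right_of_locallyIntegrable hb
    (Filter.Eventually.of_forall hb2) (locallyIntegrable_indicator_L2 hΩo hΩb φ)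

lemma fderiv_convolution_lsmul_apply {E : Type*} [NormedAddCommGroup E] [NormedSpace ℝ E]
    [FiniteDimensional ℝ E] [MeasurableSpace E] [BorelSpace E] {μ : Measure E} [μ.IsAddHaarMeasure]
    {ρ f : E → ℝ} (hρ : ContDiff ℝ 1 ρ) (hρs : HasCompactSupport ρ) (hf : LocallyIntegrable f μ)
    (z v : E) :
    fderiv ℝ (convolution ρ f (ContinuousLinearMap.lsmul ℝ ℝ) μ) z v =
      ∫ x, fderiv ℝ ρ (z - x) v * f x ∂μ := by
  have hL := (hρs.fderiv ℝ).convolutionExists_left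
    (ContinuousLinearMap.precompL E (ContinuousLinearMap.lsmul ℝ ℝ : ℝ →L[ℝ] ℝ →L[ℝ] ℝ))
    (hρ.continuous_fderiv one_ne_zero) hf z
  rw [(hρs.hasFDerivAt_convolution_left (ContinuousLinearMap.lsmul ℝ ℝ) hρ hf z).fderiv,
    convolution_eq_swap, ContinuousLinearMap.integral_apply hL.integrable_swap]
  refine integral_congr_ae (ae_of_all _ fun x => ?_)
  simp only [ContinuousLinearMap.precompL_apply, ContinuousLinearMap.lsmul_apply, smul_eq_mul]

lemma fderiv_const_sub_apply {F : Euc d → ℝ} (hF : Differentiable ℝ F) (z x v : Euc d) :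
    fderiv ℝ (fun x => F (z - x)) x v = - fderiv ℝ F (z - x) v := by
  have hsub : HasFDerivAt (fun x : Euc d => z - x) (-ContinuousLinearMap.id ℝ (Euc d)) x := by
    simpa using (hasFDerivAt_id x).const_sub z
  have hcomp := (hF (z - x)).hasFDerivAt.comp x hsub
  rw [show (fun x => F (z - x)) = F ∘ fun x => z - x from rfl, hcomp.fderiv]
  simp

lemma mem_closedBall_of_normed_sub_ne_zero (b : ContDiffBump (0 : Euc d)) {z x : Euc d}
    (hx : b.normed volume (z - x) ≠ 0) : x ∈ Metric.closedBall z b.rOut := by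
  have hmem : z - x ∈ Function.support (b.normed volume) := hx
  rw [b.support_normed_eq, Metric.mem_ball, dist_zero_right] at hmem
  rw [Metric.mem_closedBall, dist_comm, dist_eq_norm]
  exact hmem.le

lemma fderiv_mollify_apply (hΩo : IsOpen Ω) (hΩb : Bornology.IsBounded Ω)
    (hw : IsWeakGradient Ω φ G) (b : ContDiffBump (0 : Euc d)) {z : Euc d}
    (hz : Metric.closedBall z b.rOut ⊆ Ω) (v : Euc d) :
    fderiv ℝ (mollify b φ) z v = ∫ x in Ω, b.normed volume (z - x) * ⟪G x, v⟫ := by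
  set ρ := b.normed (volume : Measure (Euc d))
  have contDiff_ρ : ContDiff ℝ ∞ ρ := b.contDiff_normed
  have tsupport_subset : tsupport (fun x => ρ (z - x)) ⊆ Metric.closedBall z b.rOut :=
    closure_minimal (fun x hx => mem_closedBall_of_normed_sub_ne_zero b hx)
      Metric.isClosed_closedBall
  have hweak := hw (fun x => ρ (z - x)) (contDiff_ρ.comp (contDiff_const.sub contDiff_id))
    ((isCompact_closedBall z b.rOut).of_isClosed_subset (isClosed_tsupport _) tsupport_subset)
    (tsupport_subset.trans hz) v
  simp_rw [fderiv_const_sub_apply (contDiff_ρ.differentiable (by simp)), mul_neg] at hweak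
  rw [integral_neg] at hweak
  have integrand_eq (x) : fderiv ℝ ρ (z - x) v * Ω.indicator φ x =
      Ω.indicator (fun x => φ x * fderiv ℝ ρ (z - x) v) x := by
    by_cases hx : x ∈ Ω <;> simp [hx, mul_comm]
  rw [mollify, fderiv_convolution_lsmul_apply (contDiff_ρ.of_le (by simp))
    b.hasCompactSupport_normed (locallyIntegrable_indicator_L2 hΩo hΩb φ)]
  simp_rw [integrand_eq]
  rw [integral_indicator hΩo.measurableSet]
  exact neg_injective hweak

lemma enorm_clm_le_of_forall {E F : Type*} [NormedAddCommGroup E] [NormedSpace ℝ E]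
    [NormedAddCommGroup F] [NormedSpace ℝ F] {L : E →L[ℝ] F} {M : ENNReal}
    (h : ∀ v, ‖L v‖ₑ ≤ M * ‖v‖ₑ) : ‖L‖ₑ ≤ M := by
  by_cases hM : M = ⊤
  · exact hM ▸ le_top
  rw [← ofReal_norm, ← ENNReal.ofReal_toReal hM]
  refine ENNReal.ofReal_le_ofReal (L.opNorm_le_bound ENNReal.toReal_nonneg fun v => ?_)
  simpa only [ENNReal.toReal_mul, toReal_enorm] using
    ENNReal.toReal_mono (ENNReal.mul_ne_top hM enorm_ne_top) (h v)

lemma enorm_fderiv_mollify_le (hΩo : IsOpen Ω) (hΩb : Bornology.IsBounded Ω)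
    (hw : IsWeakGradient Ω φ G) (hV : MeasurableSet V) (hVΩ : V ⊆ Ω)
    (b : ContDiffBump (0 : Euc d)) {z : Euc d} (hz : Metric.closedBall z b.rOut ⊆ V) :
    ‖fderiv ℝ (mollify b φ) z‖ₑ ≤ ∫⁻ x in V, ‖b.normed volume (z - x)‖ₑ * ‖G x‖ₑ := by
  refine enorm_clm_le_of_forall fun v => ?_
  rw [fderiv_mollify_apply hΩo hΩb hw b (hz.trans hVΩ),
    ← lintegral_mul_const' _ _ enorm_ne_top]
  have extend_to_Ω : ∫⁻ x in V, ‖b.normed volume (z - x)‖ₑ * ‖G x‖ₑ * ‖v‖ₑ =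
      ∫⁻ x in Ω, V.indicator (fun x => ‖b.normed volume (z - x)‖ₑ * ‖G x‖ₑ * ‖v‖ₑ) x := by
    rw [lintegral_indicator hV, Measure.restrict_restrict hV, inter_eq_left.2 hVΩ]
  rw [extend_to_Ω]
  refine (enorm_integral_le_lintegral_enorm _).trans (lintegral_mono fun x => ?_)
  by_cases hx : x ∈ V
  · rw [indicator_of_mem hx, enorm_mul, mul_assoc]
    gcongr
    rw [← ofReal_norm, ← ofReal_norm, ← ofReal_norm, ← ENNReal.ofReal_mul (norm_nonneg _)]
    exact ENNReal.ofReal_le_ofReal (norm_inner_le_norm _ _)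
  · have normed_eq_zero : b.normed volume (z - x) = 0 :=
      not_ne_iff.1 fun h => hx (hz (mem_closedBall_of_normed_sub_ne_zero b h))
    simp [hx, normed_eq_zero]

lemma lintegral_enorm_normed (b : ContDiffBump (0 : Euc d)) :
    ∫⁻ x, ‖b.normed volume x‖ₑ = 1 := by
  simp_rw [Real.enorm_of_nonneg (b.nonneg_normed _)]
  rw [← ofReal_integral_eq_lintegral_ofReal b.integrable_normed
    (ae_of_all _ b.nonneg_normed), b.integral_normed, ENNReal.ofReal_one]

lemma sq_lintegral_normed_mul_le (b : ContDiffBump (0 : Euc d)) (V : Set (Euc d)) (z : Euc d)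
    {f : Euc d → ENNReal} (hf : AEMeasurable f (volume.restrict V)) :
    (∫⁻ x in V, ‖b.normed volume (z - x)‖ₑ * f x) ^ 2 ≤
      ∫⁻ x in V, ‖b.normed volume (z - x)‖ₑ * f x ^ 2 := by
  have measurable_weight : Measurable fun x => ‖b.normed volume (z - x)‖ₑ :=
    b.continuous_normed.enorm.measurable.comp (measurable_const.sub measurable_id)
  set ν := (volume.restrict V).withDensity fun x => ‖b.normed volume (z - x)‖ₑ with hν
  have mass_le_one : ν univ ≤ 1 := by
    rw [hν, withDensity_apply _ MeasurableSet.univ, Measure.restrict_univ]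
    refine (setLIntegral_le_lintegral _ _).trans ?_
    rw [lintegral_sub_left_eq_self (fun x => ‖b.normed volume x‖ₑ) z, lintegral_enorm_normed]
  have hjensen : (∫⁻ x, f x ∂ν) ^ 2 ≤ ∫⁻ x, f x ^ 2 ∂ν :=
    lintegral_sq_le mass_le_one (hf.mono_ac (withDensity_absolutelyContinuous _ _))
  rwa [hν, lintegral_withDensity_eq_lintegral_mul₀ measurable_weight.aemeasurable hf,
    lintegral_withDensity_eq_lintegral_mul₀ measurable_weight.aemeasurable (hf.pow_const 2)]
    at hjensen

lemma lintegral_enorm_fderiv_mollify_sq_le {U : Set (Euc d)} (hΩo : IsOpen Ω)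
    (hΩb : Bornology.IsBounded Ω) (hw : IsWeakGradient Ω φ G) (hV : MeasurableSet V)
    (hVΩ : V ⊆ Ω) (b : ContDiffBump (0 : Euc d)) (hU : MeasurableSet U)
    (hUV : ∀ z ∈ U, Metric.closedBall z b.rOut ⊆ V) :
    ∫⁻ z in U, ‖fderiv ℝ (mollify b φ) z‖ₑ ^ 2 ≤ ∫⁻ x in V, ‖G x‖ₑ ^ 2 := by
  set ρ := b.normed (volume : Measure (Euc d))
  have measurable_ρ : Measurable fun x => ‖ρ x‖ₑ := b.continuous_normed.enorm.measurable
  have aemeasurable_G : AEMeasurable (fun x => ‖G x‖ₑ) (volume.restrict V) :=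
    ((Lp.aestronglyMeasurable G).mono_measure (Measure.restrict_mono_set _ hVΩ)).enorm
  calc _ ≤ ∫⁻ z in U, ∫⁻ x in V, ‖ρ (z - x)‖ₑ * ‖G x‖ₑ ^ 2 :=
        setLIntegral_mono' hU fun z hz =>
          (pow_le_pow_left' (enorm_fderiv_mollify_le hΩo hΩb hw hV hVΩ b (hUV z hz)) 2).trans
            (sq_lintegral_normed_mul_le b V z aemeasurable_G)
    _ ≤ ∫⁻ z, ∫⁻ x in V, ‖ρ (z - x)‖ₑ * ‖G x‖ₑ ^ 2 := setLIntegral_le_lintegral _ _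
    _ = ∫⁻ x in V, ∫⁻ z, ‖ρ (z - x)‖ₑ * ‖G x‖ₑ ^ 2 :=
        lintegral_lintegral_swap
          ((measurable_ρ.comp (measurable_fst.sub measurable_snd)).aemeasurable.mul
            (aemeasurable_G.pow_const 2).comp_snd)
    _ = ∫⁻ x in V, ‖G x‖ₑ ^ 2 := by
        refine lintegral_congr fun x => ?_
        have measurable_shift : Measurable fun z => ‖ρ (z - x)‖ₑ :=
          measurable_ρ.comp (measurable_id.sub measurable_const)
        rw [lintegral_mul_const _ measurable_shift,
          lintegral_sub_right_eq_self (μ := volume) (fun z : Euc d => ‖ρ z‖ₑ) x,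
          lintegral_enorm_normed, one_mul]

end Mollification

section WeakPoincare

variable {d : ℕ} {Ω T : Set (Euc d)} {φ : L2 Ω} {G : L2Vec Ω} {c : Euc d} {ρ h δ : ℝ}

/-- `T` is closed, star-shaped with respect to the closed ball of radius `ρ` around `c`, and has
diameter at most `h`. -/
structure IsStarShapedCell (T : Set (Euc d)) (c : Euc d) (ρ h : ℝ) : Prop where
  isClosed : IsClosed T
  closedBall_subset : Metric.closedBall c ρ ⊆ T
  starConvex : ∀ y ∈ Metric.closedBall c ρ, StarConvex ℝ y T
  norm_sub_le : ∀ x ∈ T, ∀ y ∈ T, ‖x - y‖ ≤ h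

/-- The inner parallel set of `T`: the points whose closed `δ`-neighbourhood lies in `T`. -/
def innerCore (T : Set (Euc d)) (δ : ℝ) : Set (Euc d) :=
  {x | Metric.closedBall x δ ⊆ T}

lemma isClosed_innerCore (hT : IsClosed T) (δ : ℝ) : IsClosed (innerCore T δ) := by
  have eq_iInter :
      innerCore T δ = ⋂ e ∈ Metric.closedBall (0 : Euc d) δ, (fun x => x + e) ⁻¹' T := by
    ext x
    simp only [innerCore, mem_ofPred_eq, mem_iInter, mem_preimage]
    refine ⟨fun hx e he => hx (by simpa using he), fun hx y hy => ?_⟩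
    simpa using hx (y - x) (by simpa [dist_eq_norm] using hy)
  rw [eq_iInter]
  exact isClosed_biInter fun e _ => hT.preimage (by fun_prop)

lemma innerCore_subset (hδ : 0 ≤ δ) : innerCore T δ ⊆ T := fun _ hx =>
  hx (Metric.mem_closedBall_self hδ)

lemma innerCore_anti {δ' : ℝ} (h : δ ≤ δ') : innerCore T δ' ⊆ innerCore T δ := fun _ hx =>
  (Metric.closedBall_subset_closedBall h).trans hx

lemma interior_subset_iUnion_innerCore (T : Set (Euc d)) {δ : ℕ → ℝ}
    (hδ : Filter.Tendsto δ Filter.atTop (nhds 0)) : interior T ⊆ ⋃ n, innerCore T (δ n) := by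
  intro x hx
  obtain ⟨ε, hε, hεT⟩ := Metric.isOpen_iff.1 isOpen_interior x hx
  obtain ⟨n, hn⟩ := (hδ.eventually_lt_const hε).exists
  exact mem_iUnion.2 ⟨n, ((Metric.closedBall_subset_ball hn).trans hεT).trans interior_subset⟩

lemma starConvex_innerCore (hδ : δ ≤ ρ / 2)
    (hstar : ∀ y ∈ Metric.closedBall c ρ, StarConvex ℝ y T) {y : Euc d}
    (hy : y ∈ Metric.closedBall c (ρ / 2)) : StarConvex ℝ y (innerCore T δ) := by
  intro x hx a b ha hb hab z hz
  set e := z - (a • y + b • x) with he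
  rw [Metric.mem_closedBall, dist_eq_norm, ← he] at hz
  have y_add_mem : y + e ∈ Metric.closedBall c ρ := by
    rw [Metric.mem_closedBall, dist_eq_norm] at hy ⊢
    calc ‖y + e - c‖ = ‖(y - c) + e‖ := by congr 1; abel
      _ ≤ ρ / 2 + δ := norm_add_le_of_le hy hz
      _ ≤ ρ := by linarith
  have x_add_mem : x + e ∈ T := hx (by simpa [dist_eq_norm] using hz)
  have combination_eq : a • (y + e) + b • (x + e) = z := by
    rw [smul_add, smul_add, add_add_add_comm, ← add_smul, hab, one_smul, he, add_sub_cancel]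
  exact combination_eq ▸ hstar _ y_add_mem x_add_mem ha hb hab

lemma lintegral_lintegral_sub_sq_le_of_tendsto {F : ℕ → Euc d → ℝ} {f : Euc d → ℝ}
    (hF : ∀ n, Continuous (F n))
    (hlim : ∀ᵐ x, Filter.Tendsto (fun n => F n x) Filter.atTop (nhds (f x)))
    {U B : Set (Euc d)} {M : ENNReal}
    (hM : ∀ n, ∫⁻ x in U, ∫⁻ y in B, ‖F n x - F n y‖ₑ ^ 2 ≤ M) :
    ∫⁻ x in U, ∫⁻ y in B, ‖f x - f y‖ₑ ^ 2 ≤ M := by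
  have hmeas (n) : Measurable fun q : Euc d × Euc d => ‖F n q.1 - F n q.2‖ₑ ^ 2 :=
    (((hF n).comp continuous_fst).sub
      ((hF n).comp continuous_snd)).enorm.measurable.pow_const 2
  have inner_le : ∀ᵐ x, ∫⁻ y in B, ‖f x - f y‖ₑ ^ 2 ≤
      Filter.liminf (fun n => ∫⁻ y in B, ‖F n x - F n y‖ₑ ^ 2) Filter.atTop := by
    filter_upwards [hlim] with x hx
    refine (lintegral_mono_ae ?_).trans (lintegral_liminf_le fun n =>
      (hmeas n).comp measurable_prodMk_left)
    filter_upwards [ae_restrict_of_ae hlim] with y hy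
    have sq_tendsto : Filter.Tendsto (fun n => ‖F n x - F n y‖ₑ ^ 2) Filter.atTop
        (nhds (‖f x - f y‖ₑ ^ 2)) := ENNReal.Tendsto.pow (hx.sub hy).enorm
    exact sq_tendsto.liminf_eq.ge
  calc _ ≤ ∫⁻ x in U, Filter.liminf (fun n => ∫⁻ y in B, ‖F n x - F n y‖ₑ ^ 2) Filter.atTop :=
        lintegral_mono_ae (ae_restrict_of_ae inner_le)
    _ ≤ Filter.liminf (fun n => ∫⁻ x in U, ∫⁻ y in B, ‖F n x - F n y‖ₑ ^ 2) Filter.atTop :=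
        lintegral_liminf_le fun n => (hmeas n).lintegral_prod_right'
    _ ≤ M := Filter.liminf_le_of_frequently_le' (Filter.Frequently.of_forall hM)

lemma tendsto_div_natCast_add_two (δ : ℝ) :
    Filter.Tendsto (fun n : ℕ => δ / (n + 2)) Filter.atTop (nhds 0) :=
  tendsto_const_nhds.div_atTop
    (Filter.tendsto_atTop_add_const_right _ (2 : ℝ) tendsto_natCast_atTop_atTop)

/-- The bump functions of radius `δ / (n + 2)`, a mollifying sequence. -/
def bumpSeq (hδ : 0 < δ) (n : ℕ) : ContDiffBump (0 : Euc d) where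
  rIn := δ / (n + 2) / 2
  rOut := δ / (n + 2)
  rIn_pos := by positivity
  rIn_lt_rOut := half_lt_self (by positivity)

lemma IsStarShapedCell.lintegral_innerCore_sub_sq_le (hcell : IsStarShapedCell T c ρ h)
    (hΩo : IsOpen Ω) (hΩb : Bornology.IsBounded Ω) (hw : IsWeakGradient Ω φ G)
    (hTΩ : interior T ⊆ Ω) (hδ : 0 < δ) (hδρ : δ ≤ ρ / 2) :
    ∫⁻ x in innerCore T δ, ∫⁻ y in Metric.closedBall c (ρ / 2),
      ‖Ω.indicator φ x - Ω.indicator φ y‖ₑ ^ 2 ≤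
    ENNReal.ofReal (h ^ 2) * (2 ^ d * (volume T + volume (Metric.closedBall c (ρ / 2))) *
        ∫⁻ z in interior T, ‖G z‖ₑ ^ 2) := by
  have measurableSet_core : MeasurableSet (innerCore T δ) :=
    (isClosed_innerCore hcell.isClosed δ).measurableSet
  have core_subset : innerCore T δ ⊆ T := innerCore_subset hδ.le
  have closedBall_subset_interior (n : ℕ) : ∀ z ∈ innerCore T δ,
      Metric.closedBall z (bumpSeq (d := d) hδ n).rOut ⊆ interior T := fun z hz => by
    have rOut_lt : (bumpSeq (d := d) hδ n).rOut < δ :=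
      div_lt_self hδ (by linarith [(Nat.cast_nonneg n : (0 : ℝ) ≤ n)])
    exact (Metric.closedBall_subset_ball rOut_lt).trans
      (Metric.ball_subset_interior_closedBall.trans (interior_mono hz))
  refine lintegral_lintegral_sub_sq_le_of_tendsto
    (fun n => (contDiff_mollify hΩo hΩb (bumpSeq hδ n) φ).continuous)
    (ae_tendsto_mollify hΩo hΩb φ (tendsto_div_natCast_add_two δ) fun n =>
      (mul_div_cancel₀ _ two_ne_zero).ge) fun n => ?_
  refine (lintegral_lintegral_sub_sq_le_of_contDiff (contDiff_mollify hΩo hΩb _ φ)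
    measurableSet_core measurableSet_closedBall
    (fun y hy => starConvex_innerCore hδρ hcell.starConvex hy) fun x hx y hy =>
      hcell.norm_sub_le x (core_subset hx) y (hcell.closedBall_subset
        (Metric.closedBall_subset_closedBall (by linarith) hy))).trans ?_
  refine mul_le_mul' le_rfl (mul_le_mul' ?_ ?_)
  · gcongr
  · exact lintegral_enorm_fderiv_mollify_sq_le hΩo hΩb hw isOpen_interior.measurableSet hTΩ _
      measurableSet_core (closedBall_subset_interior n)

lemma IsStarShapedCell.lintegral_interior_sub_sq_le (hcell : IsStarShapedCell T c ρ h)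
    (hΩo : IsOpen Ω) (hΩb : Bornology.IsBounded Ω) (hw : IsWeakGradient Ω φ G)
    (hTΩ : interior T ⊆ Ω) (hρ : 0 < ρ) :
    ∫⁻ x in interior T, ∫⁻ y in Metric.closedBall c (ρ / 2),
      ‖Ω.indicator φ x - Ω.indicator φ y‖ₑ ^ 2 ≤
    ENNReal.ofReal (h ^ 2) * (2 ^ d * (volume T + volume (Metric.closedBall c (ρ / 2))) *
        ∫⁻ z in interior T, ‖G z‖ₑ ^ 2) := by
  have antitone_radius : Antitone fun n : ℕ => ρ / (n + 2 : ℝ) := fun m n hmn =>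
    div_le_div_of_nonneg_left hρ.le (by positivity) (by gcongr)
  have radius_le (n : ℕ) : ρ / (n + 2 : ℝ) ≤ ρ / 2 :=
    div_le_div_of_nonneg_left hρ.le two_pos (by linarith [(Nat.cast_nonneg n : (0 : ℝ) ≤ n)])
  refine (lintegral_mono_set (interior_subset_iUnion_innerCore T
    (tendsto_div_natCast_add_two ρ))).trans ?_
  rw [setLIntegral_iUnion_of_directed _
    (directed_of_isDirected_le fun m n hmn => innerCore_anti (antitone_radius hmn))]
  exact iSup_le fun n =>
    hcell.lintegral_innerCore_sub_sq_le hΩo hΩb hw hTΩ (by positivity) (radius_le n)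

lemma exists_const_lintegral_sub_sq_mul_le {f : Euc d → ℝ} (hf : AEMeasurable f)
    (U : Set (Euc d)) {B : Set (Euc d)} (hB0 : volume B ≠ 0) (hB : volume B ≠ ⊤) :
    ∃ k : ℝ, (∫⁻ x in U, ‖f x - k‖ₑ ^ 2) * volume B ≤
      ∫⁻ x in U, ∫⁻ y in B, ‖f x - f y‖ₑ ^ 2 := by
  have hmeas : AEMeasurable (Function.uncurry fun x y => ‖f x - f y‖ₑ ^ 2)
      ((volume.restrict U).prod (volume.restrict B)) :=
    (hf.restrict.comp_fst.sub hf.restrict.comp_snd).enorm.pow_const 2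
  obtain ⟨y, -, hy⟩ := exists_le_setLAverage hB0 hB hmeas.prod_swap.lintegral_prod_right'
  refine ⟨f y, ?_⟩
  rw [lintegral_lintegral_swap hmeas]
  rwa [setLAverage_eq, ENNReal.le_div_iff_mul_le (Or.inl hB0) (Or.inl hB)] at hy

lemma IsStarShapedCell.volume_le (hcell : IsStarShapedCell T c ρ h) (hρ : 0 < ρ) {κ : ℝ}
    (hκ : 0 ≤ κ) (hh : h ≤ κ * (ρ / 2)) :
    volume T ≤ ENNReal.ofReal (κ ^ d) * volume (Metric.closedBall c (ρ / 2)) := by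
  have subset_closedBall : T ⊆ Metric.closedBall c (κ * (ρ / 2)) := fun x hx => by
    rw [Metric.mem_closedBall, dist_eq_norm]
    exact (hcell.norm_sub_le x hx c
      (hcell.closedBall_subset (Metric.mem_closedBall_self hρ.le))).trans hh
  refine (measure_mono subset_closedBall).trans (le_of_eq ?_)
  rw [Measure.addHaar_closedBall_mul _ _ hκ (by positivity), finrank_euclideanSpace_fin,
    Measure.addHaar_closedBall_center _ c]

theorem IsStarShapedCell.exists_const_lintegral_sub_sq_le (hcell : IsStarShapedCell T c ρ h)
    (hΩo : IsOpen Ω) (hΩb : Bornology.IsBounded Ω) (hw : IsWeakGradient Ω φ G)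
    (hTΩ : interior T ⊆ Ω) (hρ : 0 < ρ) {κ : ℝ} (hκ : 0 ≤ κ) (hh : h ≤ κ * (ρ / 2)) :
    ∃ k : ℝ, ∫⁻ x in interior T, ‖φ x - k‖ₑ ^ 2 ≤
      ENNReal.ofReal (h ^ 2 * (2 ^ d * (κ ^ d + 1))) * ∫⁻ x in interior T, ‖G x‖ₑ ^ 2 := by
  set B := Metric.closedBall c (ρ / 2)
  have volume_B_ne_zero : volume B ≠ 0 :=
    (Metric.measure_closedBall_pos _ _ (by positivity)).ne'
  have volume_B_ne_top : volume B ≠ ⊤ := measure_closedBall_lt_top.ne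
  obtain ⟨k, hk⟩ := exists_const_lintegral_sub_sq_mul_le (f := Ω.indicator φ)
    (locallyIntegrable_indicator_L2 hΩo hΩb φ).aestronglyMeasurable.aemeasurable
    (interior T) volume_B_ne_zero volume_B_ne_top
  have lintegral_eq : ∫⁻ x in interior T, ‖φ x - k‖ₑ ^ 2 =
      ∫⁻ x in interior T, ‖Ω.indicator φ x - k‖ₑ ^ 2 :=
    setLIntegral_congr_fun isOpen_interior.measurableSet fun x hx => by
      simp only [indicator_of_mem (hTΩ hx)]
  refine ⟨k, ?_⟩
  rw [lintegral_eq, ← ENNReal.mul_le_mul_iff_left volume_B_ne_zero volume_B_ne_top]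
  calc _ ≤ ENNReal.ofReal (h ^ 2) * (2 ^ d * (volume T + volume B) *
          ∫⁻ z in interior T, ‖G z‖ₑ ^ 2) :=
        hk.trans (hcell.lintegral_interior_sub_sq_le hΩo hΩb hw hTΩ hρ)
    _ ≤ ENNReal.ofReal (h ^ 2) * (2 ^ d * (ENNReal.ofReal (κ ^ d) * volume B + volume B) *
          ∫⁻ z in interior T, ‖G z‖ₑ ^ 2) := by
        gcongr
        exact hcell.volume_le hρ hκ hh
    _ = _ := by
        have ofReal_two_pow : ENNReal.ofReal (2 ^ d) = 2 ^ d := by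
          rw [ENNReal.ofReal_pow zero_le_two, ENNReal.ofReal_ofNat]
        rw [ENNReal.ofReal_mul (by positivity), ENNReal.ofReal_mul (by positivity),
          ENNReal.ofReal_add (by positivity) zero_le_one, ENNReal.ofReal_one, ofReal_two_pow]
        ring

end WeakPoincare

/-! ### Shape-regular triangulations -/

namespace IsStarShapedCell

variable {d : ℕ} {T : Set (Euc d)} {c : Euc d} {ρ h : ℝ}

lemma homothety_mem_interior (hcell : IsStarShapedCell T c ρ h) (hρ : 0 < ρ) {s : ℝ}
    (hs : s ∈ Ioo 0 1) {y : Euc d} (hy : y ∈ T) : AffineMap.homothety c s y ∈ interior T := by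
  have hs' : 0 < 1 - s := sub_pos.2 hs.2
  rw [mem_interior_iff_mem_nhds]
  refine Filter.mem_of_superset (Metric.ball_mem_nhds _ (mul_pos hs' hρ)) fun w hw => ?_
  rw [mem_ball_iff_norm, AffineMap.homothety_apply] at hw
  set e := w - (s • (y -ᵥ c) +ᵥ c)
  have mem_closedBall : c + (1 - s)⁻¹ • e ∈ Metric.closedBall c ρ := by
    rw [mem_closedBall_iff_norm, add_sub_cancel_left, norm_smul, norm_inv,
      Real.norm_of_nonneg hs'.le, inv_mul_le_iff₀ hs']
    exact hw.le
  have w_eq : (1 - s) • (c + (1 - s)⁻¹ • e) + s • y = w := by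
    rw [smul_add, smul_inv_smul₀ hs'.ne']
    simp only [e, vsub_eq_sub, vadd_eq_add]
    module
  exact w_eq ▸ hcell.starConvex _ mem_closedBall hy hs'.le hs.1.le (by ring)

lemma subset_closedBall (hcell : IsStarShapedCell T c ρ h) (hρ : 0 ≤ ρ) :
    T ⊆ Metric.closedBall c h := fun x hx =>
  mem_closedBall_iff_norm.2 (hcell.norm_sub_le x hx c
    (hcell.closedBall_subset (Metric.mem_closedBall_self hρ)))

lemma volume_ne_top (hcell : IsStarShapedCell T c ρ h) (hρ : 0 ≤ ρ) : volume T ≠ ⊤ :=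
  ((measure_mono (hcell.subset_closedBall hρ)).trans_lt measure_closedBall_lt_top).ne

lemma volume_le_volume_interior (hcell : IsStarShapedCell T c ρ h) (hρ : 0 < ρ) :
    volume T ≤ volume (interior T) := by
  have volume_shrink_le : ∀ s ∈ Ioo (0 : ℝ) 1,
      ENNReal.ofReal (s ^ d) * volume T ≤ volume (interior T) := fun s hs => by
    have volume_image := Measure.addHaar_image_homothety (volume : Measure (Euc d)) c s T
    rw [finrank_euclideanSpace_fin, abs_of_nonneg (pow_nonneg hs.1.le d)] at volume_image
    rw [← volume_image]
    exact measure_mono (image_subset_iff.2 fun y hy => hcell.homothety_mem_interior hρ hs hy)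
  have tendsto_volume_shrink : Filter.Tendsto (fun s : ℝ => ENNReal.ofReal (s ^ d) * volume T)
      (nhdsWithin 1 (Iio 1)) (nhds (volume T)) := by
    have tendsto_pow : Filter.Tendsto (fun s : ℝ => s ^ d) (nhds 1) (nhds 1) := by
      simpa using (continuous_pow (M := ℝ) d).tendsto 1
    simpa using (ENNReal.Tendsto.mul_const (ENNReal.tendsto_ofReal tendsto_pow)
      (.inr (hcell.volume_ne_top hρ.le))).mono_left nhdsWithin_le_nhds
  exact le_of_tendsto tendsto_volume_shrink
    (Filter.mem_of_superset (Ioo_mem_nhdsLT one_pos) volume_shrink_le)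

lemma interior_ae_eq (hcell : IsStarShapedCell T c ρ h) (hρ : 0 < ρ) :
    interior T =ᵐ[volume] T :=
  ae_eq_of_subset_of_measure_ge interior_subset (hcell.volume_le_volume_interior hρ)
    isOpen_interior.nullMeasurableSet (hcell.volume_ne_top hρ.le)

end IsStarShapedCell

namespace Triangulation

variable {d : ℕ} {Ω : Set (Euc d)}

/-- The cells are star-shaped with respect to balls of radius `σ h` about the centres `c`, and have
diameter at most `h`. Unlike the mesh size, `h` is positive even if there are no cells. -/
structure IsShapeRegular (𝒯 : Triangulation Ω) (σ h : ℝ) (c : 𝒯.cells → Euc d) : Prop where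
  sigma_pos : 0 < σ
  pos : 0 < h
  isStarShapedCell : ∀ T : 𝒯.cells, IsStarShapedCell (T : Set (Euc d)) (c T) (σ * h) h

lemma norm_sub_le_meshSize (𝒯 : Triangulation Ω) {T : Set (Euc d)} (hT : T ∈ 𝒯.cells) {x y : Euc d}
    (hx : x ∈ T) (hy : y ∈ T) : ‖x - y‖ ≤ 𝒯.meshSize := by
  rw [← dist_eq_norm]
  exact (Metric.dist_le_diam_of_mem (𝒯.isCompact T hT).isBounded hx hy).trans
    (le_csSup (𝒯.cells.finite_toSet.image _).bddAbove ⟨T, hT, rfl⟩)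

lemma meshSize_pos [Nontrivial (Euc d)] (𝒯 : Triangulation Ω) (hne : 𝒯.cells.Nonempty) :
    0 < 𝒯.meshSize := by
  obtain ⟨T, hT⟩ := hne
  obtain ⟨x, hx⟩ := 𝒯.interior_nonempty T hT
  obtain ⟨ε, hε, hεT⟩ := Metric.isOpen_iff.1 isOpen_interior x hx
  obtain ⟨v, hv⟩ := exists_norm_eq (Euc d) (half_pos hε).le
  have add_mem : x + v ∈ T := _root_.interior_subset (hεT (by
    rw [mem_ball_iff_norm, add_sub_cancel_left, hv]
    exact half_lt_self hε))
  have norm_le := 𝒯.norm_sub_le_meshSize hT add_mem (_root_.interior_subset hx)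
  rw [add_sub_cancel_left, hv] at norm_le
  exact (half_pos hε).trans_le norm_le

lemma meshSize_le [Nontrivial (Euc d)] (𝒯 : Triangulation Ω) (hne : 𝒯.cells.Nonempty)
    (hΩb : Bornology.IsBounded Ω) {σ : ℝ} (hσ : 0 < σ) (hq : 𝒯.IsQuasiUniform σ) :
    𝒯.meshSize ≤ 2 * Metric.diam Ω / σ := by
  have radius_pos := mul_pos hσ (𝒯.meshSize_pos hne)
  obtain ⟨T, hT⟩ := hne
  obtain ⟨c, hball, -⟩ := hq T hT
  obtain ⟨v, hv⟩ := exists_norm_eq (Euc d) (half_pos radius_pos).le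
  have ball_subset : Metric.ball c (σ * 𝒯.meshSize) ⊆ Ω :=
    (Metric.ball_subset_interior_closedBall.trans (interior_mono hball)).trans
      (𝒯.interior_subset T hT)
  have add_mem : c + v ∈ Ω := ball_subset (by
    rw [mem_ball_iff_norm, add_sub_cancel_left, hv]
    exact half_lt_self radius_pos)
  have dist_le := Metric.dist_le_diam_of_mem hΩb add_mem
    (ball_subset (Metric.mem_ball_self radius_pos))
  rw [dist_eq_norm, add_sub_cancel_left, hv] at dist_le
  rw [le_div_iff₀ hσ]
  linarith

lemma isShapeRegular_one_of_subsingleton [Subsingleton (Euc d)] (𝒯 : Triangulation Ω) {σ : ℝ}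
    (hσ : 0 < σ) : 𝒯.IsShapeRegular σ 1 0 where
  sigma_pos := hσ
  pos := one_pos
  isStarShapedCell T := by
    have cell_eq : (T : Set (Euc d)) = univ :=
      ((𝒯.interior_nonempty T T.2).mono _root_.interior_subset).eq_univ
    rw [cell_eq]
    exact ⟨isClosed_univ, subset_univ _, fun _ _ => starConvex_univ _, fun x _ y _ => by
      simp [Subsingleton.elim x y]⟩

lemma IsQuasiUniform.exists_isShapeRegular {𝒯 : Triangulation Ω} {σ : ℝ}
    (hq : 𝒯.IsQuasiUniform σ) (hσ : 0 < σ) (hΩb : Bornology.IsBounded Ω) :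
    ∃ h c, h ≤ 2 * Metric.diam Ω / σ + 1 ∧ 𝒯.IsShapeRegular σ h c := by
  have bound_nonneg : 0 ≤ 2 * Metric.diam Ω / σ := by positivity
  rcases subsingleton_or_nontrivial (Euc d) with _ | _
  · exact ⟨1, 0, le_add_of_nonneg_left bound_nonneg, 𝒯.isShapeRegular_one_of_subsingleton hσ⟩
  rcases 𝒯.cells.eq_empty_or_nonempty with no_cells | hne
  · have : IsEmpty 𝒯.cells := by rw [no_cells]; infer_instance
    exact ⟨1, isEmptyElim, le_add_of_nonneg_left bound_nonneg, hσ, one_pos, isEmptyElim⟩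
  · choose c hball hstar using fun T : 𝒯.cells => hq T.1 T.2
    exact ⟨𝒯.meshSize, c, (𝒯.meshSize_le hne hΩb hσ hq).trans (le_add_of_nonneg_right zero_le_one),
      hσ, 𝒯.meshSize_pos hne, fun T => ⟨(𝒯.isCompact T T.2).isClosed, hball T, hstar T,
        fun _ hx _ hy => 𝒯.norm_sub_le_meshSize T.2 hx hy⟩⟩

namespace IsShapeRegular

variable {𝒯 : Triangulation Ω} {σ h : ℝ} {c : 𝒯.cells → Euc d}

lemma radius_pos (hr : 𝒯.IsShapeRegular σ h c) : 0 < σ * h := mul_pos hr.sigma_pos hr.pos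

lemma interior_ae_eq (hr : 𝒯.IsShapeRegular σ h c) (T : 𝒯.cells) :
    interior (T : Set (Euc d)) =ᵐ[volume] (T : Set (Euc d)) :=
  (hr.isStarShapedCell T).interior_ae_eq hr.radius_pos

lemma iUnion_interior_ae_eq (hr : 𝒯.IsShapeRegular σ h c) :
    (⋃ T : 𝒯.cells, interior (T : Set (Euc d))) =ᵐ[volume] Ω := by
  refine Filter.EventuallyLE.antisymm
    (iUnion_subset fun T : 𝒯.cells => 𝒯.interior_subset T T.2).eventuallyLE ?_
  have subset_cells : Ω ⊆ ⋃ T : 𝒯.cells, (T : Set (Euc d)) := fun x hx => by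
    obtain ⟨T, hT, hxT⟩ := mem_iUnion₂.1 (𝒯.covers hx)
    exact mem_iUnion.2 ⟨⟨T, hT⟩, hxT⟩
  exact subset_cells.eventuallyLE.trans
    (Filter.EventuallyEq.countable_iUnion fun T => (hr.interior_ae_eq T).symm).le

lemma restrict_eq_sum (hr : 𝒯.IsShapeRegular σ h c) :
    volume.restrict Ω = ∑ T : 𝒯.cells, volume.restrict (interior (T : Set (Euc d))) := by
  rw [← Measure.restrict_congr_set hr.iUnion_interior_ae_eq,
    Measure.restrict_iUnion (fun (T T' : 𝒯.cells) hTT' => 𝒯.disjoint T T.2 T' T'.2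
      fun heq => hTT' (Subtype.ext heq)) fun T => isOpen_interior.measurableSet,
    Measure.sum_fintype]

lemma ae_of_forall_mem_interior (hr : 𝒯.IsShapeRegular σ h c) {P : Euc d → Prop}
    (hP : ∀ T : 𝒯.cells, ∀ x ∈ interior (T : Set (Euc d)), P x) :
    ∀ᵐ x ∂(volume.restrict Ω), P x := by
  rw [hr.restrict_eq_sum, ← Measure.sum_fintype, Measure.ae_sum_iff]
  exact fun T => ae_restrict_of_forall_mem isOpen_interior.measurableSet (hP T)

lemma integral_eq_sum (hr : 𝒯.IsShapeRegular σ h c) {F : Euc d → ℝ}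
    (hF : Integrable F (volume.restrict Ω)) :
    ∫ x in Ω, F x = ∑ T : 𝒯.cells, ∫ x in interior (T : Set (Euc d)), F x := by
  conv_lhs => rw [hr.restrict_eq_sum]
  exact integral_finsetSum_measure fun T _ =>
    hF.mono_measure (Measure.restrict_mono_set _ (𝒯.interior_subset T.1 T.2))

lemma lintegral_eq_sum (hr : 𝒯.IsShapeRegular σ h c) (F : Euc d → ENNReal) :
    ∫⁻ x in Ω, F x = ∑ T : 𝒯.cells, ∫⁻ x in interior (T : Set (Euc d)), F x := by
  rw [hr.restrict_eq_sum, lintegral_finsetSum_measure]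

lemma interior_subset_closedBall (hr : 𝒯.IsShapeRegular σ h c) (T : 𝒯.cells) :
    interior (T : Set (Euc d)) ⊆ Metric.closedBall (c T) h :=
  _root_.interior_subset.trans ((hr.isStarShapedCell T).subset_closedBall hr.radius_pos.le)

lemma reference_mem_closedBall (hr : 𝒯.IsShapeRegular σ h c) (T : 𝒯.cells) {x : Euc d}
    (hx : x ∈ interior (T : Set (Euc d))) :
    h⁻¹ • (x - c T) ∈ Metric.closedBall (0 : Euc d) 1 := by
  rw [mem_closedBall_zero_iff, norm_smul, norm_inv, Real.norm_of_nonneg hr.pos.le,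
    inv_mul_le_iff₀ hr.pos, mul_one]
  exact mem_closedBall_iff_norm.1 (hr.interior_subset_closedBall T hx)

lemma volume_interior_le (hr : 𝒯.IsShapeRegular σ h c) (T : 𝒯.cells) :
    volume.real (interior (T : Set (Euc d))) ≤
      h ^ d * volume.real (Metric.ball (0 : Euc d) 1) := by
  refine (measureReal_mono (hr.interior_subset_closedBall T)
    measure_closedBall_lt_top.ne).trans_eq ?_
  rw [measureReal_def, Measure.addHaar_closedBall _ _ hr.pos.le, finrank_euclideanSpace_fin,
    ENNReal.toReal_mul, ENNReal.toReal_ofReal (pow_nonneg hr.pos.le d), measureReal_def]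

open scoped Pointwise in
lemma setIntegral_closedBall_reference (hr : 𝒯.IsShapeRegular σ h c) (T : 𝒯.cells)
    (F : Euc d → ℝ) :
    ∫ x in Metric.closedBall (c T) (σ * h), F (h⁻¹ • (x - c T)) =
      h ^ d * ∫ y in Metric.closedBall (0 : Euc d) σ, F y := by
  have preimage_eq : Metric.closedBall (c T) (σ * h) =
      (fun x => x - c T) ⁻¹' (h • Metric.closedBall (0 : Euc d) σ) := by
    rw [smul_closedBall _ _ hr.sigma_pos.le, smul_zero, Real.norm_of_nonneg hr.pos.le]
    ext x
    simp [dist_eq_norm, mul_comm]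
  rw [preimage_eq, (measurePreserving_sub_right volume (c T)).setIntegral_preimage_emb
      (MeasurableEquiv.subRight (c T)).measurableEmbedding (fun x => F (h⁻¹ • x)),
    Measure.setIntegral_comp_smul_of_pos _ _ _ (inv_pos.2 hr.pos),
    finrank_euclideanSpace_fin, smul_smul, inv_mul_cancel₀ hr.pos.ne', one_smul, smul_eq_mul,
    inv_pow, inv_inv]

lemma integral_reference_le (hr : 𝒯.IsShapeRegular σ h c) (T : 𝒯.cells) {F : Euc d → ℝ}
    (hF : Continuous F) (hF0 : ∀ y, 0 ≤ F y) :
    h ^ d * ∫ y in Metric.closedBall (0 : Euc d) σ, F y ≤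
      ∫ x in interior (T : Set (Euc d)), F (h⁻¹ • (x - c T)) := by
  have hcont : Continuous fun x => F (h⁻¹ • (x - c T)) := by fun_prop
  rw [setIntegral_congr_set (hr.interior_ae_eq T), ← hr.setIntegral_closedBall_reference T F]
  exact setIntegral_mono_set
    (hcont.continuousOn.integrableOn_compact (𝒯.isCompact T.1 T.2))
    (ae_of_all _ fun x => hF0 _) (hr.isStarShapedCell T).closedBall_subset.eventuallyLE

end IsShapeRegular

end Triangulation

/-! ### The finite element space -/

lemma sum_rpow_le_rpow_sum {ι : Type*} (s : Finset ι) {m : ι → ℝ} (hm : ∀ i ∈ s, 0 ≤ m i) {p : ℝ}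
    (hp : 1 < p) : ∑ i ∈ s, m i ^ p ≤ (∑ i ∈ s, m i) ^ p := by
  rw [rpow_eq_rpow_sub_one_mul hp (Finset.sum_nonneg hm), Finset.mul_sum]
  refine Finset.sum_le_sum fun i hi => ?_
  rw [rpow_eq_rpow_sub_one_mul hp (hm i hi)]
  exact mul_le_mul_of_nonneg_right (Real.rpow_le_rpow (hm i hi) (Finset.single_le_sum hm hi)
    (sub_pos.2 hp).le) (hm i hi)

lemma enorm_Lp_two_sq {X F : Type*} [MeasurableSpace X] {μ : Measure X} [NormedAddCommGroup F]
    (u : Lp F 2 μ) : ‖u‖ₑ ^ 2 = ∫⁻ x, ‖u x‖ₑ ^ 2 ∂μ := by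
  simpa [Lp.enorm_def] using
    eLpNorm_nnreal_pow_eq_lintegral (μ := μ) (f := u) (p := 2) two_ne_zero

namespace Triangulation

variable {d : ℕ} {Ω : Set (Euc d)}

section Cellwise

variable (𝒯 : Triangulation Ω) {F : Type*}

/-- The function equal to `L T` in the interior of each cell `T`, and to zero elsewhere. -/
def cellwise [AddCommMonoid F] (L : 𝒯.cells → Euc d → F) (x : Euc d) : F :=
  ∑ T : 𝒯.cells, (interior (T : Set (Euc d))).indicator (L T) x

lemma cellwise_of_mem [AddCommMonoid F] (L : 𝒯.cells → Euc d → F) {T : 𝒯.cells} {x : Euc d}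
    (hx : x ∈ interior (T : Set (Euc d))) : 𝒯.cellwise L x = L T x := by
  refine (Finset.sum_eq_single T (fun T' _ hT' => ?_) (by simp)).trans (indicator_of_mem hx _)
  exact indicator_of_notMem (fun hx' => disjoint_left.1
    (𝒯.disjoint T' T'.2 T T.2 fun heq => hT' (Subtype.ext heq)) hx' hx) _

lemma cellwise_of_forall_notMem [AddCommMonoid F] (L : 𝒯.cells → Euc d → F) {x : Euc d}
    (hx : ∀ T : 𝒯.cells, x ∉ interior (T : Set (Euc d))) : 𝒯.cellwise L x = 0 :=
  Finset.sum_eq_zero fun T _ => indicator_of_notMem (hx T) _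

variable [NormedAddCommGroup F] {L : 𝒯.cells → Euc d → F}

lemma stronglyMeasurable_cellwise (hL : ∀ T, Continuous (L T)) :
    StronglyMeasurable (𝒯.cellwise L) :=
  Finset.stronglyMeasurable_fun_sum _ fun T _ =>
    (hL T).stronglyMeasurable.indicator isOpen_interior.measurableSet

lemma exists_norm_cellwise_le (hL : ∀ T, Continuous (L T)) :
    ∃ M : ℝ, ∀ x, ‖𝒯.cellwise L x‖ ≤ M := by
  choose M hM using fun T : 𝒯.cells =>
    (𝒯.isCompact T.1 T.2).exists_bound_of_continuousOn (hL T).continuousOn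
  refine ⟨∑ T, |M T|, fun x =>
    (norm_sum_le _ _).trans (Finset.sum_le_sum fun T _ => ?_)⟩
  by_cases hx : x ∈ interior (T : Set (Euc d))
  · rw [indicator_of_mem hx]
    exact (hM T x (_root_.interior_subset hx)).trans (le_abs_self _)
  · rw [indicator_of_notMem hx, norm_zero]
    exact abs_nonneg _

end Cellwise

/-- Piecewise polynomials of degree at most `r`, by their coefficients in scaled coordinates on
every cell. -/
abbrev Coef (𝒯 : Triangulation Ω) (r : ℕ) : Type := 𝒯.cells → PolyCoef d r

section Evaluation

variable (𝒯 : Triangulation Ω) (r : ℕ) (h : ℝ) (c : 𝒯.cells → Euc d)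

/-- Evaluation of a piecewise polynomial, given by its coefficients in the coordinates
`(x - c T) / h` on each cell `T`; zero outside the interiors of the cells. -/
def evalAt : Euc d → 𝒯.Coef r →L[ℝ] ℝ := 𝒯.cellwise fun T x =>
  (PolyCoef.ev (h⁻¹ • (x - c T))).comp (ContinuousLinearMap.proj T)

/-- The elementwise gradient of a piecewise polynomial in the coordinates of `evalAt`. -/
def gradAt : Euc d → 𝒯.Coef r →L[ℝ] Euc d := 𝒯.cellwise fun T x =>
  (h⁻¹ • PolyCoef.grad (h⁻¹ • (x - c T))).comp (ContinuousLinearMap.proj T)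

lemma evalAt_of_mem {T : 𝒯.cells} {x : Euc d} (hx : x ∈ interior (T : Set (Euc d)))
    (w : 𝒯.Coef r) : 𝒯.evalAt r h c x w = PolyCoef.ev (h⁻¹ • (x - c T)) (w T) := by
  rw [evalAt, 𝒯.cellwise_of_mem _ hx]
  rfl

lemma gradAt_of_mem {T : 𝒯.cells} {x : Euc d} (hx : x ∈ interior (T : Set (Euc d)))
    (w : 𝒯.Coef r) : 𝒯.gradAt r h c x w = h⁻¹ • PolyCoef.grad (h⁻¹ • (x - c T)) (w T) := by
  rw [gradAt, 𝒯.cellwise_of_mem _ hx]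
  rfl

lemma continuous_cellEval (T : 𝒯.cells) : Continuous fun x : Euc d =>
    ((PolyCoef.ev (h⁻¹ • (x - c T))).comp (ContinuousLinearMap.proj T) : 𝒯.Coef r →L[ℝ] ℝ) :=
  (PolyCoef.continuous_ev.comp (by fun_prop)).clm_comp continuous_const

lemma continuous_cellGrad (T : 𝒯.cells) : Continuous fun x : Euc d =>
    ((h⁻¹ • PolyCoef.grad (h⁻¹ • (x - c T))).comp
      (ContinuousLinearMap.proj T) : 𝒯.Coef r →L[ℝ] Euc d) :=
  ((PolyCoef.continuous_grad.comp (by fun_prop)).const_smul h⁻¹).clm_comp continuous_const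

lemma stronglyMeasurable_evalAt : StronglyMeasurable (𝒯.evalAt r h c) :=
  𝒯.stronglyMeasurable_cellwise (𝒯.continuous_cellEval r h c)

lemma stronglyMeasurable_gradAt : StronglyMeasurable (𝒯.gradAt r h c) :=
  𝒯.stronglyMeasurable_cellwise (𝒯.continuous_cellGrad r h c)

lemma exists_norm_evalAt_le : ∃ M : ℝ, ∀ x, ‖𝒯.evalAt r h c x‖ ≤ M :=
  𝒯.exists_norm_cellwise_le (𝒯.continuous_cellEval r h c)

lemma exists_norm_gradAt_le : ∃ M : ℝ, ∀ x, ‖𝒯.gradAt r h c x‖ ≤ M :=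
  𝒯.exists_norm_cellwise_le (𝒯.continuous_cellGrad r h c)

lemma evalAt_mem_space (w : 𝒯.Coef r) : (fun x => 𝒯.evalAt r h c x w) ∈ 𝒯.space r := by
  intro T hT
  obtain ⟨p, hp, ev_eq⟩ := PolyCoef.exists_totalDegree_le (w ⟨T, hT⟩)
  obtain ⟨q, hq, eval_q⟩ :=
    exists_mvPolynomial_comp_affine p hp h⁻¹ fun i => -(h⁻¹ * c ⟨T, hT⟩ i)
  refine ⟨q, hq, fun x hx => ?_⟩
  change 𝒯.evalAt r h c x w = _
  rw [𝒯.evalAt_of_mem r h c (T := ⟨T, hT⟩) hx, ev_eq, eval_q]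
  congr 2
  funext i
  simp [sub_eq_add_neg]

lemma exists_evalAt_eq {u : Euc d → ℝ} (hh : h ≠ 0) (hu : u ∈ 𝒯.space r) : ∃ w : 𝒯.Coef r,
    ∀ T : 𝒯.cells, ∀ x ∈ interior (T : Set (Euc d)), u x = 𝒯.evalAt r h c x w := by
  have exists_cell_coef : ∀ T : 𝒯.cells, ∃ q : PolyCoef d r,
      ∀ x ∈ interior (T : Set (Euc d)), u x = PolyCoef.ev (h⁻¹ • (x - c T)) q := fun T => by
    obtain ⟨p, hp, u_eq⟩ := hu T.1 T.2
    obtain ⟨p', hp', eval_p'⟩ := exists_mvPolynomial_comp_affine p hp h fun i => c T i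
    obtain ⟨q, ev_q⟩ := PolyCoef.exists_ev_eq_eval hp'
    refine ⟨q, fun x hx => ?_⟩
    rw [u_eq x hx, ev_q, eval_p']
    congr 2
    funext i
    simp [mul_inv_cancel_left₀ hh]
  choose w hw using exists_cell_coef
  exact ⟨w, fun T x hx => by rw [hw T x hx, 𝒯.evalAt_of_mem r h c hx]⟩

lemma exists_evalAt_eq_const (k : 𝒯.cells → ℝ) : ∃ n : 𝒯.Coef r,
    (∀ x, 𝒯.gradAt r h c x n = 0) ∧
      ∀ T : 𝒯.cells, ∀ x ∈ interior (T : Set (Euc d)), 𝒯.evalAt r h c x n = k T := by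
  obtain ⟨e, he⟩ := PolyCoef.exists_ev_eq_one (d := d) (r := r)
  refine ⟨fun T => k T • e, fun x => ?_, fun T x hx => by
    rw [𝒯.evalAt_of_mem r h c hx, map_smul, he, smul_eq_mul, mul_one]⟩
  by_cases hx : ∃ T : 𝒯.cells, x ∈ interior (T : Set (Euc d))
  · obtain ⟨T, hx⟩ := hx
    rw [𝒯.gradAt_of_mem r h c hx, map_smul, PolyCoef.grad_eq_zero he, smul_zero, smul_zero]
  · rw [gradAt, 𝒯.cellwise_of_forall_notMem _ (not_exists.1 hx), _root_.zero_apply]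

lemma gradient_eq_gradAt {u : Euc d → ℝ} {w : 𝒯.Coef r} {T : 𝒯.cells}
    (hu : ∀ x ∈ interior (T : Set (Euc d)), u x = 𝒯.evalAt r h c x w) {x : Euc d}
    (hx : x ∈ interior (T : Set (Euc d))) : gradient u x = 𝒯.gradAt r h c x w := by
  have hasGradientAt_cell : HasGradientAt (fun x => PolyCoef.ev (h⁻¹ • (x - c T)) (w T))
      (h⁻¹ • PolyCoef.grad (h⁻¹ • (x - c T)) (w T)) x := by
    have scaling : HasFDerivAt (fun x : Euc d => h⁻¹ • (x - c T))
        (h⁻¹ • ContinuousLinearMap.id ℝ (Euc d)) x :=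
      ((hasFDerivAt_id x).sub_const (c T)).const_smul h⁻¹
    have composition :=
      (PolyCoef.hasGradientAt_ev (w T) (h⁻¹ • (x - c T))).hasFDerivAt.comp x scaling
    refine hasGradientAt_iff_hasFDerivAt.2 (composition.congr_fderiv ?_)
    ext v
    simp
  have eventuallyEq : u =ᶠ[nhds x] fun x => PolyCoef.ev (h⁻¹ • (x - c T)) (w T) := by
    filter_upwards [isOpen_interior.mem_nhds hx] with y hy
    rw [hu y hy, 𝒯.evalAt_of_mem r h c hy]
  rw [𝒯.gradAt_of_mem r h c hx]
  exact (hasGradientAt_cell.congr_of_eventuallyEq eventuallyEq).gradient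

lemma eq_zero_of_evalAt_eq_zero (hh : h ≠ 0) {w : 𝒯.Coef r}
    (hw : ∀ T : 𝒯.cells, ∀ x ∈ interior (T : Set (Euc d)), 𝒯.evalAt r h c x w = 0) : w = 0 := by
  funext T
  have hcont : Continuous fun y : Euc d => h • y + c T := by fun_prop
  refine PolyCoef.eq_zero_of_ev_eq_zero (U := (fun y => h • y + c T) ⁻¹' interior (T : Set (Euc d)))
    (isOpen_interior.preimage hcont) ?_ fun y hy => ?_
  · obtain ⟨x, hx⟩ := 𝒯.interior_nonempty T.1 T.2
    exact ⟨h⁻¹ • (x - c T), by simpa [smul_smul, mul_inv_cancel₀ hh] using hx⟩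
  · simpa [𝒯.evalAt_of_mem r h c hy, smul_smul, inv_mul_cancel₀ hh] using hw T _ hy

end Evaluation

section Embedding

variable (𝒯 : Triangulation Ω) (r : ℕ) (h : ℝ) (c : 𝒯.cells → Euc d)
  (hΩb : Bornology.IsBounded Ω)

include hΩb

lemma isFiniteMeasure_restrict : IsFiniteMeasure (volume.restrict Ω) :=
  ⟨by simpa using hΩb.measure_lt_top⟩

lemma integrable_evalAt_sq (w : 𝒯.Coef r) :
    Integrable (fun x => 𝒯.evalAt r h c x w ^ 2) (volume.restrict Ω) := by
  have := isFiniteMeasure_restrict hΩb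
  obtain ⟨M, hM⟩ := 𝒯.exists_norm_evalAt_le r h c
  exact integrable_comp_of_norm_le (𝒯.stronglyMeasurable_evalAt r h c) hM
    (ψ := fun L => L w ^ 2) (by fun_prop)

lemma memLp_evalAt (w : 𝒯.Coef r) :
    MemLp (fun x => 𝒯.evalAt r h c x w) 2 (volume.restrict Ω) :=
  (memLp_two_iff_integrable_sq ((continuous_eval_const w).comp_stronglyMeasurable
    (𝒯.stronglyMeasurable_evalAt r h c)).aestronglyMeasurable).2
    (𝒯.integrable_evalAt_sq r h c hΩb w)

lemma integrable_norm_gradAt_rpow (w : 𝒯.Coef r) {b : ℝ} (hb : 0 ≤ b) :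
    Integrable (fun x => ‖𝒯.gradAt r h c x w‖ ^ b) (volume.restrict Ω) := by
  have := isFiniteMeasure_restrict hΩb
  obtain ⟨M, hM⟩ := 𝒯.exists_norm_gradAt_le r h c
  exact integrable_comp_of_norm_le (𝒯.stronglyMeasurable_gradAt r h c) hM
    (ψ := fun L => ‖L w‖ ^ b)
    ((Real.continuous_rpow_const hb).comp (continuous_eval_const w).norm)

/-- The embedding of the finite element space into `L²(Ω)`. -/
def toL2 : 𝒯.Coef r →L[ℝ] L2 Ω :=
  LinearMap.toContinuousLinearMap
    { toFun := fun w => (𝒯.memLp_evalAt r h c hΩb w).toLp _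
      map_add' := fun v w => by
        rw [← MemLp.toLp_add]
        congr 1
        funext x
        exact map_add _ v w
      map_smul' := fun a w => by
        rw [RingHom.id_apply, ← MemLp.toLp_const_smul]
        congr 1
        funext x
        exact map_smul _ a w }

lemma coeFn_toL2 (w : 𝒯.Coef r) :
    𝒯.toL2 r h c hΩb w =ᵐ[volume.restrict Ω] fun x => 𝒯.evalAt r h c x w :=
  MemLp.coeFn_toLp (𝒯.memLp_evalAt r h c hΩb w)

lemma inner_toL2 (φ : L2 Ω) (w : 𝒯.Coef r) :
    ⟪φ, 𝒯.toL2 r h c hΩb w⟫ = ∫ x in Ω, φ x * 𝒯.evalAt r h c x w := by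
  rw [L2.inner_def]
  refine integral_congr_ae ?_
  filter_upwards [𝒯.coeFn_toL2 r h c hΩb w] with x hx
  rw [hx]
  simp [mul_comm]

lemma inner_toL2_toL2 (v w : 𝒯.Coef r) :
    ⟪𝒯.toL2 r h c hΩb v, 𝒯.toL2 r h c hΩb w⟫ =
      ∫ x in Ω, 𝒯.evalAt r h c x v * 𝒯.evalAt r h c x w := by
  rw [inner_toL2]
  refine integral_congr_ae ?_
  filter_upwards [𝒯.coeFn_toL2 r h c hΩb v] with x hx
  rw [hx]

lemma norm_toL2_sq (w : 𝒯.Coef r) :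
    ‖𝒯.toL2 r h c hΩb w‖ ^ 2 = ∫ x in Ω, 𝒯.evalAt r h c x w ^ 2 := by
  rw [← real_inner_self_eq_norm_sq, inner_toL2_toL2]
  simp_rw [sq]

/-- The finite element space `W_h`, as a subspace of `L²(Ω)`. -/
abbrev femSpace : Submodule ℝ (L2 Ω) := (𝒯.toL2 r h c hΩb).range

end Embedding

end Triangulation

section FiniteElementEstimates

open Triangulation

variable {d : ℕ} {Ω : Set (Euc d)} {𝒯 : Triangulation Ω} {σ h : ℝ} {c : 𝒯.cells → Euc d}

namespace Triangulation.IsShapeRegular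

lemma setIntegral_interior_le (hr : 𝒯.IsShapeRegular σ h c) (T : 𝒯.cells) {F : Euc d → ℝ} {M : ℝ}
    (hM : 0 ≤ M) (hF : ∀ x ∈ interior (T : Set (Euc d)), ‖F x‖ ≤ M) :
    ∫ x in interior (T : Set (Euc d)), F x ≤
      M * (h ^ d * volume.real (Metric.ball (0 : Euc d) 1)) :=
  calc ∫ x in interior (T : Set (Euc d)), F x ≤ |∫ x in interior (T : Set (Euc d)), F x| :=
        le_abs_self _
    _ ≤ M * volume.real (interior (T : Set (Euc d))) :=
      norm_setIntegral_le_of_norm_le_const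
        ((measure_mono _root_.interior_subset).trans_lt (𝒯.isCompact T.1 T.2).measure_lt_top) hF
    _ ≤ _ := mul_le_mul_of_nonneg_left (hr.volume_interior_le T) hM

lemma setIntegral_norm_gradAt_sq_le (hr : 𝒯.IsShapeRegular σ h c) {r : ℕ} {C : ℝ} (hC : 0 ≤ C)
    (hCle : ∀ q : PolyCoef d r, ∀ y ∈ Metric.closedBall (0 : Euc d) 1, ‖PolyCoef.grad y q‖ ^ 2 ≤
      C * ∫ z in Metric.closedBall (0 : Euc d) σ, (PolyCoef.ev z q) ^ 2)
    (T : 𝒯.cells) (w : 𝒯.Coef r) :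
    h ^ 2 * ∫ x in interior (T : Set (Euc d)), ‖𝒯.gradAt r h c x w‖ ^ 2 ≤
      C * volume.real (Metric.ball (0 : Euc d) 1) *
        ∫ x in interior (T : Set (Euc d)), 𝒯.evalAt r h c x w ^ 2 := by
  set V := volume.real (Metric.ball (0 : Euc d) 1)
  set J := ∫ z in Metric.closedBall (0 : Euc d) σ, (PolyCoef.ev z (w T)) ^ 2
  have hh := hr.pos
  have : 0 ≤ J := integral_nonneg fun z => sq_nonneg _
  have grad_le : ∫ x in interior (T : Set (Euc d)), ‖𝒯.gradAt r h c x w‖ ^ 2 ≤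
      h⁻¹ ^ 2 * (C * J) * (h ^ d * V) :=
    hr.setIntegral_interior_le T (by positivity) fun x hx => by
      rw [𝒯.gradAt_of_mem r h c hx, norm_smul, mul_pow, norm_inv, Real.norm_of_nonneg hh.le,
        Real.norm_of_nonneg (by positivity)]
      gcongr
      exact hCle _ _ (hr.reference_mem_closedBall T hx)
  have J_le : h ^ d * J ≤ ∫ x in interior (T : Set (Euc d)), 𝒯.evalAt r h c x w ^ 2 := by
    rw [setIntegral_congr_fun isOpen_interior.measurableSet fun x hx =>
      congrArg (· ^ 2) (𝒯.evalAt_of_mem r h c hx w)]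
    exact hr.integral_reference_le T (F := fun z => (PolyCoef.ev z (w T)) ^ 2)
      ((PolyCoef.continuous_ev.clm_apply continuous_const).pow 2) fun _ => sq_nonneg _
  calc _ ≤ h ^ 2 * (h⁻¹ ^ 2 * (C * J) * (h ^ d * V)) := by gcongr
    _ = C * V * (h ^ d * J) := by field_simp
    _ ≤ _ := by gcongr

lemma setIntegral_norm_grad_reference_le (hr : 𝒯.IsShapeRegular σ h c) {r : ℕ} {b : ℝ} (hb : 0 ≤ b)
    (T : 𝒯.cells) (w : 𝒯.Coef r) :
    ∫ z in Metric.closedBall (0 : Euc d) σ, ‖PolyCoef.grad z (w T)‖ ^ b ≤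
      h ^ (b - d) * ∫ x in interior (T : Set (Euc d)), ‖𝒯.gradAt r h c x w‖ ^ b := by
  have hh := hr.pos
  have gradAt_eq : ∫ x in interior (T : Set (Euc d)), ‖𝒯.gradAt r h c x w‖ ^ b =
      (h ^ b)⁻¹ * ∫ x in interior (T : Set (Euc d)),
        ‖PolyCoef.grad (h⁻¹ • (x - c T)) (w T)‖ ^ b := by
    rw [← integral_const_mul]
    refine setIntegral_congr_fun isOpen_interior.measurableSet fun x hx => ?_
    rw [𝒯.gradAt_of_mem r h c hx, norm_smul, norm_inv, Real.norm_of_nonneg hh.le,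
      Real.mul_rpow (by positivity) (norm_nonneg _), Real.inv_rpow hh.le]
  rw [gradAt_eq, Real.rpow_sub hh, Real.rpow_natCast, ← mul_assoc, div_mul_eq_mul_div,
    mul_inv_cancel₀ (Real.rpow_pos_of_pos hh b).ne', div_mul_eq_mul_div, one_mul,
    le_div_iff₀' (pow_pos hh d)]
  exact hr.integral_reference_le T (F := fun z => ‖PolyCoef.grad z (w T)‖ ^ b)
    ((Real.continuous_rpow_const hb).comp
      (PolyCoef.continuous_grad.clm_apply continuous_const).norm)
    fun _ => Real.rpow_nonneg (norm_nonneg _) b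

lemma norm_toL2_rpow_le (hr : 𝒯.IsShapeRegular σ h c) (hΩb : Bornology.IsBounded Ω) {r : ℕ} {b : ℝ}
    (hb : 0 < b) (hb2 : b < 2) {v : 𝒯.Coef r} {m : 𝒯.cells → ℝ} (hm : ∀ T, 0 ≤ m T)
    (hv : ∀ T : 𝒯.cells, ∀ x ∈ interior (T : Set (Euc d)), |𝒯.evalAt r h c x v| ^ b ≤ m T) :
    ‖𝒯.toL2 r h c hΩb v‖ ^ b ≤
      (∑ T, m T) * (h ^ d * volume.real (Metric.ball (0 : Euc d) 1)) ^ (b / 2) := by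
  set V := h ^ d * volume.real (Metric.ball (0 : Euc d) 1)
  have V_nonneg : 0 ≤ V := mul_nonneg (pow_nonneg hr.pos.le d) measureReal_nonneg
  have sum_nonneg : 0 ≤ ∑ T, m T := Finset.sum_nonneg fun T _ => hm T
  have evalAt_sq_le : ∀ T : 𝒯.cells, ∀ x ∈ interior (T : Set (Euc d)),
      ‖𝒯.evalAt r h c x v ^ 2‖ ≤ m T ^ (2 / b) := fun T x hx =>
    calc ‖𝒯.evalAt r h c x v ^ 2‖ = (|𝒯.evalAt r h c x v| ^ b) ^ (2 / b) := by
          rw [← Real.rpow_mul (abs_nonneg _), mul_div_cancel₀ _ hb.ne', Real.rpow_ofNat, norm_pow,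
            Real.norm_eq_abs]
      _ ≤ m T ^ (2 / b) := by gcongr; exact hv T x hx
  have norm_sq_le : ‖𝒯.toL2 r h c hΩb v‖ ^ 2 ≤ (∑ T, m T) ^ (2 / b) * V := by
    rw [norm_toL2_sq, hr.integral_eq_sum (𝒯.integrable_evalAt_sq r h c hΩb _)]
    calc _ ≤ ∑ T, m T ^ (2 / b) * V := Finset.sum_le_sum fun T _ =>
          hr.setIntegral_interior_le T (Real.rpow_nonneg (hm T) _) (evalAt_sq_le T)
      _ = (∑ T, m T ^ (2 / b)) * V := (Finset.sum_mul ..).symm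
      _ ≤ _ := by
        gcongr
        exact sum_rpow_le_rpow_sum _ (fun T _ => hm T) ((one_lt_div hb).2 hb2)
  calc ‖𝒯.toL2 r h c hΩb v‖ ^ b = (‖𝒯.toL2 r h c hΩb v‖ ^ 2) ^ (b / 2) := by
        rw [← Real.rpow_natCast_mul (norm_nonneg _), Nat.cast_ofNat, mul_div_cancel₀ _ two_ne_zero]
    _ ≤ ((∑ T, m T) ^ (2 / b) * V) ^ (b / 2) := by gcongr
    _ = (∑ T, m T) * V ^ (b / 2) := by
        rw [Real.mul_rpow (by positivity) V_nonneg, ← Real.rpow_mul sum_nonneg,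
          div_mul_div_cancel₀ hb.ne', div_self two_ne_zero, Real.rpow_one]

lemma exists_norm_sub_toL2_sq_le (hr : 𝒯.IsShapeRegular σ h c) (r : ℕ) (hΩo : IsOpen Ω)
    (hΩb : Bornology.IsBounded Ω) {φ : L2 Ω} {G : L2Vec Ω} (hG : IsWeakGradient Ω φ G) :
    ∃ n : 𝒯.Coef r, (∀ x, 𝒯.gradAt r h c x n = 0) ∧
      ‖φ - 𝒯.toL2 r h c hΩb n‖ ^ 2 ≤ h ^ 2 * (2 ^ d * ((2 / σ) ^ d + 1)) * ‖G‖ ^ 2 := by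
  have hσ := hr.sigma_pos
  choose k hk using fun T : 𝒯.cells =>
    (hr.isStarShapedCell T).exists_const_lintegral_sub_sq_le hΩo hΩb hG (𝒯.interior_subset T T.2)
      hr.radius_pos (κ := 2 / σ) (by positivity) (by field_simp; exact le_rfl)
  obtain ⟨n, grad_n, eval_n⟩ := 𝒯.exists_evalAt_eq_const r h c k
  refine ⟨n, grad_n, ?_⟩
  set A := h ^ 2 * (2 ^ d * ((2 / σ) ^ d + 1))
  have A_nonneg : 0 ≤ A := by positivity
  have enorm_le : ‖φ - 𝒯.toL2 r h c hΩb n‖ₑ ^ 2 ≤ ENNReal.ofReal A * ‖G‖ₑ ^ 2 := by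
    have coeFn_sub : ∀ᵐ x ∂(volume.restrict Ω), ‖(φ - 𝒯.toL2 r h c hΩb n) x‖ₑ ^ 2 =
        ‖φ x - 𝒯.evalAt r h c x n‖ₑ ^ 2 := by
      filter_upwards [Lp.coeFn_sub φ (𝒯.toL2 r h c hΩb n), 𝒯.coeFn_toL2 r h c hΩb n]
        with x sub_eq toL2_eq
      rw [sub_eq, Pi.sub_apply, toL2_eq]
    rw [enorm_Lp_two_sq, enorm_Lp_two_sq, lintegral_congr_ae coeFn_sub, hr.lintegral_eq_sum,
      hr.lintegral_eq_sum, Finset.mul_sum]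
    refine Finset.sum_le_sum fun T _ => le_trans (le_of_eq ?_) (hk T)
    exact setLIntegral_congr_fun isOpen_interior.measurableSet fun x hx => by rw [eval_n T x hx]
  simpa [ENNReal.toReal_mul, ENNReal.toReal_ofReal A_nonneg] using
    ENNReal.toReal_mono (by finiteness) enorm_le

end Triangulation.IsShapeRegular

lemma exists_inverse_inequality (d r : ℕ) {σ : ℝ} (hσ : 0 < σ) : ∃ C : ℝ, 0 ≤ C ∧
    ∀ {Ω : Set (Euc d)} (hΩb : Bornology.IsBounded Ω) {𝒯 : Triangulation Ω} {h : ℝ}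
      {c : 𝒯.cells → Euc d}, 𝒯.IsShapeRegular σ h c → ∀ w : 𝒯.Coef r,
      h ^ 2 * ∫ x in Ω, ‖𝒯.gradAt r h c x w‖ ^ 2 ≤ C * ‖𝒯.toL2 r h c hΩb w‖ ^ 2 := by
  obtain ⟨C, hC, hCle⟩ := PolyCoef.exists_norm_grad_sq_le d r hσ
  refine ⟨C * volume.real (Metric.ball (0 : Euc d) 1), mul_nonneg hC.le measureReal_nonneg,
    fun {Ω} hΩb {𝒯 h c} hr w => ?_⟩
  have integrable_sq : Integrable (fun x => ‖𝒯.gradAt r h c x w‖ ^ 2) (volume.restrict Ω) := by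
    simpa using 𝒯.integrable_norm_gradAt_rpow r h c hΩb w (b := 2) zero_le_two
  rw [hr.integral_eq_sum integrable_sq, norm_toL2_sq,
    hr.integral_eq_sum (𝒯.integrable_evalAt_sq r h c hΩb w), Finset.mul_sum, Finset.mul_sum]
  exact Finset.sum_le_sum fun T _ => hr.setIntegral_norm_gradAt_sq_le hC.le hCle T w

lemma exists_broken_poincare (d r : ℕ) {σ b H : ℝ} (hσ : 0 < σ) (hb : 0 < b) (hb2 : b < 2)
    (hexp : 0 ≤ ((d : ℝ) + 2) * b / 2 - d) (hH : 0 ≤ H) : ∃ S : ℝ, 0 < S ∧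
    ∀ {Ω : Set (Euc d)} (hΩb : Bornology.IsBounded Ω) {𝒯 : Triangulation Ω} {h : ℝ}
      {c : 𝒯.cells → Euc d}, 𝒯.IsShapeRegular σ h c → h ≤ H → ∀ w : 𝒯.Coef r, ∃ n : 𝒯.Coef r,
      (∀ x, 𝒯.gradAt r h c x n = 0) ∧
      ‖𝒯.toL2 r h c hΩb (w - n)‖ ^ b ≤ S * ∫ x in Ω, ‖𝒯.gradAt r h c x w‖ ^ b := by
  obtain ⟨C, hC, hCle⟩ := PolyCoef.exists_abs_sub_rpow_le d r hσ hb
  set V := volume.real (Metric.ball (0 : Euc d) 1)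
  have V_nonneg : 0 ≤ V := measureReal_nonneg
  refine ⟨V ^ (b / 2) * C * H ^ (((d : ℝ) + 2) * b / 2 - d) + 1, by positivity,
    fun {Ω} hΩb {𝒯 h c} hr hhH w => ?_⟩
  have hh := hr.pos
  obtain ⟨n, grad_n, eval_n⟩ := 𝒯.exists_evalAt_eq_const r h c fun T => PolyCoef.ev 0 (w T)
  refine ⟨n, grad_n, ?_⟩
  set A : 𝒯.cells → ℝ := fun T => ∫ x in interior (T : Set (Euc d)), ‖𝒯.gradAt r h c x w‖ ^ b
  have A_nonneg : ∀ T, 0 ≤ A T := fun T => integral_nonneg fun z => by positivity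
  have : 0 ≤ ∑ T, A T := Finset.sum_nonneg fun T _ => A_nonneg T
  have oscillation_le : ∀ T : 𝒯.cells, ∀ x ∈ interior (T : Set (Euc d)),
      |𝒯.evalAt r h c x (w - n)| ^ b ≤ C * (h ^ (b - d) * A T) := fun T x hx => by
    rw [map_sub, eval_n T x hx, 𝒯.evalAt_of_mem r h c hx]
    exact (hCle (w T) _ (hr.reference_mem_closedBall T hx)).trans (mul_le_mul_of_nonneg_left
      (hr.setIntegral_norm_grad_reference_le hb.le T w) hC.le)
  rw [hr.integral_eq_sum (𝒯.integrable_norm_gradAt_rpow r h c hΩb w hb.le)]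
  calc ‖𝒯.toL2 r h c hΩb (w - n)‖ ^ b
      ≤ (∑ T, C * (h ^ (b - d) * A T)) * (h ^ d * V) ^ (b / 2) :=
        hr.norm_toL2_rpow_le hΩb hb hb2
          (fun T => mul_nonneg hC.le (mul_nonneg (by positivity) (A_nonneg T))) oscillation_le
    _ = V ^ (b / 2) * C * (h ^ ((d : ℝ) * (b / 2)) * h ^ (b - d)) * ∑ T, A T := by
        rw [← Finset.mul_sum, ← Finset.mul_sum, Real.mul_rpow (by positivity) V_nonneg,
          ← Real.rpow_natCast_mul hh.le]
        ring
    _ = V ^ (b / 2) * C * h ^ (((d : ℝ) + 2) * b / 2 - d) * ∑ T, A T := by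
        rw [← Real.rpow_add hh]
        congr 3
        ring
    _ ≤ (V ^ (b / 2) * C * H ^ (((d : ℝ) + 2) * b / 2 - d) + 1) * ∑ T, A T := by
        gcongr
        refine le_add_of_le_of_nonneg ?_ zero_le_one
        gcongr

-- The projection is compared with a piecewise constant, whose elementwise gradient vanishes.
lemma exists_projection_stability (d r : ℕ) {σ : ℝ} (hσ : 0 < σ) : ∃ B : ℝ, 0 ≤ B ∧
    ∀ {Ω : Set (Euc d)} (_ : IsOpen Ω) (hΩb : Bornology.IsBounded Ω) {𝒯 : Triangulation Ω} {h : ℝ}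
      {c : 𝒯.cells → Euc d}, 𝒯.IsShapeRegular σ h c → ∀ {φ : L2 Ω} {G : L2Vec Ω},
      IsWeakGradient Ω φ G → ∀ p : 𝒯.Coef r,
      𝒯.toL2 r h c hΩb p = (𝒯.femSpace r h c hΩb).starProjection φ →
      ∫ x in Ω, ‖𝒯.gradAt r h c x p‖ ^ 2 ≤ B * ‖G‖ ^ 2 := by
  obtain ⟨C, hC, hCle⟩ := exists_inverse_inequality d r hσ
  refine ⟨C * (2 ^ d * ((2 / σ) ^ d + 1)), by positivity,
    fun {Ω} hΩo hΩb {𝒯 h c} hr {φ G} hG p hp => ?_⟩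
  obtain ⟨n, grad_n, norm_sub_n_le⟩ := hr.exists_norm_sub_toL2_sq_le r hΩo hΩb hG
  have proj_n : (𝒯.femSpace r h c hΩb).starProjection (𝒯.toL2 r h c hΩb n) =
      𝒯.toL2 r h c hΩb n := Submodule.starProjection_eq_self_iff.2 ⟨n, rfl⟩
  have norm_le : ‖𝒯.toL2 r h c hΩb (p - n)‖ ≤ ‖φ - 𝒯.toL2 r h c hΩb n‖ := by
    rw [map_sub, hp, ← proj_n, ← map_sub, proj_n]
    exact Submodule.norm_starProjection_apply_le _ _
  refine le_of_mul_le_mul_left ?_ (pow_pos hr.pos 2)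
  calc h ^ 2 * ∫ x in Ω, ‖𝒯.gradAt r h c x p‖ ^ 2
      = h ^ 2 * ∫ x in Ω, ‖𝒯.gradAt r h c x (p - n)‖ ^ 2 := by simp_rw [map_sub, grad_n, sub_zero]
    _ ≤ C * ‖𝒯.toL2 r h c hΩb (p - n)‖ ^ 2 := hCle hΩb hr (p - n)
    _ ≤ C * (h ^ 2 * (2 ^ d * ((2 / σ) ^ d + 1)) * ‖G‖ ^ 2) := by
        gcongr
        exact (pow_le_pow_left₀ (norm_nonneg _) norm_le 2).trans norm_sub_n_le
    _ = h ^ 2 * (C * (2 ^ d * ((2 / σ) ^ d + 1)) * ‖G‖ ^ 2) := by ring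

end FiniteElementEstimates

/-! ### Projections and solutions in `L²` -/

section SeparatingFunctionals

variable {V ι : Type*} [NormedAddCommGroup V] [NormedSpace ℝ V] [FiniteDimensional ℝ V]

lemma isClosedEmbedding_of_separating {ℓ : ι → V →L[ℝ] ℝ}
    (hℓ : ∀ v, (∀ i, ℓ i v = 0) → v = 0) : Topology.IsClosedEmbedding fun v i => ℓ i v :=
  LinearMap.isClosedEmbedding_of_injective (f := (ContinuousLinearMap.pi ℓ).toLinearMap)
    (LinearMap.ker_eq_bot'.2 fun v hv => hℓ v fun i => congrFun hv i)

lemma continuousOn_of_separating {ℓ : ι → V →L[ℝ] ℝ} (hℓ : ∀ v, (∀ i, ℓ i v = 0) → v = 0)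
    {Y : Type*} [TopologicalSpace Y] {γ : Y → V} {s : Set Y}
    (hγ : ∀ i, ContinuousOn (fun y => ℓ i (γ y)) s) : ContinuousOn γ s :=
  (isClosedEmbedding_of_separating hℓ).isInducing.continuousOn_iff.2 (continuousOn_pi.2 hγ)

lemma differentiableAt_of_separating {ℓ : ι → V →L[ℝ] ℝ} (hℓ : ∀ v, (∀ i, ℓ i v = 0) → v = 0)
    {γ : ℝ → V} {t : ℝ} (hγ : ∀ i, DifferentiableAt ℝ (fun s => ℓ i (γ s)) t) :
    DifferentiableAt ℝ γ t := by
  have embedding := isClosedEmbedding_of_separating hℓ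
  have tendsto_slope : Filter.Tendsto (fun s i => ℓ i (slope γ t s)) (nhdsWithin t {t}ᶜ)
      (nhds fun i => deriv (fun s => ℓ i (γ s)) t) := tendsto_pi_nhds.2 fun i => by
    simpa [slope_fun_def, map_smul] using hasDerivAt_iff_tendsto_slope.1 (hγ i).hasDerivAt
  obtain ⟨v, hv⟩ := embedding.isClosed_range.mem_of_tendsto tendsto_slope
    (Filter.Eventually.of_forall fun s => mem_range_self (slope γ t s))
  rw [← hv] at tendsto_slope
  exact (hasDerivAt_iff_tendsto_slope.2
    (embedding.isInducing.tendsto_nhds_iff.2 tendsto_slope)).differentiableAt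

end SeparatingFunctionals

namespace Triangulation.IsShapeRegular

variable {d : ℕ} {Ω : Set (Euc d)} {𝒯 : Triangulation Ω} {σ h : ℝ} {c : 𝒯.cells → Euc d}
  (hr : 𝒯.IsShapeRegular σ h c) (r : ℕ) (hΩb : Bornology.IsBounded Ω)

include hr in
lemma toL2_injective : Function.Injective (𝒯.toL2 r h c hΩb) := by
  rw [injective_iff_map_eq_zero]
  intro w hw
  have evalAt_ae_eq : (fun x => 𝒯.evalAt r h c x w) =ᵐ[volume.restrict Ω] fun _ => (0 : ℝ) :=
    (𝒯.coeFn_toL2 r h c hΩb w).symm.trans (hw ▸ Lp.coeFn_zero _ _ _)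
  refine 𝒯.eq_zero_of_evalAt_eq_zero r h c hr.pos.ne' fun T => ?_
  have continuousOn_evalAt : ContinuousOn (fun x => 𝒯.evalAt r h c x w) (interior T) :=
    ((continuous_eval_const w).comp (𝒯.continuous_cellEval r h c T)).continuousOn.congr
      fun x hx => 𝒯.evalAt_of_mem r h c hx w
  exact Measure.eqOn_open_of_ae_eq (ae_mono (Measure.restrict_mono_set _
    (𝒯.interior_subset T.1 T.2)) evalAt_ae_eq)
    isOpen_interior continuousOn_evalAt continuousOn_const

/-- The coefficients of the elements of `W_h ⊆ L²(Ω)`. -/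
def coefEquiv : 𝒯.Coef r ≃L[ℝ] 𝒯.femSpace r h c hΩb :=
  (LinearEquiv.ofInjective (𝒯.toL2 r h c hΩb).toLinearMap
    (hr.toL2_injective r hΩb)).toContinuousLinearEquiv

/-- The value at `x` of an element of `W_h ⊆ L²(Ω)`; zero outside the interiors of the cells. -/
def value (x : Euc d) : 𝒯.femSpace r h c hΩb →L[ℝ] ℝ :=
  (𝒯.evalAt r h c x).comp (hr.coefEquiv r hΩb).symm.toContinuousLinearMap

/-- The elementwise gradient on `W_h ⊆ L²(Ω)`. -/
def discreteGradient : DiscreteGradient (Euc d) (Euc d) (𝒯.femSpace r h c hΩb) where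
  D x := (𝒯.gradAt r h c x).comp (hr.coefEquiv r hΩb).symm.toContinuousLinearMap
  bound := (𝒯.exists_norm_gradAt_le r h c).choose *
    ‖(hr.coefEquiv r hΩb).symm.toContinuousLinearMap‖
  stronglyMeasurable_D :=
    ((ContinuousLinearMap.compL ℝ _ _ _).flip _).continuous.comp_stronglyMeasurable
      (𝒯.stronglyMeasurable_gradAt r h c)
  norm_D_le x := (ContinuousLinearMap.opNorm_comp_le _ _).trans
    (mul_le_mul_of_nonneg_right ((𝒯.exists_norm_gradAt_le r h c).choose_spec x)
      (ContinuousLinearMap.opNorm_nonneg _))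

/-- `w ∈ W_h ⊆ L²(Ω)` is the class of the piecewise polynomial `q`, whose values on the skeleton
are irrelevant. -/
def Represents (w : 𝒯.femSpace r h c hΩb) (q : Euc d → ℝ) : Prop :=
  ∀ T : 𝒯.cells, ∀ x ∈ interior (T : Set (Euc d)), q x = hr.value r hΩb x w

variable {r hΩb}

lemma represents_value (w : 𝒯.femSpace r h c hΩb) :
    hr.Represents r hΩb w fun x => hr.value r hΩb x w := fun _ _ _ => rfl

lemma value_mem_space (w : 𝒯.femSpace r h c hΩb) :
    (fun x => hr.value r hΩb x w) ∈ 𝒯.space r := 𝒯.evalAt_mem_space r h c _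

lemma exists_represents {q : Euc d → ℝ} (hq : q ∈ 𝒯.space r) : ∃ w, hr.Represents r hΩb w q := by
  obtain ⟨w, hw⟩ := 𝒯.exists_evalAt_eq r h c hr.pos.ne' hq
  exact ⟨hr.coefEquiv r hΩb w, by simpa [Represents, value] using hw⟩

lemma eq_zero_of_value_eq_zero {w : 𝒯.femSpace r h c hΩb}
    (hw : ∀ T : 𝒯.cells, ∀ x ∈ interior (T : Set (Euc d)), hr.value r hΩb x w = 0) : w = 0 :=
  (hr.coefEquiv r hΩb).symm.map_eq_zero_iff.1 (𝒯.eq_zero_of_evalAt_eq_zero r h c hr.pos.ne' hw)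

namespace Represents

variable {hr} {w v : 𝒯.femSpace r h c hΩb} {q p : Euc d → ℝ}

lemma add (hw : hr.Represents r hΩb w q) (hv : hr.Represents r hΩb v p) :
    hr.Represents r hΩb (w + v) (q + p) := fun T x hx => by
  rw [Pi.add_apply, hw T x hx, hv T x hx, map_add]

lemma gradient_eq (hw : hr.Represents r hΩb w q) {T : 𝒯.cells} {x : Euc d}
    (hx : x ∈ interior (T : Set (Euc d))) :
    gradient q x = (hr.discreteGradient r hΩb).D x w := 𝒯.gradient_eq_gradAt r h c (hw T) hx

lemma gradPow_eq (hw : hr.Represents r hΩb w q) (g : ForchheimerPoly) :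
    gradPow Ω g.beta q = (hr.discreteGradient r hΩb).dissipation g (volume.restrict Ω) w :=
  integral_congr_ae (hr.ae_of_forall_mem_interior fun _ _ hx => by
    simp only [hw.gradient_eq hx])

lemma coeFn_ae_eq (hw : hr.Represents r hΩb w q) : (w : L2 Ω) =ᵐ[volume.restrict Ω] q := by
  obtain ⟨k, rfl⟩ := (hr.coefEquiv r hΩb).surjective w
  refine (𝒯.coeFn_toL2 r h c hΩb k).trans (hr.ae_of_forall_mem_interior fun T x hx => ?_)
  simp [hw T x hx, value]

lemma inner_eq (hw : hr.Represents r hΩb w q) (φ : L2 Ω) :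
    ⟪φ, (w : L2 Ω)⟫ = ∫ x in Ω, φ x * q x := by
  rw [L2.inner_def]
  refine integral_congr_ae (hw.coeFn_ae_eq.mono fun x hx => ?_)
  simp [hx, mul_comm]

lemma inner_eq_integral_mul (hw : hr.Represents r hΩb w q) (hv : hr.Represents r hΩb v p) :
    ⟪w, v⟫ = ∫ x in Ω, q x * p x :=
  (hv.inner_eq w).trans (integral_congr_ae (hw.coeFn_ae_eq.mono fun x hx => by simp only [hx]))

lemma normSqL2_eq (hw : hr.Represents r hΩb w q) : normSqL2 Ω q = ‖w‖ ^ 2 := by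
  rw [← real_inner_self_eq_norm_sq, hw.inner_eq_integral_mul hw]
  simp only [normSqL2, sq]

end Represents

lemma represents_of_isL2Proj {φ : L2 Ω} {q : Euc d → ℝ} (hq : 𝒯.IsL2Proj r φ q) :
    hr.Represents r hΩb ((𝒯.femSpace r h c hΩb).orthogonalProjectionOnto φ) q := by
  obtain ⟨w, hw⟩ := hr.exists_represents (hΩb := hΩb) hq.1
  suffices (𝒯.femSpace r h c hΩb).orthogonalProjectionOnto φ = w from this ▸ hw
  refine Subtype.ext (Submodule.eq_starProjection_of_mem_of_inner_eq_zero w.2 fun v hv => ?_)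
  have value_represents := hr.represents_value (⟨v, hv⟩ : 𝒯.femSpace r h c hΩb)
  rw [inner_sub_left, sub_eq_zero, value_represents.inner_eq,
    ← hq.2 _ (hr.value_mem_space _)]
  exact (hw.inner_eq_integral_mul value_represents).symm

end Triangulation.IsShapeRegular

namespace IsSemidiscreteSolution

variable {d r : ℕ} {Ω : Set (Euc d)} {g : ForchheimerPoly} {𝒯 : Triangulation Ω}
  {D : ProblemData Ω} {rhoT rho : ℝ → Euc d → ℝ} (hsol : IsSemidiscreteSolution g 𝒯 r D rhoT rho)
  {σ h : ℝ} {c : 𝒯.cells → Euc d} {hr : 𝒯.IsShapeRegular σ h c} {hΩb : Bornology.IsBounded Ω}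
  {u : ℝ → 𝒯.femSpace r h c hΩb}

include hsol

variable (hr hΩb) in
lemma exists_represents : ∃ u : ℝ → 𝒯.femSpace r h c hΩb,
    ∀ t, 0 ≤ t → hr.Represents r hΩb (u t) (rhoT t) := by
  have exists_at : ∀ t, ∃ w, 0 ≤ t → hr.Represents r hΩb w (rhoT t) := fun t => by
    by_cases ht : 0 ≤ t
    · exact (hr.exists_represents (hsol.mem t ht)).imp fun w hw _ => hw
    · exact ⟨0, fun ht' => absurd ht' ht⟩
  choose u hu using exists_at
  exact ⟨u, hu⟩

variable (hu : ∀ t, 0 ≤ t → hr.Represents r hΩb (u t) (rhoT t))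

include hu

lemma continuousOn_of_represents : ContinuousOn u (Ici 0) :=
  continuousOn_of_separating
    (ℓ := fun x : {x // ∃ T : 𝒯.cells, x ∈ interior (T : Set (Euc d))} => hr.value r hΩb x)
    (fun _ hv => hr.eq_zero_of_value_eq_zero fun T x hx => hv ⟨x, T, hx⟩)
    fun ⟨x, T, hx⟩ => (hsol.continuousOn T.1 T.2 x hx).congr fun t ht => (hu t ht T x hx).symm

omit hsol in
lemma value_eventuallyEq {t : ℝ} (ht : 0 < t) {T : 𝒯.cells} {x : Euc d}
    (hx : x ∈ interior (T : Set (Euc d))) :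
    (fun s => hr.value r hΩb x (u s)) =ᶠ[nhds t] fun s => rhoT s x := by
  filter_upwards [Ioi_mem_nhds ht] with s hs using (hu s (le_of_lt hs) T x hx).symm

lemma hasDerivAt_of_represents {t : ℝ} (ht : 0 < t) : HasDerivAt u (deriv u t) t :=
  (differentiableAt_of_separating
    (ℓ := fun x : {x // ∃ T : 𝒯.cells, x ∈ interior (T : Set (Euc d))} => hr.value r hΩb x)
    (fun _ hv => hr.eq_zero_of_value_eq_zero fun T x hx => hv ⟨x, T, hx⟩)
    fun ⟨x, T, hx⟩ => (hsol.differentiableAt T.1 T.2 x hx t ht).congr_of_eventuallyEq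
      (value_eventuallyEq hu ht hx)).hasDerivAt

lemma represents_timeDeriv {t : ℝ} (ht : 0 < t) :
    hr.Represents r hΩb (deriv u t) (timeDeriv rhoT t) := fun T x hx => by
  rw [timeDeriv, ← (value_eventuallyEq hu ht hx).deriv_eq]
  exact ((hr.value r hΩb x).hasFDerivAt.comp_hasDerivAt t
    (hsol.hasDerivAt_of_represents hu ht)).deriv

lemma represents_rho {t : ℝ} (ht : 0 ≤ t) : hr.Represents r hΩb
    (u t + (𝒯.femSpace r h c hΩb).orthogonalProjectionOnto (D.phi t)) (rho t) := by
  simpa using (hu t ht).add (hr.represents_of_isL2Proj (hsol.proj t ht))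

lemma deriv_add_energyGradient_eq {t : ℝ} (ht : 0 < t) :
    have := Triangulation.isFiniteMeasure_restrict hΩb
    deriv u t + (hr.discreteGradient r hΩb).energyGradient g (volume.restrict Ω)
      (u t + (𝒯.femSpace r h c hΩb).orthogonalProjectionOnto (D.phi t)) =
      (𝒯.femSpace r h c hΩb).orthogonalProjectionOnto (D.fTilde t) := by
  have := Triangulation.isFiniteMeasure_restrict hΩb
  refine ext_inner_right ℝ fun w => ?_
  have w_represents := hr.represents_value w
  rw [inner_add_left, Submodule.inner_orthogonalProjectionOnto_eq_of_mem_right,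
    w_represents.inner_eq, ← hsol.equation t ht _ (hr.value_mem_space w),
    (hsol.represents_timeDeriv hu ht).inner_eq_integral_mul w_represents,
    DiscreteGradient.inner_energyGradient]
  congr 1
  refine integral_congr_ae (hr.ae_of_forall_mem_interior fun T x hx => ?_)
  simp only [(hsol.represents_rho hu ht.le).gradient_eq hx, w_represents.gradient_eq hx,
    ForchheimerPoly.flux]

end IsSemidiscreteSolution

/-! ### The estimates for the semidiscrete problem -/

namespace ProblemData

variable {d : ℕ} {Ω : Set (Euc d)} (D : ProblemData Ω)

lemma continuousOn_phi : ContinuousOn D.phi (Ici 0) := fun t ht =>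
  (D.hasDeriv_phi t ht).continuousWithinAt

lemma hasDerivAt_phi {t : ℝ} (ht : 0 < t) : HasDerivAt D.phi (D.phi_t t) t :=
  (D.hasDeriv_phi t ht.le).hasDerivAt (Ici_mem_nhds ht)

lemma continuousOn_fTilde : ContinuousOn D.fTilde (Ici 0) :=
  D.continuousOn_f.sub D.continuousOn_phi_t

lemma continuousOn_phiH1Sq : ContinuousOn D.phiH1Sq (Ici 0) :=
  (D.continuousOn_phi.norm.pow 2).add (D.continuousOn_grad_phi.norm.pow 2)

lemma continuousOn_phitH1Sq : ContinuousOn D.phitH1Sq (Ici 0) :=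
  (D.continuousOn_phi_t.norm.pow 2).add (D.continuousOn_grad_phi_t.norm.pow 2)

lemma continuousOn_gFun (g : ForchheimerPoly) : ContinuousOn (D.gFun g) (Ici 0) :=
  (D.continuousOn_fTilde.norm.rpow_const fun _ _ =>
    Or.inr (zero_le_two.trans g.two_le_lam)).add D.continuousOn_phiH1Sq

end ProblemData

/-- Uniform estimates for the discrete gradient on `W_h`: `S` is the constant of the broken
Poincaré inequality, `B` bounds the broken `H¹` seminorm of `L²(Ω)`-projections. -/
structure Triangulation.IsShapeRegular.HasEstimates {d : ℕ} {Ω : Set (Euc d)} {𝒯 : Triangulation Ω}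
    {σ h : ℝ} {c : 𝒯.cells → Euc d} (hr : 𝒯.IsShapeRegular σ h c) (r : ℕ)
    (hΩb : Bornology.IsBounded Ω) (g : ForchheimerPoly) (S B : ℝ) : Prop where
  poincare : ∀ w, ∃ n ∈ (hr.discreteGradient r hΩb).constants, ‖w - n‖ ^ g.beta ≤
    S * (hr.discreteGradient r hΩb).dissipation g (volume.restrict Ω) w
  projection : ∀ {φ G}, IsWeakGradient Ω φ G → ∫ x in Ω, ‖(hr.discreteGradient r hΩb).D x
    ((𝒯.femSpace r h c hΩb).orthogonalProjectionOnto φ)‖ ^ 2 ≤ B * ‖G‖ ^ 2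

lemma ForchheimerPoly.sobolev_exponent_nonneg {d : ℕ} (g : ForchheimerPoly)
    (hdeg : g.a ≤ 4 / ((d : ℝ) + 2)) : 0 ≤ ((d : ℝ) + 2) * g.beta / 2 - d := by
  rw [le_div_iff₀ (by positivity)] at hdeg
  rw [ForchheimerPoly.beta]
  linarith

lemma Triangulation.exists_hasEstimates (d r : ℕ) (g : ForchheimerPoly)
    (hdeg : g.a ≤ 4 / ((d : ℝ) + 2)) {σ H : ℝ} (hσ : 0 < σ) (hH : 0 ≤ H) :
    ∃ S B : ℝ, 0 < S ∧ 0 ≤ B ∧ ∀ {Ω : Set (Euc d)} (_ : IsOpen Ω) (hΩb : Bornology.IsBounded Ω)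
      {𝒯 : Triangulation Ω} {h : ℝ} {c : 𝒯.cells → Euc d} (hr : 𝒯.IsShapeRegular σ h c),
      h ≤ H → hr.HasEstimates r hΩb g S B := by
  obtain ⟨S, hS, poincare⟩ := exists_broken_poincare d r hσ g.beta_pos g.beta_lt_two
    (g.sobolev_exponent_nonneg hdeg) hH
  obtain ⟨B, hB, projection⟩ := exists_projection_stability d r hσ
  refine ⟨S, B, hS, hB, fun hΩo hΩb _ _ _ hr hhH => ⟨fun w => ?_, fun {φ G} hG => ?_⟩⟩
  · obtain ⟨k, rfl⟩ := (hr.coefEquiv r hΩb).surjective w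
    obtain ⟨n, grad_n, norm_le⟩ := poincare hΩb hr hhH k
    refine ⟨hr.coefEquiv r hΩb n, DiscreteGradient.mem_constants.2 fun x => ?_, ?_⟩
    · simpa [IsShapeRegular.discreteGradient] using grad_n x
    · rw [← map_sub]
      exact norm_le.trans_eq (by
        simp [DiscreteGradient.dissipation, IsShapeRegular.discreteGradient])
  · refine projection hΩo hΩb hr hG ((hr.coefEquiv r hΩb).symm _) ?_
    exact congrArg Subtype.val ((hr.coefEquiv r hΩb).apply_symm_apply _)

/-- The energy profile `𝓔` describes the solution `ρ̃_h`, `ρ_h` of the semidiscrete problem with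
data `D`. -/
structure EnergyProfile.Describes {g : ForchheimerPoly} {c C : ℝ} (𝓔 : EnergyProfile g.beta c C)
    {d : ℕ} {Ω : Set (Euc d)} (D : ProblemData Ω) (rhoT rho : ℝ → Euc d → ℝ) : Prop where
  A_eq : ∀ t, 0 ≤ t → 𝓔.A t = gradPow Ω g.beta (rho t)
  R_eq : ∀ t, 0 < t → 𝓔.R t = normSqL2 Ω (timeDeriv rhoT t)
  z_le : ∀ t, 0 ≤ t → 𝓔.z t ≤ normSqL2 Ω (rhoT t)
  z_zero_le : 𝓔.z 0 ≤ ‖D.rhoTilde0‖ ^ 2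
  F_le : ∀ t, 𝓔.F t ≤ D.gFun g t
  F'_eq : 𝓔.F' = D.phitH1Sq

namespace IsSemidiscreteSolution

variable {d r : ℕ} {Ω : Set (Euc d)} {g : ForchheimerPoly} {𝒯 : Triangulation Ω}
  {D : ProblemData Ω} {rhoT rho : ℝ → Euc d → ℝ} (hsol : IsSemidiscreteSolution g 𝒯 r D rhoT rho)
  {σ h : ℝ} {c : 𝒯.cells → Euc d} {hr : 𝒯.IsShapeRegular σ h c} {hΩb : Bornology.IsBounded Ω}
  {u : ℝ → 𝒯.femSpace r h c hΩb} (hu : ∀ t, 0 ≤ t → hr.Represents r hΩb (u t) (rhoT t))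
  {S B : ℝ} (hest : hr.HasEstimates r hΩb g S B)

include hsol hu in
lemma norm_zero_le : ‖u 0‖ ≤ ‖D.rhoTilde0‖ := by
  refine le_trans (le_of_eq ?_)
    ((𝒯.femSpace r h c hΩb).norm_orthogonalProjectionOnto_apply_le D.rhoTilde0)
  rw [← sq_eq_sq₀ (norm_nonneg _) (norm_nonneg _), ← (hu 0 le_rfl).normSqL2_eq,
    ← (hr.represents_of_isL2Proj hsol.init).normSqL2_eq]

/-- The evolution of the representative `u` of `ρ̃_h` in `W_h ⊆ L²(Ω)`. -/
def galerkinFlow (hB : 0 ≤ B) :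
    GalerkinFlow g (volume.restrict Ω) (Euc d) (𝒯.femSpace r h c hΩb) S B where
  toDiscreteGradient := hr.discreteGradient r hΩb
  u := u
  u_t := deriv u
  p t := (𝒯.femSpace r h c hΩb).orthogonalProjectionOnto (D.phi t)
  p_t t := (𝒯.femSpace r h c hΩb).orthogonalProjectionOnto (D.phi_t t)
  f t := (𝒯.femSpace r h c hΩb).orthogonalProjectionOnto (D.fTilde t)
  P := D.phiH1Sq
  P_t := D.phitH1Sq
  poincare := hest.poincare
  continuousOn_u := hsol.continuousOn_of_represents hu
  hasDerivAt_u _ := hsol.hasDerivAt_of_represents hu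
  continuousOn_p := (ContinuousLinearMap.continuous _).comp_continuousOn D.continuousOn_phi
  hasDerivAt_p _ ht := (ContinuousLinearMap.hasFDerivAt _).comp_hasDerivAt _ (D.hasDerivAt_phi ht)
  continuousOn_f := (ContinuousLinearMap.continuous _).comp_continuousOn D.continuousOn_fTilde
  continuousOn_P := D.continuousOn_phiH1Sq
  continuousOn_P_t := D.continuousOn_phitH1Sq
  P_nonneg _ := add_nonneg (sq_nonneg _) (sq_nonneg _)
  P_t_nonneg _ := add_nonneg (sq_nonneg _) (sq_nonneg _)
  integral_p_le t ht := (hest.projection (D.isWeakGradient_phi t ht.le)).trans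
    (mul_le_mul_of_nonneg_left (le_add_of_nonneg_left (sq_nonneg _)) hB)
  integral_p_t_le t ht := (hest.projection (D.isWeakGradient_phi_t t ht.le)).trans
    (mul_le_mul_of_nonneg_left (le_add_of_nonneg_left (sq_nonneg _)) hB)
  equation _ := hsol.deriv_add_energyGradient_eq hu

lemma describes_energyProfile [IsFiniteMeasure (volume.restrict Ω)] {k K : ℝ}
    (hg : g.GrowthBounds (Euc d) k K) (hS : 0 < S) (hB : 0 ≤ B) :
    ((hsol.galerkinFlow hu hest hB).energyProfile hg hS hB).Describes D rhoT rho where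
  A_eq _ ht := ((hsol.represents_rho hu ht).gradPow_eq g).symm
  R_eq _ ht := (hsol.represents_timeDeriv hu ht).normSqL2_eq.symm
  z_le t ht := (pow_le_pow_left₀ (norm_nonneg _)
    (DiscreteGradient.norm_fluctuation_le _ _) 2).trans_eq (hu t ht).normSqL2_eq.symm
  z_zero_le := pow_le_pow_left₀ (norm_nonneg _)
    ((DiscreteGradient.norm_fluctuation_le _ _).trans (hsol.norm_zero_le hu)) 2
  F_le _ := add_le_add_left (Real.rpow_le_rpow (norm_nonneg _)
    (Submodule.norm_orthogonalProjectionOnto_apply_le _ _) (zero_le_two.trans g.two_le_lam)) _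
  F'_eq := rfl

end IsSemidiscreteSolution

lemma exists_energyProfile {d : ℕ} {g : ForchheimerPoly} (hdeg : g.a ≤ 4 / ((d : ℝ) + 2))
    {Ω : Set (Euc d)} (hΩo : IsOpen Ω) (hΩb : Bornology.IsBounded Ω) (r : ℕ) {σ : ℝ}
    (hσ : 0 < σ) : ∃ c C : ℝ, 0 < c ∧ 0 < C ∧ ∀ {𝒯 : Triangulation Ω}, 𝒯.IsQuasiUniform σ →
      ∀ {D : ProblemData Ω} {rhoT rho : ℝ → Euc d → ℝ}, IsSemidiscreteSolution g 𝒯 r D rhoT rho →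
        ∃ 𝓔 : EnergyProfile g.beta c C, 𝓔.Describes D rhoT rho := by
  have := Triangulation.isFiniteMeasure_restrict hΩb
  obtain ⟨c, C, hg⟩ := g.exists_growthBounds (Euc d)
  obtain ⟨S, B, hS, hB, hest⟩ := Triangulation.exists_hasEstimates d r g hdeg hσ
    (H := 2 * Metric.diam Ω / σ + 1) (by positivity)
  refine ⟨c, _, hg.lower_pos,
    GalerkinFlow.upperConst_pos g hg.lower_pos hg.upper_pos hS hB
      (measureReal_nonneg (μ := volume.restrict Ω) (s := univ)),
    fun hq _ _ _ hsol => ?_⟩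
  obtain ⟨h, center, hhH, hr⟩ := hq.exists_isShapeRegular hσ hΩb
  obtain ⟨u, hu⟩ := hsol.exists_represents hr hΩb
  exact ⟨_, hsol.describes_energyProfile hu (hest hΩo hΩb hr hhH) hg hS hB⟩

namespace EnergyProfile.Describes

variable {g : ForchheimerPoly} {c C : ℝ} {𝓔 : EnergyProfile g.beta c C} {d : ℕ} {Ω : Set (Euc d)}
  {D : ProblemData Ω} {rhoT rho : ℝ → Euc d → ℝ} (h𝓔 : 𝓔.Describes D rhoT rho) {s t : ℝ}

include h𝓔

lemma eqOn_A (hs : 0 ≤ s) (hst : s ≤ t) :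
    EqOn 𝓔.A (fun τ => gradPow Ω g.beta (rho τ)) (uIcc s t) := by
  rw [uIcc_of_le hst]
  exact fun τ hτ => h𝓔.A_eq τ (hs.trans hτ.1)

lemma eqOn_R (hs : 0 < s) (hst : s ≤ t) :
    EqOn 𝓔.R (fun τ => normSqL2 Ω (timeDeriv rhoT τ)) (uIcc s t) := by
  rw [uIcc_of_le hst]
  exact fun τ hτ => h𝓔.R_eq τ (hs.trans_le hτ.1)

lemma intervalIntegrable_gradPow (hs : 0 ≤ s) (hst : s ≤ t) :
    IntervalIntegrable (fun τ => gradPow Ω g.beta (rho τ)) volume s t :=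
  (intervalIntegrable_of_continuousOn_Ici 𝓔.continuousOn_A hs hst).congr
    ((h𝓔.eqOn_A hs hst).mono uIoc_subset_uIcc)

lemma intervalIntegrable_normSqL2_timeDeriv (hs : 0 < s) (hst : s ≤ t) :
    IntervalIntegrable (fun τ => normSqL2 Ω (timeDeriv rhoT τ)) volume s t :=
  (ContinuousOn.intervalIntegrable_of_Icc hst
    (𝓔.continuousOn_R.mono fun _ hτ => hs.trans_le hτ.1)).congr
    ((h𝓔.eqOn_R hs hst).mono uIoc_subset_uIcc)

lemma integral_F_le (hs : 0 ≤ s) (hst : s ≤ t) :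
    ∫ τ in s..t, 𝓔.F τ ≤ ∫ τ in s..t, (D.phiH1Sq τ + ‖D.fTilde τ‖ ^ g.lam) := by
  simp_rw [add_comm (D.phiH1Sq _)]
  exact intervalIntegral.integral_mono_on hst
    (intervalIntegrable_of_continuousOn_Ici 𝓔.continuousOn_F hs hst)
    (intervalIntegrable_of_continuousOn_Ici (D.continuousOn_gFun g) hs hst) fun τ _ => h𝓔.F_le τ

lemma integral_F_add_F'_le (hs : 0 ≤ s) (hst : s ≤ t) : ∫ τ in s..t, (𝓔.F τ + 𝓔.F' τ) ≤
    ∫ τ in s..t, (D.phiH1Sq τ + D.phitH1Sq τ + ‖D.fTilde τ‖ ^ g.lam) := by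
  have rearrange : ∀ τ, D.phiH1Sq τ + D.phitH1Sq τ + ‖D.fTilde τ‖ ^ g.lam =
      D.gFun g τ + D.phitH1Sq τ := fun τ => by rw [ProblemData.gFun]; ring
  simp_rw [rearrange, h𝓔.F'_eq]
  exact intervalIntegral.integral_mono_on hst
    (intervalIntegrable_of_continuousOn_Ici (𝓔.continuousOn_F.add D.continuousOn_phitH1Sq) hs hst)
    (intervalIntegrable_of_continuousOn_Ici
      ((D.continuousOn_gFun g).add D.continuousOn_phitH1Sq) hs hst)
    fun τ _ => add_le_add_left (h𝓔.F_le τ) _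

lemma F_le_of_isEnvelope {E : ℝ → ℝ} (hE : IsEnvelope (D.gFun g) E) (hs : s ∈ Icc 0 t) :
    𝓔.F s ≤ E t :=
  (h𝓔.F_le s).trans ((hE.le s hs.1).trans (hE.monotoneOn hs.1 (hs.1.trans hs.2) hs.2))

end EnergyProfile.Describes

theorem theorem4p3_general (d : ℕ) (g : ForchheimerPoly)
    (hdeg : g.a ≤ 4 / ((d : ℝ) + 2))
    (Ω : Set (Euc d)) (hΩo : IsOpen Ω) (hΩb : Bornology.IsBounded Ω)
    (r : ℕ) (σ : ℝ) (hσ : 0 < σ) :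
    ∃ C : ℝ, 0 < C ∧
      ∀ 𝒯 : Triangulation Ω, 𝒯.IsQuasiUniform σ →
      ∀ (D : ProblemData Ω) (rhoT rho : ℝ → Euc d → ℝ),
        IsSemidiscreteSolution g 𝒯 r D rhoT rho →
        (∀ t : ℝ, 1 ≤ t →
          IntervalIntegrable (fun τ => gradPow Ω g.beta (rho τ)) volume (t - 1) t ∧
          ∫ τ in (t - 1)..t, gradPow Ω g.beta (rho τ) ≤
            C * (1 + normSqL2 Ω (rhoT (t - 1)) +
              ∫ τ in (t - 1)..t, (D.phiH1Sq τ + ‖D.fTilde τ‖ ^ g.lam))) ∧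
        (∀ t : ℝ, 1 ≤ t →
          IntervalIntegrable (fun τ => normSqL2 Ω (timeDeriv rhoT τ)) volume (t - 1 / 2) t ∧
          (∫ τ in (t - 1 / 2)..t, normSqL2 Ω (timeDeriv rhoT τ)) + gradPow Ω g.beta (rho t) ≤
            C * normSqL2 Ω (rhoT (t - 1)) +
              C * (1 + ∫ τ in (t - 1)..t,
                (D.phiH1Sq τ + D.phitH1Sq τ + ‖D.fTilde τ‖ ^ g.lam))) ∧
        (∀ E : ℝ → ℝ, IsEnvelope (D.gFun g) E → ∀ t : ℝ, 1 ≤ t →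
          gradPow Ω g.beta (rho t) ≤
            C * (1 + ‖D.rhoTilde0‖ ^ 2 + E t ^ (2 / g.beta) +
              ∫ τ in (t - 1)..t, D.phitH1Sq τ)) := by
  obtain ⟨c, C, hc, hC, exists_profile⟩ := exists_energyProfile hdeg hΩo hΩb r hσ
  obtain ⟨M, hM, estimates⟩ :=
    EnergyProfile.exists_estimates g.beta_pos g.beta_lt_two.le hc hC
  refine ⟨M, hM, fun 𝒯 hq D rhoT rho hsol => ?_⟩
  obtain ⟨𝓔, h𝓔⟩ := exists_profile hq hsol
  refine ⟨fun t ht => ?_, fun t ht => ?_, fun E hE t ht => ?_⟩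
  · have hs : 0 ≤ t - 1 := by linarith
    have hst : t - 1 ≤ t := by linarith
    refine ⟨h𝓔.intervalIntegrable_gradPow hs hst, ?_⟩
    rw [← intervalIntegral.integral_congr (h𝓔.eqOn_A hs hst)]
    refine (estimates 𝓔 t ht).1.trans ?_
    gcongr
    exacts [h𝓔.z_le _ hs, h𝓔.integral_F_le hs hst]
  · have hs : 0 < t - 1 / 2 := by linarith
    have hst : t - 1 / 2 ≤ t := by linarith
    refine ⟨h𝓔.intervalIntegrable_normSqL2_timeDeriv hs hst, ?_⟩
    rw [← intervalIntegral.integral_congr (h𝓔.eqOn_R hs hst), ← h𝓔.A_eq t (by linarith), ← mul_add,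
      add_left_comm, ← add_assoc]
    refine (estimates 𝓔 t ht).2.1.trans ?_
    gcongr
    exacts [h𝓔.z_le _ (by linarith), h𝓔.integral_F_add_F'_le (by linarith) (by linarith)]
  · rw [← h𝓔.A_eq t (by linarith), ← h𝓔.F'_eq]
    refine ((estimates 𝓔 t ht).2.2 _ fun s => h𝓔.F_le_of_isEnvelope hE).trans ?_
    gcongr
    exact h𝓔.z_zero_le

end

theorem theorem4p3 (d : ℕ) (hd : 2 ≤ d) (g : ForchheimerPoly)
    (hdeg : g.a ≤ 4 / ((d : ℝ) + 2))
    (Ω : Set (Euc d)) (hΩo : IsOpen Ω) (hΩb : Bornology.IsBounded Ω)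
    (r : ℕ) (σ : ℝ) (hσ : 0 < σ) :
    ∃ C : ℝ, 0 < C ∧
      ∀ 𝒯 : Triangulation Ω, 𝒯.IsQuasiUniform σ →
      ∀ (D : ProblemData Ω) (rhoT rho : ℝ → Euc d → ℝ),
        IsSemidiscreteSolution g 𝒯 r D rhoT rho →
        (∀ t : ℝ, 1 ≤ t →
          IntervalIntegrable (fun τ => gradPow Ω g.beta (rho τ)) volume (t - 1) t ∧
          ∫ τ in (t - 1)..t, gradPow Ω g.beta (rho τ) ≤
            C * (1 + normSqL2 Ω (rhoT (t - 1)) +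
              ∫ τ in (t - 1)..t, (D.phiH1Sq τ + ‖D.fTilde τ‖ ^ g.lam))) ∧
        (∀ t : ℝ, 1 ≤ t →
          IntervalIntegrable (fun τ => normSqL2 Ω (timeDeriv rhoT τ)) volume (t - 1 / 2) t ∧
          (∫ τ in (t - 1 / 2)..t, normSqL2 Ω (timeDeriv rhoT τ)) + gradPow Ω g.beta (rho t) ≤
            C * normSqL2 Ω (rhoT (t - 1)) +
              C * (1 + ∫ τ in (t - 1)..t,
                (D.phiH1Sq τ + D.phitH1Sq τ + ‖D.fTilde τ‖ ^ g.lam))) ∧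
        (∀ E : ℝ → ℝ, IsEnvelope (D.gFun g) E → ∀ t : ℝ, 1 ≤ t →
          gradPow Ω g.beta (rho t) ≤
            C * (1 + ‖D.rhoTilde0‖ ^ 2 + E t ^ (2 / g.beta) +
              ∫ τ in (t - 1)..t, D.phitH1Sq τ)) :=
  theorem4p3_general d g hdeg Ω hΩo hΩb r σ hσ
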